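/- Let $P\subset\mathbb R^d$ be a parallelohedron, that is, a $d$-dimensional convex polytope whose translates tile $\mathbb R^d$ face-to-face (distinct cells have disjoint interiors, and the intersection of any two cells is empty or a common face of both). Let $\mathcal T_P$ be a face-to-face tiling of $\mathbb R^d$ by translates of $P$. A *Voronoi parallelohedron* is the Dirichlet domain $\{x\in\mathbb R^d:\ \|x-p\|\le\|x-q\|\ \text{for all } q\in\Lambda\}$ of a point $p$ of some $d$-dimensional lattice $\Lambda\subset\mathbb R^d$. The Voronoi conjecture *holds for $P$* if some invertible affine transformation of $\mathbb R^d$ maps $P$ onto a Voronoi parallelohedron. A *canonical scaling* of $\mathcal T_P$ is a function $s$ that assigns a positive real number to each $(d-1)$-face of the tiling such that for every $(d-2)$-face $G$ of the tiling $$\sum_{i=1}^{k}s(F_i)\,\mathbf n_i=0,$$ where $F_1,\dots,F_k$ are all the $(d-1)$-faces of the tiling that contain $G$, and $\mathbf n_i$ is the unit normal to $F_i$ that points in the direction of traversal when one goes around $G$ in one of the two possible directions, the same for all $i$ (the choice of this direction only affects the sign of the sum). Then the Voronoi conjecture holds for $P$ if and only if $\mathcal T_P$ has a canonical scaling. -/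

import Mathlib

open scoped Pointwise

/-- A `d`-dimensional convex polytope in `ℝ^d`: the convex hull of a finite set of points,
with nonempty interior. -/
def IsFullDimPolytope {d : ℕ} (P : Set (EuclideanSpace ℝ (Fin d))) : Prop :=
  (∃ V : Set (EuclideanSpace ℝ (Fin d)), V.Finite ∧ P = convexHull ℝ V) ∧ (interior P).Nonempty

/-- `T` is a normal (face-to-face) tiling of `ℝ^d` by translates of `P`: its cells are translates
of `P`, they cover the space, distinct cells have disjoint interiors, and the intersection of any
two cells is a common face of both. (`IsExposed ℝ Q F` says that `F` is empty or is the set of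
maximizers on `Q` of a linear functional; for a polytope `Q` these are exactly its faces, with
`∅` and `Q` included.) -/
structure IsNormalTranslateTiling {d : ℕ} (P : Set (EuclideanSpace ℝ (Fin d)))
    (T : Set (Set (EuclideanSpace ℝ (Fin d)))) : Prop where
  translate : ∀ Q ∈ T, ∃ t : EuclideanSpace ℝ (Fin d), Q = t +ᵥ P
  cover : ⋃₀ T = Set.univ
  disjoint : ∀ Q ∈ T, ∀ R ∈ T, Q ≠ R → Disjoint (interior Q) (interior R)
  face_to_face : ∀ Q ∈ T, ∀ R ∈ T, IsExposed ℝ Q (Q ∩ R) ∧ IsExposed ℝ R (Q ∩ R)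

/-- A parallelohedron: a convex polytope whose translates tile the space face-to-face. -/
def IsParallelohedron {d : ℕ} (P : Set (EuclideanSpace ℝ (Fin d))) : Prop :=
  IsFullDimPolytope P ∧ ∃ T : Set (Set (EuclideanSpace ℝ (Fin d))), IsNormalTranslateTiling P T

/-- The Dirichlet domain of the point `p` with respect to the set `Λ`. -/
def dirichletDomain {d : ℕ} (Λ : Set (EuclideanSpace ℝ (Fin d))) (p : EuclideanSpace ℝ (Fin d)) :
    Set (EuclideanSpace ℝ (Fin d)) :=
  {x | ∀ q ∈ Λ, ‖x - p‖ ≤ ‖x - q‖}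

/-- A Voronoi parallelohedron: the Dirichlet domain of a point of a `d`-dimensional lattice. -/
def IsVoronoiParallelohedron {d : ℕ} (V : Set (EuclideanSpace ℝ (Fin d))) : Prop :=
  ∃ (Λ : Submodule ℤ (EuclideanSpace ℝ (Fin d))) (_ : DiscreteTopology Λ),
    IsZLattice ℝ Λ ∧ ∃ p ∈ Λ, V = dirichletDomain (Λ : Set (EuclideanSpace ℝ (Fin d))) p

/-- The Voronoi conjecture holds for `P`: some nondegenerate affine transformation maps `P` onto a
Voronoi parallelohedron. -/
def VoronoiConjectureHoldsFor {d : ℕ} (P : Set (EuclideanSpace ℝ (Fin d))) : Prop :=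
  ∃ f : EuclideanSpace ℝ (Fin d) ≃ᵃ[ℝ] EuclideanSpace ℝ (Fin d),
    IsVoronoiParallelohedron (f '' P)

/-- `F` is a (nonempty) face of codimension `k` of the tiling `T`, i.e. a `(d-k)`-dimensional face
of one of its cells. -/
def IsTilingFace {d : ℕ} (T : Set (Set (EuclideanSpace ℝ (Fin d)))) (k : ℕ)
    (F : Set (EuclideanSpace ℝ (Fin d))) : Prop :=
  F.Nonempty ∧ (∃ Q ∈ T, IsExposed ℝ Q F) ∧ Module.finrank ℝ (vectorSpan ℝ F) + k = d

/-- The hyperfaces (`(d-1)`-faces) of the tiling `T` that contain the set `G`. -/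
def facetsAround {d : ℕ} (T : Set (Set (EuclideanSpace ℝ (Fin d))))
    (G : Set (EuclideanSpace ℝ (Fin d))) : Set (Set (EuclideanSpace ℝ (Fin d))) :=
  {F | IsTilingFace T 1 F ∧ G ⊆ F}

/-- `n` assigns to the hyperfaces around the `(d-2)`-face `G` unit normals that agree with one of
the two directions of going around `G`.

Such a direction is an orientation of the two-dimensional quotient of `ℝ^d` by the directions of
`G`. The orientation is given by a nonzero alternating form `ω` whose kernel contains
the directions of `G`. In the quotient, `G` becomes a point and each hyperface `F ⊇ G` a segment
starting at this point; the normal `n F` has to point to the positive side of that segment. -/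
def AreCoherentNormals {d : ℕ} (T : Set (Set (EuclideanSpace ℝ (Fin d))))
    (G : Set (EuclideanSpace ℝ (Fin d)))
    (n : Set (EuclideanSpace ℝ (Fin d)) → EuclideanSpace ℝ (Fin d)) : Prop :=
  ∃ ω : EuclideanSpace ℝ (Fin d) →ₗ[ℝ] EuclideanSpace ℝ (Fin d) →ₗ[ℝ] ℝ,
    ω ≠ 0 ∧ ω.IsAlt ∧ (∀ v ∈ vectorSpan ℝ G, ω v = 0) ∧
    ∀ F ∈ facetsAround T G,
      ‖n F‖ = 1 ∧ (∀ v ∈ vectorSpan ℝ F, inner ℝ v (n F) = 0) ∧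
      ∀ x ∈ G, ∀ y ∈ F \ G, 0 < ω (y - x) (n F)

/-- The torsion of the scaling `s` around the `(d-2)`-face `G`, computed with the normals `n`. The
sum is over the hyperfaces containing `G`; there are finitely many of them in a tiling by
translates of a polytope. -/
noncomputable def torsion {d : ℕ} (T : Set (Set (EuclideanSpace ℝ (Fin d))))
    (s : Set (EuclideanSpace ℝ (Fin d)) → ℝ)
    (n : Set (EuclideanSpace ℝ (Fin d)) → EuclideanSpace ℝ (Fin d))
    (G : Set (EuclideanSpace ℝ (Fin d))) : EuclideanSpace ℝ (Fin d) :=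
  ∑ᶠ F ∈ facetsAround T G, s F • n F

/-- `s` is a canonical scaling of the tiling `T`: it is positive on all hyperfaces (its values on
other sets play no role) and has zero torsion around every `(d-2)`-face. -/
def IsCanonicalScaling {d : ℕ} (T : Set (Set (EuclideanSpace ℝ (Fin d))))
    (s : Set (EuclideanSpace ℝ (Fin d)) → ℝ) : Prop :=
  (∀ F, IsTilingFace T 1 F → 0 < s F) ∧
  ∀ G, IsTilingFace T 2 G → ∀ n, AreCoherentNormals T G n → torsion T s n G = 0

/-! Suppose first that an affine map with linear part `L` carries `P` onto a Dirichlet domain, and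
put `A = L* L`. If `P` and `v + P` share a facet with unit normal `n` directed towards `v + P`, the
facet lies in the bisector of `v` for the metric given by `A`. Hence `A v` is a positive multiple of
`n` (`exists_pos_smul_normal`). The length of `A` applied to the difference of the translation
vectors of the two adjacent cells is then a scaling. Around a ridge its torsion is a cyclic sum of
differences `A t_R - A t_Q`, so it vanishes.

Conversely, let `s` be a canonical scaling. Zero torsion says that the jumps `s F • n` across facets
integrate around every ridge. The complement of the faces of codimension at least three behaves like
a simply connected space: generic segments and triangles miss these faces. So the jumps integrate
globally to a function `a` on cells, the gradient of Voronoi's generatrix (`exists_potential`,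
`exists_gradient`).

This gradient need not be additive on the lattice generated by the facet vectors. But going from a
cell to its translate by `v + w` in the two possible orders, and using independence of the two
normals, shows that the increment along `v` does not change under translation by a facet vector `w ≠
± v`. Averaging the increments gives factors `κ v > 0` for which every integer relation between
facet vectors also holds between the vectors `κ v • n v` (`exists_relation_map`). Thus a linear map
`A` sends each facet vector to a positive multiple of its normal.

Now integrate once more. The heights of the affine pieces with gradients `A t` exist, because a
point of a ridge lies on all facets around it. They form a quadratic function on the lattice.
Commutativity of addition forces `A` to be symmetric, and the additive remainder of the heights
supplies a centre, so that all facets bisect their facet vectors in the form of `A`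
(`isSymmetric_and_bisect`). The form is nonnegative since the gradient is monotone along segments,
and its kernel is trivial since a kernel vector would translate the bounded set `P` into itself. A
square root of `A` makes the form Euclidean. The Dirichlet domain is then cut out by inequalities
that include those of the facets, so it lies in `P`; the reverse inclusion holds because both tile
by the same lattice (`exists_mem_iff_norm_le`). -/

namespace Parallelohedron

open Set Module

set_option linter.unusedSectionVars false

variable {E : Type*} [NormedAddCommGroup E] [InnerProductSpace ℝ E] [FiniteDimensional ℝ E]

/-! ### Relative interiors and exposed faces -/

/-- `w` lies in the (algebraic) relative interior of `F`. -/
def RelInt (F : Set E) (w : E) : Prop :=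
  w ∈ F ∧ ∀ u ∈ vectorSpan ℝ F, ∃ ε > (0 : ℝ), w + ε • u ∈ F

theorem exists_relInt {F : Set E} (hF : Convex ℝ F) (hne : F.Nonempty) : ∃ w, RelInt F w := by
  obtain ⟨w, hw⟩ := hne.intrinsicInterior hF
  refine ⟨w, intrinsicInterior_subset hw, fun u hu => ?_⟩
  obtain ⟨y, hy, rfl⟩ := mem_intrinsicInterior.1 hw
  have hu' : u ∈ (affineSpan ℝ F).direction := by rwa [direction_affineSpan]
  have hmem : ∀ t : ℝ, (y : E) + t • u ∈ affineSpan ℝ F := fun t => by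
    have := AffineSubspace.vadd_mem_of_mem_direction (Submodule.smul_mem _ t hu') y.2
    rwa [vadd_eq_add, add_comm] at this
  let f : ℝ → affineSpan ℝ F := fun t => ⟨(y : E) + t • u, hmem t⟩
  have hf : Continuous f := by
    refine Continuous.subtype_mk ?_ _
    fun_prop
  have hf0 : f 0 = y := by ext; simp [f]
  have hn : f ⁻¹' (interior (Subtype.val ⁻¹' F)) ∈ nhds (0 : ℝ) :=
    (isOpen_interior.preimage hf).mem_nhds (by simpa [hf0] using hy)
  obtain ⟨ε, hε, hb⟩ := Metric.mem_nhds_iff.1 hn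
  refine ⟨ε / 2, by positivity, ?_⟩
  have h2 : ε / 2 ∈ Metric.ball (0 : ℝ) ε := by
    simp only [Metric.mem_ball, dist_zero_right, Real.norm_eq_abs]
    rw [abs_of_pos (by positivity)]; linarith
  have h3 : f (ε / 2) ∈ Subtype.val ⁻¹' F := interior_subset (hb h2)
  exact h3

theorem sub_mem_vectorSpan {F : Set E} {x y : E} (hx : x ∈ F) (hy : y ∈ F) :
    x - y ∈ vectorSpan ℝ F := vsub_mem_vectorSpan ℝ hx hy

/-- A continuous linear functional that is constant on `F` vanishes on its directions. -/
theorem map_vectorSpan_eq_zero {F : Set E} (l : E →ₗ[ℝ] ℝ) {w : E} (hc : ∀ x ∈ F, l x = l w)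
    {u : E} (hu : u ∈ vectorSpan ℝ F) : l u = 0 := by
  have : vectorSpan ℝ F ≤ LinearMap.ker l := by
    rw [vectorSpan_def, Submodule.span_le]
    rintro _ ⟨x, hx, y, hy, rfl⟩
    simp [hc x hx, hc y hy]
  exact this hu

/-- From a relatively interior point one can move slightly away from any `x` inside `F`, so a
maximum at `w` forces constancy. -/
theorem RelInt.eq_of_le {F : Set E} {w : E} (hw : RelInt F w) (l : E →ₗ[ℝ] ℝ)
    (hl : ∀ x ∈ F, l x ≤ l w) : ∀ x ∈ F, l x = l w := by
  intro x hx
  refine le_antisymm (hl x hx) ?_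
  obtain ⟨ε, hε, he⟩ := hw.2 (w - x) (sub_mem_vectorSpan hw.1 hx)
  have := hl _ he
  simp only [map_add, map_smul, map_sub, smul_eq_mul] at this
  nlinarith

/-- The functional exposing `K` is maximal at `w`, hence constant on `F`. This is how one relatively
interior point controls which cells contain a whole face. -/
theorem exposed_subset_of_relInt {Q K F : Set E} {w : E} (hK : IsExposed ℝ Q K) (hFQ : F ⊆ Q)
    (hw : RelInt F w) (hwK : w ∈ K) : F ⊆ K := by
  obtain ⟨l, hl⟩ := hK ⟨w, hwK⟩
  rw [hl] at hwK ⊢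
  intro x hx
  refine ⟨hFQ hx, fun y hy => ?_⟩
  have h : l x = l w := hw.eq_of_le l.toLinearMap (fun x hx => hwK.2 x (hFQ hx)) x hx
  rw [h]
  exact hwK.2 y hy

theorem mem_exposed_of_sub_mem {Q K : Set E} (hK : IsExposed ℝ Q K) {x y : E} (hx : x ∈ Q)
    (hy : y ∈ K) (h : x - y ∈ vectorSpan ℝ K) : x ∈ K := by
  obtain ⟨l, hl⟩ := hK ⟨y, hy⟩
  have hc : ∀ z ∈ K, l.toLinearMap z = l.toLinearMap y := by
    intro z hz
    have hz' := hz
    have hy' := hy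
    rw [hl] at hz' hy'
    exact le_antisymm (hy'.2 z hz'.1) (hz'.2 y hy'.1)
  have h0 := map_vectorSpan_eq_zero l.toLinearMap hc h
  rw [map_sub, sub_eq_zero] at h0
  have hy' := hy
  rw [hl] at hy' ⊢
  exact ⟨hx, fun z hz => (hy'.2 z hz).trans (le_of_eq h0.symm)⟩

theorem eq_of_exposed_of_finrank_le {Q K K' : Set E} (hK : IsExposed ℝ Q K) (hne : K.Nonempty)
    (h : K ⊆ K') (hQ : K' ⊆ Q)
    (hd : finrank ℝ (vectorSpan ℝ K') ≤ finrank ℝ (vectorSpan ℝ K)) : K = K' := by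
  have he := Submodule.eq_of_le_of_finrank_le (vectorSpan_mono ℝ h) hd
  obtain ⟨y, hy⟩ := hne
  refine h.antisymm fun x hx => mem_exposed_of_sub_mem hK (hQ hx) hy ?_
  rw [he]
  exact sub_mem_vectorSpan hx (h hy)

theorem finrank_lt_of_exposed {Q K K' : Set E} (hK : IsExposed ℝ Q K) (hne : K.Nonempty)
    (h : K ⊆ K') (hQ : K' ⊆ Q) (hn : K ≠ K') :
    finrank ℝ (vectorSpan ℝ K) < finrank ℝ (vectorSpan ℝ K') := by
  by_contra hd
  exact hn (eq_of_exposed_of_finrank_le hK hne h hQ (not_lt.1 hd))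

theorem interior_nonempty_of_finrank {K : Set E} (hK : Convex ℝ K) (hne : K.Nonempty)
    (hd : finrank ℝ (vectorSpan ℝ K) = finrank ℝ E) : (interior K).Nonempty := by
  rw [hK.interior_nonempty_iff_affineSpan_eq_top,
    ← AffineSubspace.direction_eq_top_iff_of_nonempty ((affineSpan_nonempty ℝ).2 hne),
    direction_affineSpan]
  exact Submodule.eq_top_of_finrank_eq hd

theorem vectorSpan_eq_top_of_interior {K : Set E} (hK : (interior K).Nonempty) :
    vectorSpan ℝ K = ⊤ := by
  have h1 : affineSpan ℝ K = ⊤ := by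
    refine top_unique ?_
    rw [← isOpen_interior.affineSpan_eq_top hK]
    exact affineSpan_mono ℝ interior_subset
  rw [← direction_affineSpan, h1, AffineSubspace.direction_top]

/-- The points `x + k u` would leave every bounded set. It serves to identify translation vectors
and to show that `A` has trivial kernel. -/
theorem eq_zero_of_add_subset {K : Set E} (hb : Bornology.IsBounded K) (hne : K.Nonempty) {u : E}
    (h : ∀ x ∈ K, x + u ∈ K) : u = 0 := by
  obtain ⟨x, hx⟩ := hne
  have hk : ∀ k : ℕ, x + (k : ℝ) • u ∈ K := by
    intro k
    induction k with
    | zero => simpa using hx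
    | succ k ih =>
      have := h _ ih
      convert this using 1
      push_cast
      rw [add_smul, one_smul, add_assoc]
  obtain ⟨C, hC⟩ := hb.exists_norm_le
  by_contra hu
  obtain ⟨k, hk'⟩ := exists_nat_gt ((C + ‖x‖) / ‖u‖)
  have hu' : 0 < ‖u‖ := norm_pos_iff.2 hu
  rw [div_lt_iff₀ hu'] at hk'
  have h1 := hC _ (hk k)
  have h2 : ‖(k : ℝ) • u‖ ≤ ‖x + (k : ℝ) • u‖ + ‖x‖ := by
    have := norm_sub_le (x + (k : ℝ) • u) x
    simpa using this
  rw [norm_smul, Real.norm_natCast] at h2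
  linarith

/-! ### General position -/

/-- The set of affine combinations of `x` and points of `W` is contained in this subspace. -/
theorem finrank_vectorSpan_insert_le_add_one (S : Set E) (x : E) :
    finrank ℝ (vectorSpan ℝ (insert x S)) ≤ finrank ℝ (vectorSpan ℝ S) + 1 := by
  have h := finrank_vectorSpan_insert_le (affineSpan ℝ S) x
  rw [direction_affineSpan] at h
  refine le_trans (Submodule.finrank_mono (vectorSpan_mono ℝ ?_)) h
  exact insert_subset_insert (subset_affineSpan ℝ S)

/-- Proper affine subspaces are Haar null, so the complement of countably many of them is dense. -/
theorem exists_mem_avoiding {ι : Type*} {I : Set ι} (hI : I.Countable) (S : ι → Set E)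
    (hS : ∀ i ∈ I, finrank ℝ (vectorSpan ℝ (S i)) < finrank ℝ E) {U : Set E} (hU : IsOpen U)
    (hne : U.Nonempty) : ∃ x ∈ U, ∀ i ∈ I, x ∉ affineSpan ℝ (S i) := by
  borelize E
  have hae : ∀ᵐ x ∂(MeasureTheory.Measure.addHaar : MeasureTheory.Measure E),
      ∀ i ∈ I, x ∉ affineSpan ℝ (S i) := by
    rw [MeasureTheory.ae_ball_iff hI]
    intro i hi
    have h0 : MeasureTheory.Measure.addHaar (affineSpan ℝ (S i) : Set E) = 0 := by
      refine MeasureTheory.Measure.addHaar_affineSubspace _ _ fun htop => ?_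
      have h := hS i hi
      rw [← direction_affineSpan, htop, AffineSubspace.direction_top, finrank_top] at h
      exact lt_irrefl _ h
    rw [MeasureTheory.ae_iff]
    simpa using h0
  obtain ⟨x, hxU, hx⟩ := (MeasureTheory.Measure.dense_of_ae hae).inter_open_nonempty U hU hne
  exact ⟨x, hxU, hx⟩

/-- If a point `a • x + b • y` with `b ≠ 0` lies in the affine span of `S`, then `y` is in the
affine span of `S` and `x`. -/
theorem mem_affineSpan_insert_of_combo {S : Set E} {x y : E} {a b : ℝ} (hab : a + b = 1)
    (hb : b ≠ 0) (h : a • x + b • y ∈ affineSpan ℝ S) : y ∈ affineSpan ℝ (insert x S) := by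
  have h1 : a • x + b • y ∈ affineSpan ℝ (insert x S) :=
    affineSpan_mono ℝ (subset_insert _ _) h
  have h2 : x ∈ affineSpan ℝ (insert x S) := subset_affineSpan ℝ _ (mem_insert _ _)
  have h3 := AffineMap.lineMap_mem (b⁻¹) h2 h1
  convert h3 using 1
  rw [AffineMap.lineMap_apply_module]
  obtain rfl : a = 1 - b := by linarith
  rw [smul_add, smul_smul, smul_smul, inv_mul_cancel₀ hb, one_smul, ← add_assoc, ← add_smul]
  have : (1 - b⁻¹ + b⁻¹ * (1 - b)) = 0 := by field_simp; ring
  rw [this, zero_smul, zero_add]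

/-- Such a `y` is available when `S` has codimension at least two; the triangle version below needs
codimension at least three. These two lemmas stand in for connectedness and simple connectedness of
the complement of a skeleton. -/
theorem segment_disjoint_affineSpan {S : Set E} {x y : E} (hx : x ∉ affineSpan ℝ S)
    (hy : y ∉ affineSpan ℝ (insert x S)) : ∀ z ∈ segment ℝ x y, z ∉ affineSpan ℝ S := by
  rintro z ⟨a, b, -, -, hab, rfl⟩ hz
  by_cases hb : b = 0
  · subst hb
    obtain rfl : a = 1 := by linarith
    exact hx (by simpa using hz)
  · exact hy (mem_affineSpan_insert_of_combo hab hb hz)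

theorem triangle_disjoint_affineSpan {S : Set E} {x y z : E} (hx : x ∉ affineSpan ℝ S)
    (hy : y ∉ affineSpan ℝ (insert x S)) (hz : z ∉ affineSpan ℝ (insert y (insert x S))) :
    ∀ w ∈ convexHull ℝ {x, y, z}, w ∉ affineSpan ℝ S := by
  intro w hw hwS
  rw [convexHull_insert (by simp), convexHull_pair, mem_convexJoin] at hw
  obtain ⟨x', hx', u, hu, hw⟩ := hw
  rw [mem_singleton_iff] at hx'
  subst hx'
  obtain ⟨a, b, -, -, hab, rfl⟩ := hw
  by_cases hb : b = 0
  · subst hb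
    obtain rfl : a = 1 := by linarith
    exact hx (by simpa using hwS)
  · exact segment_disjoint_affineSpan hy hz u hu (mem_affineSpan_insert_of_combo hab hb hwS)

end Parallelohedron

namespace Parallelohedron

open Set Module

set_option linter.unusedSectionVars false

variable {E : Type*} [NormedAddCommGroup E] [InnerProductSpace ℝ E] [FiniteDimensional ℝ E]

local notation "⟪" x "," y "⟫" => inner ℝ x y

/-! ### Facet normals -/

/-- `F` is nonempty and has codimension `k`. -/
def HasCodim (k : ℕ) (F : Set E) : Prop :=
  F.Nonempty ∧ finrank ℝ (vectorSpan ℝ F) + k = finrank ℝ E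

/-- `n` is the outer unit normal of `Q` along its exposed face `F`. -/
def IsFacetNormal (Q F : Set E) (n : E) : Prop :=
  ‖n‖ = 1 ∧ ∃ m : ℝ, (∀ x ∈ Q, ⟪n, x⟫ ≤ m) ∧ F = {x ∈ Q | ⟪n, x⟫ = m}

theorem inner_eq_zero_of_const {F : Set E} {n : E} {m : ℝ} (h : ∀ x ∈ F, ⟪n, x⟫ = m) {u : E}
    (hu : u ∈ vectorSpan ℝ F) : ⟪n, u⟫ = 0 := by
  rcases F.eq_empty_or_nonempty with rfl | ⟨w, hw⟩
  · rw [vectorSpan_empty, Submodule.mem_bot] at hu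
    simp [hu]
  · exact map_vectorSpan_eq_zero (innerₛₗ ℝ n) (w := w)
      (fun x hx => by simp [h x hx, h w hw]) hu

theorem IsFacetNormal.inner_vectorSpan {Q F : Set E} {n : E} (h : IsFacetNormal Q F n) {u : E}
    (hu : u ∈ vectorSpan ℝ F) : ⟪n, u⟫ = 0 := by
  obtain ⟨-, m, -, rfl⟩ := h
  exact inner_eq_zero_of_const (fun x hx => hx.2) hu

theorem IsFacetNormal.subset {Q F : Set E} {n : E} (h : IsFacetNormal Q F n) : F ⊆ Q := by
  obtain ⟨-, m, -, rfl⟩ := h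
  exact fun x hx => hx.1

theorem IsFacetNormal.le {Q F : Set E} {n : E} (h : IsFacetNormal Q F n) {x y : E} (hx : x ∈ Q)
    (hy : y ∈ F) : ⟪n, x⟫ ≤ ⟪n, y⟫ := by
  obtain ⟨-, m, hm, rfl⟩ := h
  rw [hy.2]
  exact hm x hx

theorem IsFacetNormal.mem {Q F : Set E} {n : E} (h : IsFacetNormal Q F n) {x y : E} (hx : x ∈ Q)
    (hy : y ∈ F) (hxy : ⟪n, y⟫ ≤ ⟪n, x⟫) : x ∈ F := by
  have := h.le hx hy
  obtain ⟨-, m, hm, rfl⟩ := h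
  exact ⟨hx, by rw [← hy.2]; exact le_antisymm this hxy⟩

theorem IsFacetNormal.inner_eq {Q F : Set E} {n : E} (h : IsFacetNormal Q F n) {x y : E}
    (hx : x ∈ F) (hy : y ∈ F) : ⟪n, x⟫ = ⟪n, y⟫ :=
  le_antisymm (h.le (h.subset hx) hy) (h.le (h.subset hy) hx)

theorem IsFacetNormal.ne_zero {Q F : Set E} {n : E} (h : IsFacetNormal Q F n) : n ≠ 0 := by
  intro h0
  have := h.1
  simp [h0] at this

theorem IsFacetNormal.lt_of_interior {Q F : Set E} {n : E} (h : IsFacetNormal Q F n) {x y : E}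
    (hx : x ∈ interior Q) (hy : y ∈ F) : ⟪n, x⟫ < ⟪n, y⟫ := by
  obtain ⟨r, hr, hb⟩ := Metric.isOpen_iff.1 isOpen_interior x hx
  have hz : x + (r / 2) • n ∈ Q := by
    refine interior_subset (hb ?_)
    rw [Metric.mem_ball, dist_eq_norm, add_sub_cancel_left, norm_smul, h.1, Real.norm_eq_abs,
      abs_of_pos (by positivity)]
    linarith
  have := h.le hz hy
  rw [inner_add_right, inner_smul_right, real_inner_self_eq_norm_sq, h.1] at this
  nlinarith

theorem IsFacetNormal.convex {Q F : Set E} {n : E} (h : IsFacetNormal Q F n) (hQ : Convex ℝ Q) :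
    Convex ℝ F := by
  obtain ⟨-, m, hm, rfl⟩ := h
  intro x hx y hy a b ha hb hab
  refine ⟨hQ hx.1 hy.1 ha hb hab, ?_⟩
  rw [inner_add_right, inner_smul_right, inner_smul_right, hx.2, hy.2, ← add_mul, hab, one_mul]

theorem vectorSpan_eq_orthogonal {F : Set E} (hF : HasCodim 1 F) {n : E} (hn : n ≠ 0)
    (h : ∀ u ∈ vectorSpan ℝ F, ⟪n, u⟫ = 0) : vectorSpan ℝ F = (ℝ ∙ n)ᗮ := by
  refine Submodule.eq_of_le_of_finrank_le (fun u hu => ?_) ?_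
  · rw [Submodule.mem_orthogonal_singleton_iff_inner_right]
    exact h u hu
  · have h1 := Submodule.finrank_add_finrank_orthogonal (ℝ ∙ n)
    rw [finrank_span_singleton hn] at h1
    have := hF.2
    omega

theorem mem_vectorSpan_of_inner {F : Set E} (hF : HasCodim 1 F) {n : E} (hn : n ≠ 0)
    (h : ∀ u ∈ vectorSpan ℝ F, ⟪n, u⟫ = 0) {u : E} (hu : ⟪n, u⟫ = 0) : u ∈ vectorSpan ℝ F := by
  rw [vectorSpan_eq_orthogonal hF hn h, Submodule.mem_orthogonal_singleton_iff_inner_right]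
  exact hu

/-- Vectors orthogonal to a hyperplane are proportional. -/
theorem exists_smul_of_orthogonal {F : Set E} (hF : HasCodim 1 F) {n n' : E} (hn : ‖n‖ = 1)
    (h : ∀ u ∈ vectorSpan ℝ F, ⟪n, u⟫ = 0) (h' : ∀ u ∈ vectorSpan ℝ F, ⟪n', u⟫ = 0) :
    n' = ⟪n, n'⟫ • n := by
  have hn0 : n ≠ 0 := by intro h0; simp [h0] at hn
  have h1 : ⟪n, n' - ⟪n, n'⟫ • n⟫ = 0 := by
    rw [inner_sub_right, inner_smul_right, real_inner_self_eq_norm_sq, hn]; ring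
  have h2 := h' _ (mem_vectorSpan_of_inner hF hn0 h h1)
  have h3 : ⟪n' - ⟪n, n'⟫ • n, n' - ⟪n, n'⟫ • n⟫ = 0 := by
    rw [inner_sub_left, h2, inner_smul_left, h1]; simp
  exact sub_eq_zero.1 (inner_self_eq_zero.1 h3)

theorem eq_or_eq_neg_of_orthogonal {F : Set E} (hF : HasCodim 1 F) {n n' : E} (hn : ‖n‖ = 1)
    (hn' : ‖n'‖ = 1)
    (h : ∀ u ∈ vectorSpan ℝ F, ⟪n, u⟫ = 0) (h' : ∀ u ∈ vectorSpan ℝ F, ⟪n', u⟫ = 0) :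
    n' = n ∨ n' = -n := by
  have h1 := exists_smul_of_orthogonal hF hn h h'
  have h2 : |⟪n, n'⟫| = 1 := by
    have := congrArg norm h1
    rw [norm_smul, hn, hn', mul_one] at this
    exact this.symm
  rcases (abs_eq zero_le_one).1 h2 with h3 | h3 <;> rw [h3] at h1
  · left; simpa using h1
  · right; simpa using h1

theorem IsFacetNormal.unique {Q F : Set E} (hQ : (interior Q).Nonempty) (hF : HasCodim 1 F)
    {n n' : E} (h : IsFacetNormal Q F n) (h' : IsFacetNormal Q F n') : n' = n := by
  rcases eq_or_eq_neg_of_orthogonal hF h.1 h'.1 (fun u => h.inner_vectorSpan)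
    (fun u => h'.inner_vectorSpan) with rfl | rfl
  · rfl
  · obtain ⟨x, hx⟩ := hQ
    obtain ⟨y, hy⟩ := hF.1
    have h1 := h.lt_of_interior hx hy
    have h2 := h'.lt_of_interior hx hy
    rw [inner_neg_left, inner_neg_left] at h2
    linarith

theorem exists_isFacetNormal {Q F : Set E} (hQ : (interior Q).Nonempty) (hF : HasCodim 1 F)
    (h : IsExposed ℝ Q F) : ∃ n, IsFacetNormal Q F n := by
  obtain ⟨l, hl⟩ := h hF.1
  obtain ⟨y, hy⟩ := hF.1
  set a := (InnerProductSpace.toDual ℝ E).symm l with ha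
  have hla : ∀ x, l x = ⟪a, x⟫ := fun x => by simp [ha]
  have hyQ := hy
  rw [hl] at hyQ
  have ha0 : a ≠ 0 := by
    intro h0
    have hFQ : F = Q := by
      rw [hl]; ext x; simp [hla, h0]
    have := hF.2
    rw [hFQ, vectorSpan_eq_top_of_interior hQ, finrank_top] at this
    omega
  have hp : 0 < ‖a‖ := norm_pos_iff.2 ha0
  refine ⟨‖a‖⁻¹ • a, by rw [norm_smul, norm_inv, norm_norm, inv_mul_cancel₀ hp.ne'],
    ‖a‖⁻¹ * ⟪a, y⟫, fun x hx => ?_, ?_⟩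
  · rw [real_inner_smul_left]
    have := hyQ.2 x hx
    rw [hla, hla] at this
    gcongr
  · rw [hl]
    ext x
    simp only [mem_ofPred_eq, hla, real_inner_smul_left]
    refine and_congr_right fun hx => ⟨fun h => ?_, fun h z hz => ?_⟩
    · have h1 := h y hyQ.1
      have h2 := hyQ.2 x hx
      rw [hla, hla] at h2
      rw [le_antisymm h2 h1]
    · have h2 := hyQ.2 z hz
      rw [hla, hla] at h2
      rw [mul_left_cancel₀ (inv_ne_zero hp.ne') h]
      exact h2

theorem HasCodim.eq_of_exposed {Q K K' : Set E} {k : ℕ} (hK : IsExposed ℝ Q K) (h : HasCodim k K)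
    (h' : HasCodim k K') (hs : K ⊆ K') (hQ : K' ⊆ Q) : K = K' := by
  refine eq_of_exposed_of_finrank_le hK h.1 hs hQ ?_
  have := h.2
  have := h'.2
  omega

/-- Two convex bodies on the same side of a common facet overlap. -/
theorem interior_inter_nonempty_of_same_side {Q R F : Set E} {n : E} (hQ : Convex ℝ Q)
    (hQi : (interior Q).Nonempty) (hR : Convex ℝ R) (hRi : (interior R).Nonempty)
    (hF : HasCodim 1 F) (h : IsFacetNormal Q F n) (h' : IsFacetNormal R F n) :
    (interior Q ∩ interior R).Nonempty := by
  obtain ⟨w, hw⟩ := exists_relInt (h.convex hQ) hF.1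
  obtain ⟨x, hx⟩ := hQi
  obtain ⟨y, hy⟩ := hRi
  have hp : 0 < ⟪n, w - x⟫ := by rw [inner_sub_right]; linarith [h.lt_of_interior hx hw.1]
  have hq : 0 < ⟪n, w - y⟫ := by rw [inner_sub_right]; linarith [h'.lt_of_interior hy hw.1]
  -- The ratio of the depths of `y` and `x` below the facet: with it, `(y - w) - α (x - w)` is
  -- parallel to the facet.
  set α := ⟪n, w - y⟫ / ⟪n, w - x⟫ with hα
  have hα0 : 0 < α := div_pos hq hp
  have hu : (y - w) - α • (x - w) ∈ vectorSpan ℝ F := by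
    refine mem_vectorSpan_of_inner hF h.ne_zero (fun u => h.inner_vectorSpan) ?_
    have h1 : α * ⟪n, w - x⟫ = ⟪n, w - y⟫ := div_mul_cancel₀ _ hp.ne'
    rw [inner_sub_right, inner_smul_right]
    have h2 : ⟪n, x - w⟫ = - ⟪n, w - x⟫ := by rw [← inner_neg_right, neg_sub]
    have h3 : ⟪n, y - w⟫ = - ⟪n, w - y⟫ := by rw [← inner_neg_right, neg_sub]
    rw [h2, h3]; linarith
  obtain ⟨ε, hε, hwε⟩ := hw.2 _ hu
  set e := min ε 1 with he
  have he0 : 0 < e := lt_min hε one_pos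
  have he1 : e ≤ 1 := min_le_right _ _
  have hmem : w + e • ((y - w) - α • (x - w)) ∈ F := by
    have := (h.convex hQ) hw.1 hwε (a := 1 - e / ε) (b := e / ε)
      (by rw [sub_nonneg, div_le_one hε]; exact min_le_left _ _) (by positivity) (by ring)
    convert this using 1
    rw [smul_add, smul_smul, div_mul_cancel₀ _ hε.ne', ← add_assoc, ← add_smul]
    simp
  have hk : 0 < 1 + e * α := by positivity
  -- One point written in two ways: on the segment from `w` to `y`, and on the segment from `x` to
  -- the point of `F` just found, where the contributions of `x` cancel. Positive weights on `x` and
  -- `y` put it in both interiors.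
  refine ⟨(1 - e / (1 + e * α)) • w + (e / (1 + e * α)) • y, ?_, ?_⟩
  · have := hQ.combo_interior_self_mem_interior hx (h.subset hmem) (a := e * α / (1 + e * α))
      (b := 1 / (1 + e * α)) (by positivity) (by positivity) (by field_simp; ring)
    convert this using 1
    match_scalars <;> field_simp <;> ring
  · have := hR.combo_interior_self_mem_interior hy (h'.subset hw.1) (a := e / (1 + e * α))
      (b := 1 - e / (1 + e * α)) (by positivity)
      (by rw [sub_nonneg, div_le_one hk]; nlinarith) (by ring)
    rwa [add_comm] at this

theorem exists_mem_segment_boundary {Q : Set E} (hQ : IsClosed Q) {x y : E} (hx : x ∈ interior Q)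
    (hy : y ∉ Q) : ∃ z ∈ segment ℝ x y, z ∈ Q ∧ z ∉ interior Q := by
  by_contra! h
  obtain ⟨z, -, hz, hz'⟩ := (convex_segment x y).isPreconnected (interior Q) Qᶜ isOpen_interior
    hQ.isOpen_compl
    (fun z hz => by
      by_cases hzQ : z ∈ Q
      · exact Or.inl (h z hz hzQ)
      · exact Or.inr hzQ)
    ⟨x, left_mem_segment ℝ x y, hx⟩ ⟨y, right_mem_segment ℝ x y, hy⟩
  exact hz' (interior_subset hz)

/-! ### Face-to-face tilings -/

/-- A locally finite face-to-face tiling by convex bodies. -/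
structure IsFaceTiling (T : Set (Set E)) : Prop where
  convex : ∀ Q ∈ T, Convex ℝ Q
  compact : ∀ Q ∈ T, IsCompact Q
  interior_nonempty : ∀ Q ∈ T, (interior Q).Nonempty
  locallyFinite : ∀ w : E, ∃ r > 0, {Q ∈ T | (Q ∩ Metric.ball w r).Nonempty}.Finite
  cover : ∀ x, ∃ Q ∈ T, x ∈ Q
  disjoint : ∀ Q ∈ T, ∀ R ∈ T, Q ≠ R → Disjoint (interior Q) (interior R)
  face : ∀ Q ∈ T, ∀ R ∈ T, IsExposed ℝ Q (Q ∩ R)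

variable {T : Set (Set E)}

namespace IsFaceTiling

theorem face' (hT : IsFaceTiling T) {Q R : Set E} (hQ : Q ∈ T) (hR : R ∈ T) :
    IsExposed ℝ R (Q ∩ R) := by
  rw [inter_comm]
  exact hT.face R hR Q hQ

theorem exists_ball (hT : IsFaceTiling T) (w : E) :
    ∃ r > 0, ∀ Q ∈ T, (Q ∩ Metric.ball w r).Nonempty → w ∈ Q := by
  obtain ⟨r, hr, hf⟩ := hT.locallyFinite w
  set S := {Q ∈ T | (Q ∩ Metric.ball w r).Nonempty} with hS
  have hU : IsOpen (⋂ Q ∈ {Q ∈ S | w ∉ Q}, Qᶜ) := by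
    refine (hf.subset (fun Q hQ => hQ.1)).isOpen_biInter fun Q hQ => ?_
    exact (hT.compact Q hQ.1.1).isClosed.isOpen_compl
  have hw : w ∈ ⋂ Q ∈ {Q ∈ S | w ∉ Q}, Qᶜ := by
    simp only [mem_iInter]
    exact fun Q hQ => hQ.2
  obtain ⟨r', hr', hb⟩ := Metric.isOpen_iff.1 hU w hw
  refine ⟨min r r', lt_min hr hr', fun Q hQ hne => ?_⟩
  obtain ⟨x, hxQ, hx⟩ := hne
  by_contra hwQ
  have hxr' := hb (Metric.ball_subset_ball (min_le_right _ _) hx)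
  simp only [mem_iInter] at hxr'
  exact hxr' Q ⟨⟨hQ, x, hxQ, Metric.ball_subset_ball (min_le_left _ _) hx⟩, hwQ⟩ hxQ

theorem finite_inter (hT : IsFaceTiling T) {K : Set E} (hK : IsCompact K) :
    {R ∈ T | (K ∩ R).Nonempty}.Finite := by
  refine hK.induction_on (p := fun K => {R ∈ T | (K ∩ R).Nonempty}.Finite) ?_ ?_ ?_ ?_
  · simp
  · intro s t hst ht
    exact ht.subset fun _ hR => ⟨hR.1, hR.2.mono (inter_subset_inter_left _ hst)⟩
  · intro s t hs ht
    refine (hs.union ht).subset fun R hR => ?_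
    obtain ⟨x, hx | hx, hxR⟩ := hR.2
    · exact Or.inl ⟨hR.1, x, hx, hxR⟩
    · exact Or.inr ⟨hR.1, x, hx, hxR⟩
  · intro w _
    obtain ⟨r, hr, hf⟩ := hT.locallyFinite w
    refine ⟨Metric.ball w r, mem_nhdsWithin_of_mem_nhds (Metric.ball_mem_nhds w hr), ?_⟩
    refine hf.subset fun R hR => ⟨hR.1, ?_⟩
    rw [inter_comm]
    exact hR.2

theorem finite_mem (hT : IsFaceTiling T) (w : E) : {R ∈ T | w ∈ R}.Finite :=
  (hT.finite_inter (isCompact_singleton (x := w))).subset fun _ hR => ⟨hR.1, w, rfl, hR.2⟩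

theorem countable (hT : IsFaceTiling T) : T.Countable := by
  have : T ⊆ ⋃ k : ℕ, {R ∈ T | (Metric.closedBall (0 : E) k ∩ R).Nonempty} := by
    intro Q hQ
    obtain ⟨x, hx⟩ := hT.interior_nonempty Q hQ
    obtain ⟨k, hk⟩ := exists_nat_ge ‖x‖
    exact mem_iUnion.2 ⟨k, hQ, x, by simpa using hk, interior_subset hx⟩
  exact (countable_iUnion fun k => (hT.finite_inter (isCompact_closedBall _ _)).countable).mono this

theorem eq_of_mem_interior (hT : IsFaceTiling T) {Q R : Set E} (hQ : Q ∈ T) (hR : R ∈ T) {x : E}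
    (hx : x ∈ interior Q) (hxR : x ∈ R) : R = Q := by
  by_contra hne
  have h1 : x ∈ closure (interior R) := by
    rw [(hT.convex R hR).closure_interior_eq_closure_of_nonempty_interior
      (hT.interior_nonempty R hR)]
    exact subset_closure hxR
  obtain ⟨y, hy, hy'⟩ := mem_closure_iff.1 h1 _ isOpen_interior hx
  exact disjoint_left.1 (hT.disjoint R hR Q hQ hne) hy' hy

theorem finrank_inter_lt (hT : IsFaceTiling T) {Q R : Set E} (hQ : Q ∈ T) (hR : R ∈ T)
    (hne : Q ≠ R) (hn : (Q ∩ R).Nonempty) :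
    finrank ℝ (vectorSpan ℝ (Q ∩ R)) < finrank ℝ E := by
  refine lt_of_le_of_ne (Submodule.finrank_le _) fun h => hne ?_
  obtain ⟨x, hx⟩ := interior_nonempty_of_finrank
    ((hT.convex Q hQ).inter (hT.convex R hR)) hn h
  exact (hT.eq_of_mem_interior hQ hR (interior_mono inter_subset_left hx)
    (interior_subset hx).2).symm

theorem exists_ne_mem (hT : IsFaceTiling T) {Q : Set E} {w : E}
    (hw' : w ∉ interior Q) : ∃ R ∈ T, R ≠ Q ∧ w ∈ R := by
  by_contra! h
  obtain ⟨r, hr, hb⟩ := hT.exists_ball w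
  refine hw' (mem_interior.2 ⟨Metric.ball w r, fun x hx => ?_, Metric.isOpen_ball,
    Metric.mem_ball_self hr⟩)
  obtain ⟨R, hR, hxR⟩ := hT.cover x
  by_cases hRQ : R = Q
  · rwa [← hRQ]
  · exact absurd (hb R hR ⟨x, hxR, hx⟩) (h R hR hRQ)

theorem ne_of_hasCodim_one (hT : IsFaceTiling T) {Q R : Set E} (hQ : Q ∈ T)
    (h : HasCodim 1 (Q ∩ R)) : Q ≠ R := by
  rintro rfl
  have := h.2
  rw [inter_self, vectorSpan_eq_top_of_interior (hT.interior_nonempty Q hQ), finrank_top] at this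
  omega

/-- A relatively interior point of the facet is a boundary point of `Q`, so another cell `R`
contains it. Then `Q ∩ R` contains the facet and has smaller dimension than `Q`, hence equals it. -/
theorem exists_neighbor (hT : IsFaceTiling T) {Q F : Set E} (hQ : Q ∈ T) (hF : HasCodim 1 F)
    (h : IsExposed ℝ Q F) : ∃ R ∈ T, R ≠ Q ∧ Q ∩ R = F := by
  obtain ⟨n, hn⟩ := exists_isFacetNormal (hT.interior_nonempty Q hQ) hF h
  obtain ⟨w, hw⟩ := exists_relInt (hn.convex (hT.convex Q hQ)) hF.1
  obtain ⟨R, hR, hRQ, hwR⟩ := hT.exists_ne_mem (Q := Q) (w := w) fun hwi =>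
    lt_irrefl _ (hn.lt_of_interior hwi hw.1)
  refine ⟨R, hR, hRQ, ?_⟩
  have hwQ := hn.subset hw.1
  have hsub := exposed_subset_of_relInt (hT.face Q hQ R hR) hn.subset hw ⟨hwQ, hwR⟩
  refine (eq_of_exposed_of_finrank_le h hF.1 hsub inter_subset_left ?_).symm
  have h1 := hT.finrank_inter_lt hQ hR hRQ.symm ⟨w, hwQ, hwR⟩
  have := hF.2
  omega

theorem exists_normal (hT : IsFaceTiling T) {Q R : Set E} (hQ : Q ∈ T) (hR : R ∈ T)
    (h : HasCodim 1 (Q ∩ R)) :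
    ∃ n, IsFacetNormal Q (Q ∩ R) n ∧ IsFacetNormal R (Q ∩ R) (-n) := by
  obtain ⟨n, hn⟩ := exists_isFacetNormal (hT.interior_nonempty Q hQ) h (hT.face Q hQ R hR)
  obtain ⟨n', hn'⟩ := exists_isFacetNormal (hT.interior_nonempty R hR) h (hT.face' hQ hR)
  refine ⟨n, hn, ?_⟩
  rcases eq_or_eq_neg_of_orthogonal h hn.1 hn'.1 (fun u => hn.inner_vectorSpan)
    (fun u => hn'.inner_vectorSpan) with rfl | rfl
  · exfalso
    obtain ⟨x, hx, hx'⟩ := interior_inter_nonempty_of_same_side (hT.convex Q hQ)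
      (hT.interior_nonempty Q hQ) (hT.convex R hR) (hT.interior_nonempty R hR) h hn hn'
    exact hT.ne_of_hasCodim_one hQ h
      (hT.eq_of_mem_interior hQ hR hx (interior_subset hx')).symm
  · exact hn'

theorem neighbor_unique (hT : IsFaceTiling T) {Q R R' : Set E} (hQ : Q ∈ T) (hR : R ∈ T)
    (hR' : R' ∈ T) (h : HasCodim 1 (Q ∩ R)) (he : Q ∩ R = Q ∩ R') : R = R' := by
  obtain ⟨n, hn, hn2⟩ := hT.exists_normal hQ hR h
  obtain ⟨n', hn', hn2'⟩ := hT.exists_normal hQ hR' (he ▸ h)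
  rw [← he] at hn' hn2'
  rw [hn.unique (hT.interior_nonempty Q hQ) h hn'] at hn2'
  obtain ⟨x, hx, hx'⟩ := interior_inter_nonempty_of_same_side (hT.convex R hR)
      (hT.interior_nonempty R hR) (hT.convex R' hR') (hT.interior_nonempty R' hR') h hn2 hn2'
  exact (hT.eq_of_mem_interior hR hR' hx (interior_subset hx')).symm

theorem eq_or_eq_of_relInt (hT : IsFaceTiling T) {Q R S : Set E} (hQ : Q ∈ T) (hR : R ∈ T)
    (hS : S ∈ T) (h : HasCodim 1 (Q ∩ R)) {w : E} (hw : RelInt (Q ∩ R) w) (hwS : w ∈ S) :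
    S = Q ∨ S = R := by
  by_cases hSQ : S = Q
  · exact Or.inl hSQ
  right
  have hsub := exposed_subset_of_relInt (hT.face Q hQ S hS) inter_subset_left hw ⟨hw.1.1, hwS⟩
  refine (hT.neighbor_unique hQ hR hS h ?_).symm
  refine eq_of_exposed_of_finrank_le (hT.face Q hQ R hR) h.1 hsub inter_subset_left ?_
  have h1 := hT.finrank_inter_lt hQ hS (Ne.symm hSQ) ⟨w, hw.1.1, hwS⟩
  have := h.2
  omega

/-- The facet description of a cell, derived from the tiling: a segment from a generic interior
point to `y` leaves `Q` through a facet. Compactness and convexity of the cells suffice, with no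
polytope theory. -/
theorem exists_facet_separating (hT : IsFaceTiling T) {Q : Set E} (hQ : Q ∈ T) {y : E}
    (hy : y ∉ Q) : ∃ R ∈ T, HasCodim 1 (Q ∩ R) ∧ ∀ n, IsFacetNormal Q (Q ∩ R) n →
      ∀ z ∈ Q ∩ R, ⟪n, z⟫ < ⟪n, y⟫ := by
  obtain ⟨x, hx, hxa⟩ := exists_mem_avoiding
    (I := {R ∈ T | finrank ℝ (vectorSpan ℝ (Q ∩ R)) + 2 ≤ finrank ℝ E})
    -- Adding `y` to each low-dimensional intersection before avoiding its span ensures that the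
    -- segment to `y` misses the intersection itself.
    (hT.countable.mono fun R hR => hR.1) (fun R => insert y (Q ∩ R))
    (fun R hR => by
      have := finrank_vectorSpan_insert_le_add_one (Q ∩ R) y
      have := hR.2
      omega) isOpen_interior (hT.interior_nonempty Q hQ)
  obtain ⟨z, hz, hzQ, hzf⟩ := exists_mem_segment_boundary (hT.compact Q hQ).isClosed hx hy
  obtain ⟨R, hR, hRQ, hzR⟩ := hT.exists_ne_mem (Q := Q) (w := z) hzf
  obtain ⟨a, b, ha, hb, hab, rfl⟩ := hz
  have ha0 : a ≠ 0 := by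
    rintro rfl
    obtain rfl : b = 1 := by linarith
    exact hy (by simpa using hzQ)
  have hlt := hT.finrank_inter_lt hQ hR hRQ.symm ⟨_, hzQ, hzR⟩
  have hcod : HasCodim 1 (Q ∩ R) := by
    refine ⟨⟨_, hzQ, hzR⟩, ?_⟩
    by_contra hne
    refine hxa R ⟨hR, by omega⟩ (mem_affineSpan_insert_of_combo (add_comm b a ▸ hab) ha0 ?_)
    rw [add_comm]
    exact subset_affineSpan ℝ _ ⟨hzQ, hzR⟩
  refine ⟨R, hR, hcod, fun n hn z' hz' => ?_⟩
  have h1 := hn.lt_of_interior hx (⟨hzQ, hzR⟩ : _ ∈ Q ∩ R)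
  rw [← hn.inner_eq ⟨hzQ, hzR⟩ hz']
  rw [inner_add_right, inner_smul_right, inner_smul_right] at h1 ⊢
  obtain rfl : a = 1 - b := by linarith
  have hb1 : 0 < 1 - b := lt_of_le_of_ne ha (Ne.symm ha0)
  nlinarith

end IsFaceTiling

end Parallelohedron

namespace Parallelohedron

open Set Module

set_option linter.unusedSectionVars false

variable {E : Type*} [NormedAddCommGroup E] [InnerProductSpace ℝ E] [FiniteDimensional ℝ E]
variable {Γ : Type*} [AddCommGroup Γ]

/-! ### Integrating local cocycles over convex sets -/

/-- `φ` is locally (uniformly) a potential for the differences `k` on `X`. -/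
def IsPotentialOn (k : E → E → Γ) (X : Set E) (φ : E → Γ) : Prop :=
  ∃ δ > 0, ∀ x ∈ X, ∀ y ∈ X, dist x y < δ → φ y - φ x = k x y

theorem IsPotentialOn.mono {k : E → E → Γ} {X Y : Set E} {φ : E → Γ} (h : IsPotentialOn k Y φ)
    (hXY : X ⊆ Y) : IsPotentialOn k X φ := by
  obtain ⟨δ, hδ, h⟩ := h
  exact ⟨δ, hδ, fun x hx y hy => h x (hXY hx) y (hXY hy)⟩

/-- Two local potentials have a locally constant difference, and a convex set is preconnected. -/
theorem IsPotentialOn.sub_eq {k : E → E → Γ} {X : Set E} (hX : Convex ℝ X) {φ ψ : E → Γ}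
    (h : IsPotentialOn k X φ) (h' : IsPotentialOn k X ψ) {x y : E} (hx : x ∈ X) (hy : y ∈ X) :
    φ y - φ x = ψ y - ψ x := by
  obtain ⟨δ, hδ, h⟩ := h
  obtain ⟨δ', hδ', h'⟩ := h'
  refine hX.isPreconnected.induction₂ (fun x y => φ y - φ x = ψ y - ψ x) ?_ ?_ ?_ hx hy
  · intro x hx
    have h1 : ∀ᶠ y in nhdsWithin x X, y ∈ Metric.ball x (min δ δ') :=
      mem_nhdsWithin_of_mem_nhds (Metric.ball_mem_nhds x (lt_min hδ hδ'))
    filter_upwards [h1, self_mem_nhdsWithin] with y hy hyX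
    rw [Metric.mem_ball, dist_comm] at hy
    rw [h x hx y hyX (lt_of_lt_of_le hy (min_le_left _ _)),
      h' x hx y hyX (lt_of_lt_of_le hy (min_le_right _ _))]
  · intro x y z _ _ _ hxy hyz
    have := congrArg₂ (· + ·) hxy hyz
    simpa using this
  · intro x y _ _ hxy
    rw [← neg_sub (φ y), hxy, neg_sub]

/-- The potential at `y` is the sum of `k` along `N` equal steps of the straight path from `x₀`. For
nearby endpoints the two paths bound a ladder of small triangles, on each of which `k` is additive.
-/
theorem exists_isPotentialOn {X : Set E} (hX : Convex ℝ X) (hb : Bornology.IsBounded X)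
    (k : E → E → Γ) {δ : ℝ} (hδ : 0 < δ)
    (hk : ∀ x ∈ X, ∀ y ∈ X, ∀ z ∈ X, dist x y < δ → dist y z < δ → dist x z < δ →
      k x y + k y z = k x z) : ∃ φ, IsPotentialOn k X φ := by
  rcases X.eq_empty_or_nonempty with rfl | ⟨x₀, hx₀⟩
  · exact ⟨0, 1, one_pos, fun x hx => absurd hx (by simp)⟩
  obtain ⟨D, hD⟩ := (Metric.isBounded_iff_subset_closedBall x₀).1 hb
  obtain ⟨N, hN⟩ := exists_nat_gt (max (2 * D / δ) 0)
  have hN0 : (0 : ℝ) < N := lt_of_le_of_lt (le_max_right _ _) hN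
  -- Rungs and steps both shorter than `δ / 2` make the diagonals of the ladder shorter than `δ`.
  have hND : D / N < δ / 2 := by
    have := lt_of_le_of_lt (le_max_left _ _) hN
    rw [div_lt_iff₀ hδ] at this
    rw [div_lt_iff₀ hN0]
    linarith
  let p : ℕ → E → E := fun i y => AffineMap.lineMap x₀ y ((i : ℝ) / N)
  have hpX : ∀ i ≤ N, ∀ y ∈ X, p i y ∈ X := by
    intro i hi y hy
    refine hX.lineMap_mem hx₀ hy ⟨by positivity, ?_⟩
    rw [div_le_one hN0]
    exact_mod_cast hi
  have hstep : ∀ i, ∀ y ∈ X, dist (p i y) (p (i + 1) y) < δ / 2 := by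
    intro i y hy
    have h1 : dist ((i : ℝ) / N) (((i + 1 : ℕ) : ℝ) / N) = 1 / N := by
      rw [Real.dist_eq, ← sub_div]
      push_cast
      rw [abs_div, abs_of_pos hN0]
      simp
    simp only [p]
    rw [dist_lineMap_lineMap, h1]
    have h2 : dist x₀ y ≤ D := by rw [dist_comm]; exact hD hy
    calc 1 / (N : ℝ) * dist x₀ y ≤ 1 / N * D := by gcongr
      _ = D / N := by ring
      _ < δ / 2 := hND
  have hside : ∀ i ≤ N, ∀ y z : E, dist (p i y) (p i z) ≤ dist y z := by
    intro i hi y z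
    simp only [p]
    rw [AffineMap.lineMap_apply_module, AffineMap.lineMap_apply_module, dist_add_left, dist_smul₀]
    refine mul_le_of_le_one_left dist_nonneg ?_
    rw [Real.norm_eq_abs, abs_of_nonneg (by positivity), div_le_one hN0]
    exact_mod_cast hi
  have hp0 : ∀ y, p 0 y = x₀ := fun y => by simp [p]
  have hpN : ∀ y, p N y = y := fun y => by simp [p, div_self hN0.ne']
  refine ⟨fun y => ∑ i ∈ Finset.range N, k (p i y) (p (i + 1) y), δ / 2, by positivity, ?_⟩
  intro y hy z hz hyz
  have key : ∀ i ≤ N, ∑ j ∈ Finset.range i, k (p j z) (p (j + 1) z) -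
      ∑ j ∈ Finset.range i, k (p j y) (p (j + 1) y) = k (p i y) (p i z) := by
    intro i
    induction i with
    | zero =>
      intro _
      have h0 := hk x₀ hx₀ x₀ hx₀ x₀ hx₀ (by simpa using hδ) (by simpa using hδ) (by simpa using hδ)
      simp only [Finset.range_zero, Finset.sum_empty, sub_zero, hp0]
      rw [add_eq_left] at h0
      exact h0.symm
    | succ i ih =>
      intro hi
      have hi' : i ≤ N := by omega
      rw [Finset.sum_range_succ, Finset.sum_range_succ]
      have ih := ih hi'
      have d1 := hside i hi' y z
      have d2 := hside (i + 1) hi y z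
      have d3 := hstep i y hy
      have d4 := hstep i z hz
      have d5 := dist_triangle (p i y) (p i z) (p (i + 1) z)
      have e1 := hk _ (hpX i hi' y hy) _ (hpX i hi' z hz) _ (hpX (i + 1) hi z hz)
        (by linarith) (by linarith) (by linarith)
      have e2 := hk _ (hpX i hi' y hy) _ (hpX (i + 1) hi y hy) _ (hpX (i + 1) hi z hz)
        (by linarith) (by linarith) (by linarith)
      rw [add_sub_add_comm, ih, ← add_sub_assoc, e1, ← e2, add_sub_cancel_left]
  have := key N le_rfl
  rwa [hpN, hpN] at this

/-! ### Global potentials on tilings -/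

variable {T : Set (Set E)}

namespace IsFaceTiling

/-- A Lebesgue number for the balls of `exists_ball` turns proximity into incidence: the cells met
within distance `δ` have a common point, and this point lies in `X`, so it inherits the general
position of `X`. -/
theorem exists_lebesgue (hT : IsFaceTiling T) {X : Set E} (hX : IsCompact X) :
    ∃ δ > 0, ∀ x ∈ X, ∃ w ∈ X, ∀ Q ∈ T, (Q ∩ Metric.ball x δ).Nonempty → w ∈ Q := by
  choose r hr h using hT.exists_ball
  obtain ⟨δ, hδ, h'⟩ := lebesgue_number_lemma_of_metric (c := fun w : X => Metric.ball w.1 (r w))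
    hX (fun _ => Metric.isOpen_ball)
    (fun x hx => mem_iUnion.2 ⟨⟨x, hx⟩, Metric.mem_ball_self (hr x)⟩)
  refine ⟨δ, hδ, fun x hx => ?_⟩
  obtain ⟨w, hw⟩ := h' x hx
  exact ⟨w, w.2, fun Q hQ hne => h w Q hQ (hne.mono (inter_subset_inter_right _ hw))⟩

theorem interior_inter_ball_nonempty (hT : IsFaceTiling T) {Q : Set E} (hQ : Q ∈ T) {w : E}
    (hw : w ∈ Q) {r : ℝ} (hr : 0 < r) : (interior Q ∩ Metric.ball w r).Nonempty := by
  have h1 : w ∈ closure (interior Q) := by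
    rw [(hT.convex Q hQ).closure_interior_eq_closure_of_nonempty_interior
      (hT.interior_nonempty Q hQ)]
    exact subset_closure hw
  obtain ⟨x, hx, hx'⟩ := mem_closure_iff.1 h1 _ Metric.isOpen_ball (Metric.mem_ball_self hr)
  exact ⟨x, hx', hx⟩

/-- Walking along a segment in general position. -/
theorem exists_walk (hT : IsFaceTiling T) {Q R U V : Set E} (hQ : Q ∈ T) (hR : R ∈ T)
    (hU : IsOpen U) (hUn : U.Nonempty) (hUQ : U ⊆ interior Q) (hV : IsOpen V) (hVn : V.Nonempty)
    (hVR : V ⊆ interior R) :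
    ∃ x ∈ U, ∃ y ∈ V, ∀ r : Set E → Set E → Prop, (∀ S, r S S) →
      (∀ S₁ S₂ S₃, r S₁ S₂ → r S₂ S₃ → r S₁ S₃) →
      (∀ S₁ ∈ T, ∀ S₂ ∈ T, HasCodim 1 (S₁ ∩ S₂) → ∀ n, IsFacetNormal S₁ (S₁ ∩ S₂) n →
        IsFacetNormal S₂ (S₁ ∩ S₂) (-n) → 0 ≤ inner ℝ n (y - x) → r S₁ S₂) → r Q R := by
  -- Pairs of cells meeting in codimension at least two; a segment missing these intersections
  -- changes cells only through facets.
  let bad : Set (Set E × Set E) := {i | (i.1 ∈ T ∧ i.2 ∈ T) ∧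
    finrank ℝ (vectorSpan ℝ (i.1 ∩ i.2)) + 2 ≤ finrank ℝ E}
  have hbad : bad.Countable := (hT.countable.prod hT.countable).mono fun i hi => hi.1
  obtain ⟨x, hxU, hx⟩ := exists_mem_avoiding hbad (fun i => i.1 ∩ i.2)
    (fun i hi => by have := hi.2; omega) hU hUn
  obtain ⟨y, hyV, hy⟩ := exists_mem_avoiding hbad (fun i => insert x (i.1 ∩ i.2))
    (fun i hi => by
      have := hi.2
      have := finrank_vectorSpan_insert_le_add_one (i.1 ∩ i.2) x
      omega) hV hVn
  refine ⟨x, hxU, y, hyV, fun r hrefl htrans hr => ?_⟩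
  choose cell hcellT hcell using hT.cover
  obtain ⟨δ, hδ, hw⟩ := hT.exists_lebesgue (X := segment ℝ x y)
    (by rw [← convexHull_pair]; exact Set.Finite.isCompact_convexHull ℝ (by simp))
  obtain ⟨N, hN⟩ := exists_nat_gt (dist x y / δ)
  have hN0 : (0 : ℝ) < N := lt_of_le_of_lt (by positivity) hN
  let p : ℕ → E := fun i => AffineMap.lineMap x y ((i : ℝ) / N)
  have hpX : ∀ i ≤ N, p i ∈ segment ℝ x y := by
    intro i hi
    rw [segment_eq_image_lineMap]
    refine ⟨(i : ℝ) / N, ⟨by positivity, ?_⟩, rfl⟩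
    rw [div_le_one hN0]
    exact_mod_cast hi
  have hsub : ∀ i, p (i + 1) - p i = (1 / N : ℝ) • (y - x) := by
    intro i
    simp only [p, AffineMap.lineMap_apply_module]
    push_cast
    match_scalars <;> field_simp <;> ring
  have key : ∀ i ≤ N, r (cell (p 0)) (cell (p i)) := by
    intro i
    induction i with
    | zero => exact fun _ => hrefl _
    | succ i ih =>
      intro hi
      refine htrans _ _ _ (ih (by omega)) ?_
      obtain ⟨w, hwX, hw⟩ := hw (p i) (hpX i (by omega))
      have h1 := hw _ (hcellT (p i)) ⟨p i, hcell _, Metric.mem_ball_self hδ⟩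
      have h2 := hw _ (hcellT (p (i + 1))) ⟨p (i + 1), hcell _, by
        rw [Metric.mem_ball, dist_eq_norm, hsub, norm_smul, Real.norm_eq_abs,
          abs_of_pos (by positivity), ← dist_eq_norm, dist_comm y x]
        rw [div_lt_iff₀ hδ] at hN
        rw [one_div, inv_mul_lt_iff₀ hN0]
        exact hN⟩
      by_cases he : cell (p i) = cell (p (i + 1))
      · rw [he]
        exact hrefl _
      have hlt := hT.finrank_inter_lt (hcellT _) (hcellT _) he ⟨w, h1, h2⟩
      have hcod : HasCodim 1 (cell (p i) ∩ cell (p (i + 1))) := by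
        refine ⟨⟨w, h1, h2⟩, ?_⟩
        by_contra hne
        have hb : (cell (p i), cell (p (i + 1))) ∈ bad :=
          ⟨⟨hcellT _, hcellT _⟩, by dsimp only; omega⟩
        exact segment_disjoint_affineSpan (hx _ hb) (hy _ hb) w hwX
          (subset_affineSpan ℝ _ ⟨h1, h2⟩)
      obtain ⟨n, hn, hn'⟩ := hT.exists_normal (hcellT _) (hcellT _) hcod
      refine hr _ (hcellT _) _ (hcellT _) hcod n hn hn' ?_
      -- The facet hyperplane has `p i` on its inner and `p (i + 1)` on its outer side, so it is
      -- crossed in the direction of its normal.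
      have e1 := hn.le (hcell (p i)) ⟨h1, h2⟩
      have e2 := hn'.le (hcell (p (i + 1))) ⟨h1, h2⟩
      rw [inner_neg_left, inner_neg_left] at e2
      have e3 : inner ℝ n (p (i + 1) - p i) = 1 / N * inner ℝ n (y - x) := by
        rw [hsub, inner_smul_right]
      rw [inner_sub_right] at e3
      have e4 : 0 ≤ 1 / N * inner ℝ n (y - x) := by rw [← e3]; linarith
      exact nonneg_of_mul_nonneg_right e4 (by positivity)
  have h0 : p 0 = x := by simp [p]
  have h1 : p N = y := by simp [p, div_self hN0.ne']
  have := key N le_rfl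
  rwa [h0, h1, hT.eq_of_mem_interior hQ (hcellT x) (hUQ hxU) (hcell x),
    hT.eq_of_mem_interior hR (hcellT y) (hVR hyV) (hcell y)] at this

/-- Any two cells are joined by a generic segment that passes through facets only. -/
theorem eq_of_forall_adjacent (hT : IsFaceTiling T) {α : Type*} (f : Set E → α)
    (hf : ∀ Q ∈ T, ∀ R ∈ T, HasCodim 1 (Q ∩ R) → f Q = f R) {Q R : Set E} (hQ : Q ∈ T)
    (hR : R ∈ T) : f Q = f R := by
  obtain ⟨x, -, y, -, h⟩ := hT.exists_walk hQ hR isOpen_interior (hT.interior_nonempty Q hQ)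
    subset_rfl isOpen_interior (hT.interior_nonempty R hR) subset_rfl
  exact h (fun S₁ S₂ => f S₁ = f S₂) (fun _ => rfl) (fun _ _ _ h h' => h.trans h')
    (fun S₁ h₁ S₂ h₂ h _ _ _ _ => hf S₁ h₁ S₂ h₂ h)

/-- A cocycle on the cells sharing a face of codimension at most two is a coboundary. -/
theorem exists_potential (hT : IsFaceTiling T) (c : Set E → Set E → Γ)
    (hc : ∀ Q ∈ T, ∀ R ∈ T, ∀ S ∈ T, (Q ∩ R ∩ S).Nonempty →
      finrank ℝ E ≤ finrank ℝ (vectorSpan ℝ (Q ∩ R ∩ S)) + 2 → c Q R + c R S = c Q S) :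
    ∃ a : Set E → Γ, ∀ Q ∈ T, ∀ R ∈ T, HasCodim 1 (Q ∩ R) → a R - a Q = c Q R := by
  classical
  choose cell hcellT hcell using hT.cover
  have hcQQ : ∀ Q ∈ T, c Q Q = 0 := fun Q hQ => by
    have := hc Q hQ Q hQ Q hQ
    rw [inter_self, inter_self] at this
    have h := this ((hT.interior_nonempty Q hQ).mono interior_subset) (by
      rw [vectorSpan_eq_top_of_interior (hT.interior_nonempty Q hQ), finrank_top]; omega)
    simpa using h
  have hcell_int : ∀ Q ∈ T, ∀ x ∈ interior Q, cell x = Q := fun Q hQ x hx =>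
    hT.eq_of_mem_interior hQ (hcellT x) hx (hcell x)
  -- The cocycle moved from cells to points, through a chosen cell containing each point.
  set k : E → E → Γ := fun x y => c (cell x) (cell y) with hk
  -- Triples of cells with intersection of codimension at least three, where the cocycle relation is
  -- not assumed.
  let bad : Set (Set E × Set E × Set E) := {i | (i.1 ∈ T ∧ i.2.1 ∈ T ∧ i.2.2 ∈ T) ∧
    finrank ℝ (vectorSpan ℝ (i.1 ∩ i.2.1 ∩ i.2.2)) + 3 ≤ finrank ℝ E}
  have hbad : bad.Countable :=
    (hT.countable.prod (hT.countable.prod hT.countable)).mono fun i hi => hi.1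
  let S : Set E × Set E × Set E → Set E := fun i => i.1 ∩ i.2.1 ∩ i.2.2
  have hpot : ∀ X : Set E, IsCompact X → Convex ℝ X →
      (∀ i ∈ bad, ∀ w ∈ X, w ∉ affineSpan ℝ (S i)) → ∃ φ, IsPotentialOn k X φ := by
    intro X hX hXc hXb
    obtain ⟨δ, hδ, hw⟩ := hT.exists_lebesgue hX
    refine exists_isPotentialOn hXc hX.isBounded k hδ fun x hx y hy z hz hxy hyz hxz => ?_
    obtain ⟨w, hwX, hw⟩ := hw x hx
    have h1 := hw _ (hcellT x) ⟨x, hcell x, Metric.mem_ball_self hδ⟩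
    have h2 := hw _ (hcellT y) ⟨y, hcell y, by rwa [Metric.mem_ball, dist_comm]⟩
    have h3 := hw _ (hcellT z) ⟨z, hcell z, by rwa [Metric.mem_ball, dist_comm]⟩
    refine hc _ (hcellT x) _ (hcellT y) _ (hcellT z) ⟨w, ⟨h1, h2⟩, h3⟩ ?_
    by_contra hlt
    exact hXb (cell x, cell y, cell z) ⟨⟨hcellT x, hcellT y, hcellT z⟩, by dsimp only; omega⟩ w hwX
      (subset_affineSpan ℝ _ ⟨⟨h1, h2⟩, h3⟩)
  let I : E → E → Γ := fun x y =>
    if h : ∃ φ, IsPotentialOn k (segment ℝ x y) φ then h.choose y - h.choose x else 0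
  have hI : ∀ x y φ, IsPotentialOn k (segment ℝ x y) φ → I x y = φ y - φ x := by
    intro x y φ hφ
    have h : ∃ φ, IsPotentialOn k (segment ℝ x y) φ := ⟨φ, hφ⟩
    simp only [I, dif_pos h]
    exact h.choose_spec.sub_eq (convex_segment x y) hφ (left_mem_segment ℝ x y)
      (right_mem_segment ℝ x y)
  have hd1 : ∀ i ∈ bad, ∀ x, finrank ℝ (vectorSpan ℝ (insert x (S i))) + 2 ≤ finrank ℝ E := by
    intro i hi x
    have h1 := finrank_vectorSpan_insert_le_add_one (S i) x
    have h2 := hi.2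
    simp only [S] at h1 ⊢
    omega
  have hd2 : ∀ i ∈ bad, ∀ x y,
      finrank ℝ (vectorSpan ℝ (insert y (insert x (S i)))) < finrank ℝ E := by
    intro i hi x y
    have h1 := finrank_vectorSpan_insert_le_add_one (insert x (S i)) y
    have h2 := hd1 i hi x
    omega
  obtain ⟨x₀, -, hx₀⟩ := exists_mem_avoiding hbad S (fun i hi => by
    have h2 := hi.2
    simp only [S]
    omega) isOpen_univ (univ_nonempty (α := E))
  have hgen : ∀ U : Set E, IsOpen U → U.Nonempty → ∃ y ∈ U, ∀ i ∈ bad,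
      y ∉ affineSpan ℝ (insert x₀ (S i)) := fun U hU hne =>
    exists_mem_avoiding hbad (fun i => insert x₀ (S i))
      (fun i hi => by have := hd1 i hi x₀; omega) hU hne
  have hgen2 : ∀ y, ∀ U : Set E, IsOpen U → U.Nonempty → ∃ z ∈ U, ∀ i ∈ bad,
      z ∉ affineSpan ℝ (insert y (insert x₀ (S i))) := fun y U hU hne =>
    exists_mem_avoiding hbad (fun i => insert y (insert x₀ (S i)))
      (fun i hi => hd2 i hi x₀ y) hU hne
  have hmono : ∀ y z i, z ∉ affineSpan ℝ (insert y (insert x₀ (S i))) →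
      z ∉ affineSpan ℝ (insert x₀ (S i)) := fun y z i h h' =>
    h (affineSpan_mono ℝ (subset_insert _ _) h')
  -- Closedness: a potential exists on the whole generic triangle, so the integrals over its sides
  -- add up.
  have htri : ∀ y z, (∀ i ∈ bad, y ∉ affineSpan ℝ (insert x₀ (S i))) →
      (∀ i ∈ bad, z ∉ affineSpan ℝ (insert y (insert x₀ (S i)))) → I x₀ y + I y z = I x₀ z := by
    intro y z hy hz
    obtain ⟨φ, hφ⟩ := hpot (convexHull ℝ {x₀, y, z})
      (Set.Finite.isCompact_convexHull ℝ (by simp)) (convex_convexHull ℝ _)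
      (fun i hi => triangle_disjoint_affineSpan (hx₀ i hi) (hy i hi) (hz i hi))
    have hm : ∀ p ∈ ({x₀, y, z} : Set E), ∀ q ∈ ({x₀, y, z} : Set E), I p q = φ q - φ p :=
      fun p hp q hq => hI p q φ (hφ.mono ((convex_convexHull ℝ _).segment_subset
        (subset_convexHull ℝ _ hp) (subset_convexHull ℝ _ hq)))
    rw [hm x₀ (by simp) y (by simp), hm y (by simp) z (by simp), hm x₀ (by simp) z (by simp)]
    abel
  have hint : ∀ Q ∈ T, ∀ y ∈ interior Q, ∀ z ∈ interior Q, I y z = 0 := by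
    intro Q hQ y hy z hz
    rw [hI y z 0 ⟨1, one_pos, fun p hp q hq _ => ?_⟩]
    · simp
    · have hs := (hT.convex Q hQ).interior.segment_subset hy hz
      simp only [hk, hcell_int Q hQ p (hs hp), hcell_int Q hQ q (hs hq), hcQQ Q hQ]
      simp
  have hex : ∀ Q ∈ T, ∃ y ∈ interior Q, ∀ i ∈ bad, y ∉ affineSpan ℝ (insert x₀ (S i)) :=
    fun Q hQ => hgen _ isOpen_interior (hT.interior_nonempty Q hQ)
  let pt : Set E → E := fun Q => if h : Q ∈ T then (hex Q h).choose else 0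
  have hpt : ∀ Q ∈ T, pt Q ∈ interior Q ∧ ∀ i ∈ bad, pt Q ∉ affineSpan ℝ (insert x₀ (S i)) := by
    intro Q hQ
    simp only [pt, dif_pos hQ]
    exact (hex Q hQ).choose_spec
  have hindep : ∀ Q ∈ T, ∀ y ∈ interior Q, (∀ i ∈ bad, y ∉ affineSpan ℝ (insert x₀ (S i))) →
      I x₀ y = I x₀ (pt Q) := by
    intro Q hQ y hy hyb
    -- An auxiliary point generic with respect to both `y` and `pt Q` compares the two integrals,
    -- since segments inside `Q` contribute nothing.
    obtain ⟨z, hz, hzb⟩ := exists_mem_avoiding (I := bad ×ˢ ({y, pt Q} : Set E))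
      (hbad.prod (by simp)) (fun j => insert j.2 (insert x₀ (S j.1)))
      (fun j hj => hd2 j.1 hj.1 x₀ j.2) isOpen_interior (hT.interior_nonempty Q hQ)
    have e1 := htri y z hyb (fun i hi => hzb (i, y) ⟨hi, by simp⟩)
    have e2 := htri (pt Q) z (hpt Q hQ).2 (fun i hi => hzb (i, pt Q) ⟨hi, by simp⟩)
    rw [hint Q hQ y hy z hz, add_zero] at e1
    rw [hint Q hQ (pt Q) (hpt Q hQ).1 z hz, add_zero] at e2
    rw [e1, e2]
  refine ⟨fun Q => I x₀ (pt Q), fun Q hQ R hR hQR => ?_⟩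
  have hQRc := (hT.convex Q hQ).inter (hT.convex R hR)
  obtain ⟨w, hw⟩ := exists_relInt hQRc hQR.1
  obtain ⟨r, hr, hball⟩ := hT.exists_ball w
  obtain ⟨y, ⟨hy, hyr⟩, hyb⟩ := hgen _ (isOpen_interior.inter Metric.isOpen_ball)
    (hT.interior_inter_ball_nonempty hQ hw.1.1 hr)
  obtain ⟨z, ⟨hz, hzr⟩, hzb⟩ := hgen2 y _ (isOpen_interior.inter Metric.isOpen_ball)
    (hT.interior_inter_ball_nonempty hR hw.1.2 hr)
  have hne := hT.ne_of_hasCodim_one hQ hQR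
  have hcRQ : c Q R + c R Q = 0 := by
    have h1 := hc Q hQ R hR Q hQ
    rw [inter_right_comm, inter_self, hcQQ Q hQ] at h1
    exact h1 hQR.1 (by have := hQR.2; omega)
  have hIyz : I y z = c Q R := by
    -- Near a relatively interior point of the facet only `Q` and `R` occur, so a two-valued
    -- potential is explicit.
    rw [hI y z (fun x => if cell x = Q then 0 else c Q R) ⟨1, one_pos, fun p hp q hq _ => ?_⟩]
    · simp [hcell_int Q hQ y hy, hcell_int R hR z hz, hne.symm]
    · have hs := (convex_ball w r).segment_subset hyr hzr
      have hcl : ∀ p ∈ segment ℝ y z, cell p = Q ∨ cell p = R := fun p hp =>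
        hT.eq_or_eq_of_relInt hQ hR (hcellT p) hQR hw
          (hball _ (hcellT p) ⟨p, hcell p, hs hp⟩)
      simp only [hk]
      rcases hcl p hp with hp | hp <;> rcases hcl q hq with hq | hq <;>
        simp [hp, hq, hne.symm, hcQQ Q hQ, hcQQ R hR]
      exact (eq_neg_of_add_eq_zero_right hcRQ).symm
  dsimp only
  rw [← hIyz, ← hindep Q hQ y hy hyb, ← hindep R hR z hz (fun i hi => hmono y z i (hzb i hi)),
    ← htri y z hyb hzb, add_sub_cancel_left]

end IsFaceTiling

end Parallelohedron

namespace Parallelohedron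

open Set Module

set_option linter.unusedSectionVars false

variable {E : Type*} [NormedAddCommGroup E] [InnerProductSpace ℝ E] [FiniteDimensional ℝ E]

local notation "⟪" x "," y "⟫" => inner ℝ x y

/-! ### The cells and facets around a face of codimension two -/

/-- The facets of the tiling that contain `G`. -/
def facetsAt (T : Set (Set E)) (G : Set E) : Set (Set E) :=
  {F | HasCodim 1 F ∧ (∃ Q ∈ T, IsExposed ℝ Q F) ∧ G ⊆ F}

/-- The cells of the tiling that contain `G`. -/
def cellsAt (T : Set (Set E)) (G : Set E) : Set (Set E) := {Q ∈ T | G ⊆ Q}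

/-- Unit normals to the facets around `G`, directed according to the orientation `ω`. -/
structure IsCoherent (T : Set (Set E)) (G : Set E) (ω : E →ₗ[ℝ] E →ₗ[ℝ] ℝ) (n : Set E → E) :
    Prop where
  alt : ω.IsAlt
  ker : ∀ v ∈ vectorSpan ℝ G, ω v = 0
  norm : ∀ F ∈ facetsAt T G, ‖n F‖ = 1
  orth : ∀ F ∈ facetsAt T G, ∀ v ∈ vectorSpan ℝ F, ⟪n F, v⟫ = 0
  pos : ∀ F ∈ facetsAt T G, ∀ x ∈ G, ∀ y ∈ F \ G, 0 < ω (y - x) (n F)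

theorem IsCoherent.neg {T : Set (Set E)} {G : Set E} {ω : E →ₗ[ℝ] E →ₗ[ℝ] ℝ} {n : Set E → E}
    (h : IsCoherent T G ω n) : IsCoherent T G (-ω) (-n) where
  alt x := by simp [h.alt x]
  ker v hv := by simp [h.ker v hv]
  norm F hF := by simp [h.norm F hF]
  orth F hF v hv := by simp [h.orth F hF v hv]
  pos F hF x hx y hy := by simpa using h.pos F hF x hx y hy

/-- A face of codimension two of some cell of the tiling. -/
structure IsRidge (T : Set (Set E)) (G : Set E) : Prop where
  codim : HasCodim 2 G
  exposed : ∃ Q ∈ T, IsExposed ℝ Q G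

variable {T : Set (Set E)}

namespace IsFaceTiling

/-- Facets through `g` are not violated in the direction `z`, and the finitely many others have
slack at `g`. By `exists_facet_separating` no further constraint exists. -/
theorem exists_add_smul_mem (hT : IsFaceTiling T) {Q : Set E} (hQ : Q ∈ T) {g z : E} (hg : g ∈ Q)
    (hz : ∀ R ∈ T, HasCodim 1 (Q ∩ R) → g ∈ R → ∀ n, IsFacetNormal Q (Q ∩ R) n → ⟪n, z⟫ ≤ 0) :
    ∃ ε > (0 : ℝ), g + ε • z ∈ Q := by
  have hev : ∀ᶠ ε : ℝ in nhdsWithin 0 (Ioi 0), ∀ R ∈ {R ∈ T | (Q ∩ R).Nonempty},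
      HasCodim 1 (Q ∩ R) → ∃ n, IsFacetNormal Q (Q ∩ R) n ∧ ∃ y ∈ Q ∩ R, ⟪n, g + ε • z⟫ ≤ ⟪n, y⟫ := by
    rw [Filter.eventually_all_finite (hT.finite_inter (hT.compact Q hQ))]
    rintro R ⟨hR, -⟩
    by_cases hcod : HasCodim 1 (Q ∩ R)
    swap
    · exact Filter.Eventually.of_forall fun ε h => absurd h hcod
    obtain ⟨n, hn, -⟩ := hT.exists_normal hQ hR hcod
    by_cases hgR : g ∈ R
    · filter_upwards [self_mem_nhdsWithin] with ε hε _
      refine ⟨n, hn, g, ⟨hg, hgR⟩, ?_⟩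
      rw [inner_add_right, inner_smul_right]
      have := mul_nonpos_of_nonneg_of_nonpos (le_of_lt hε) (hz R hR hcod hgR n hn)
      linarith
    · obtain ⟨y, hy⟩ := hcod.1
      have hlt : ⟪n, g⟫ < ⟪n, y⟫ := by
        by_contra hle
        exact hgR (hn.mem hg hy (not_lt.1 hle)).2
      have hc : Filter.Tendsto (fun ε : ℝ => ⟪n, g + ε • z⟫) (nhds 0) (nhds ⟪n, g + (0 : ℝ) • z⟫) := by
        refine Continuous.tendsto ?_ 0
        fun_prop
      rw [zero_smul, add_zero] at hc
      filter_upwards [(hc.eventually (eventually_lt_nhds hlt)).filter_mono nhdsWithin_le_nhds]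
        with ε hε _
      exact ⟨n, hn, y, hy, hε.le⟩
  obtain ⟨ε, hε, h0⟩ := (hev.and self_mem_nhdsWithin).exists
  refine ⟨ε, h0, ?_⟩
  by_contra hnot
  obtain ⟨R, hR, hcod, hsep⟩ := hT.exists_facet_separating hQ hnot
  obtain ⟨n, hn, y, hy, hle⟩ := hε R ⟨hR, hcod.1⟩ hcod
  exact absurd (hsep n hn y hy) (not_lt.2 hle)

/-- Otherwise one normal `n₁` governs all facets through `g`. A nonzero `z` orthogonal to `n₁` and
to `G` could be followed both ways inside `Q`; the functional exposing `G` would be constant along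
it, forcing `z` to be a direction of `G`. -/
theorem exists_two_facets (hT : IsFaceTiling T) {Q G : Set E} (hQ : Q ∈ T) (hG : HasCodim 2 G)
    (hGQ : IsExposed ℝ Q G) {g : E} (hg : g ∈ G) :
    ∃ R₁ ∈ T, ∃ R₂ ∈ T, R₁ ≠ R₂ ∧ HasCodim 1 (Q ∩ R₁) ∧ HasCodim 1 (Q ∩ R₂) ∧ g ∈ R₁ ∧ g ∈ R₂ := by
  by_contra! hcon
  have hex : ∃ n₁ : E, ∀ R ∈ T, HasCodim 1 (Q ∩ R) → g ∈ R → ∀ n, IsFacetNormal Q (Q ∩ R) n →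
      n = n₁ := by
    by_cases h : ∃ R ∈ T, HasCodim 1 (Q ∩ R) ∧ g ∈ R
    · obtain ⟨R₁, hR₁, hc₁, hg₁⟩ := h
      obtain ⟨n₁, hn₁, -⟩ := hT.exists_normal hQ hR₁ hc₁
      refine ⟨n₁, fun R hR hc hgR n hn => ?_⟩
      obtain rfl : R₁ = R := by
        by_contra hne
        exact hcon R₁ hR₁ R hR hne hc₁ hc hg₁ hgR
      exact hn₁.unique (hT.interior_nonempty Q hQ) hc hn
    · push Not at h
      exact ⟨0, fun R hR hc hgR => absurd hgR (h R hR hc)⟩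
  obtain ⟨n₁, hn₁⟩ := hex
  have hlt : finrank ℝ (vectorSpan ℝ G ⊔ (ℝ ∙ n₁) : Submodule ℝ E) < finrank ℝ E := by
    have h1 := Submodule.finrank_add_le_finrank_add_finrank (vectorSpan ℝ G) (ℝ ∙ n₁)
    have h2 : finrank ℝ (ℝ ∙ n₁) ≤ 1 := (finrank_span_le_card {n₁}).trans (by simp)
    have := hG.2
    omega
  have hne : (vectorSpan ℝ G ⊔ (ℝ ∙ n₁) : Submodule ℝ E)ᗮ ≠ ⊥ := by
    intro h
    rw [Submodule.orthogonal_eq_bot_iff] at h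
    rw [h, finrank_top] at hlt
    exact lt_irrefl _ hlt
  obtain ⟨z, hz, hz0⟩ := Submodule.exists_mem_ne_zero_of_ne_bot hne
  rw [Submodule.mem_orthogonal] at hz
  have hzn : ⟪n₁, z⟫ = 0 := hz n₁ (Submodule.mem_sup_right (Submodule.mem_span_singleton_self n₁))
  have hzG : ∀ u ∈ vectorSpan ℝ G, ⟪u, z⟫ = 0 := fun u hu => hz u (Submodule.mem_sup_left hu)
  have hgQ := hGQ.subset hg
  obtain ⟨ε, hε, h1⟩ := hT.exists_add_smul_mem hQ (z := z) hgQ fun R hR hc hgR n hn => by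
    rw [hn₁ R hR hc hgR n hn, hzn]
  obtain ⟨ε', hε', h2⟩ := hT.exists_add_smul_mem hQ (z := -z) hgQ fun R hR hc hgR n hn => by
    rw [hn₁ R hR hc hgR n hn, inner_neg_right, hzn, neg_zero]
  obtain ⟨l, hl⟩ := hGQ ⟨g, hg⟩
  have hgl := hg
  rw [hl] at hgl
  have e1 := hgl.2 _ h1
  have e2 := hgl.2 _ h2
  simp only [map_add, map_smul, map_neg, smul_eq_mul] at e1 e2
  have e3 : l z = 0 := by
    refine le_antisymm ?_ ?_ <;> by_contra hh <;> push Not at hh <;> nlinarith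
  have hmem : g + ε • z ∈ G := by
    rw [hl]
    refine ⟨h1, fun y hy => ?_⟩
    rw [map_add, map_smul, e3, smul_zero, add_zero]
    exact hgl.2 y hy
  have h3 := hzG _ (sub_mem_vectorSpan hmem hg)
  rw [add_sub_cancel_left, inner_smul_left, real_inner_self_eq_norm_sq] at h3
  simp only [conj_trivial, mul_eq_zero] at h3
  rcases h3 with h3 | h3
  · exact hε.ne' h3
  · exact hz0 (by simpa using h3)

/-- Two different facets of a cell through the same ridge intersect in the ridge. -/
theorem inter_eq_of_codim_two {Q F₁ F₂ G : Set E} (hG : HasCodim 2 G)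
    (hGQ : IsExposed ℝ Q G) (h₁ : HasCodim 1 F₁) (h₂ : HasCodim 1 F₂) (hF₁ : IsExposed ℝ Q F₁)
    (hF₂ : IsExposed ℝ Q F₂) (hG₁ : G ⊆ F₁) (hG₂ : G ⊆ F₂) (hne : F₁ ≠ F₂) : F₁ ∩ F₂ = G := by
  have hsub : G ⊆ F₁ ∩ F₂ := subset_inter hG₁ hG₂
  symm
  refine eq_of_exposed_of_finrank_le hGQ hG.1 hsub (inter_subset_left.trans hF₁.subset) ?_
  have hn := hG.1.mono hsub
  have hlt : finrank ℝ (vectorSpan ℝ (F₁ ∩ F₂)) < finrank ℝ (vectorSpan ℝ F₁) := by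
    refine finrank_lt_of_exposed (hF₁.inter hF₂) hn inter_subset_left hF₁.subset fun h => ?_
    exact hne (HasCodim.eq_of_exposed hF₁ h₁ h₂ (inter_eq_left.1 h) hF₂.subset)
  have := hG.2
  have := h₁.2
  omega

theorem subset_of_relInt (hT : IsFaceTiling T) {G : Set E} (hG : IsRidge T G) {g : E}
    (hg : RelInt G g) {R : Set E} (hR : R ∈ T) (hgR : g ∈ R) : G ⊆ R := by
  obtain ⟨Q, hQ, hGQ⟩ := hG.exposed
  exact (exposed_subset_of_relInt (hT.face Q hQ R hR) hGQ.subset hg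
    ⟨hGQ.subset hg.1, hgR⟩).trans inter_subset_right

theorem exists_relInt_ridge (hT : IsFaceTiling T) {G : Set E} (hG : IsRidge T G) :
    ∃ g, RelInt G g := by
  obtain ⟨Q, hQ, hGQ⟩ := hG.exposed
  exact exists_relInt (hGQ.convex (hT.convex Q hQ)) hG.codim.1

/-- Either `G = Q ∩ R`, a face of both cells, or `Q ∩ R` is a facet and a second facet `Q ∩ S` of
`Q` cuts out `G`. In the latter case `G = (R ∩ Q) ∩ (R ∩ S)` is an intersection of faces of `R`. -/
theorem ridge_exposed (hT : IsFaceTiling T) {G : Set E} (hG : IsRidge T G) {R : Set E}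
    (hR : R ∈ T) (hGR : G ⊆ R) : IsExposed ℝ R G := by
  obtain ⟨g, hg⟩ := hT.exists_relInt_ridge hG
  obtain ⟨Q, hQ, hGQ⟩ := hG.exposed
  by_cases hRQ : R = Q
  · rwa [hRQ]
  have hsub : G ⊆ Q ∩ R := subset_inter hGQ.subset hGR
  have hlt := hT.finrank_inter_lt hQ hR (Ne.symm hRQ) (hG.codim.1.mono hsub)
  have h2 := hG.codim.2
  by_cases hcod : finrank ℝ (vectorSpan ℝ (Q ∩ R)) + 1 = finrank ℝ E
  · have hcod : HasCodim 1 (Q ∩ R) := ⟨hG.codim.1.mono hsub, hcod⟩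
    obtain ⟨R₁, hR₁, R₂, hR₂, hne, hc₁, hc₂, hg₁, hg₂⟩ :=
      hT.exists_two_facets hQ hG.codim hGQ hg.1
    obtain ⟨S, hS, hSR, hcS, hgS⟩ : ∃ S ∈ T, S ≠ R ∧ HasCodim 1 (Q ∩ S) ∧ g ∈ S := by
      by_cases h : R₁ = R
      · exact ⟨R₂, hR₂, fun h' => hne (h.trans h'.symm), hc₂, hg₂⟩
      · exact ⟨R₁, hR₁, h, hc₁, hg₁⟩
    have hGS := hT.subset_of_relInt hG hg hS hgS
    have he := inter_eq_of_codim_two hG.codim hGQ hcod hcS (hT.face Q hQ R hR)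
      (hT.face Q hQ S hS) hsub (subset_inter hGQ.subset hGS)
      (fun h => hSR (hT.neighbor_unique hQ hR hS hcod h).symm)
    have he' : (R ∩ Q) ∩ (R ∩ S) = G := by
      rw [← he]
      ext x
      simp only [mem_inter_iff]
      tauto
    rw [← he']
    exact (hT.face R hR Q hQ).inter (hT.face R hR S hS)
  · have he : G = Q ∩ R := eq_of_exposed_of_finrank_le hGQ hG.codim.1 hsub inter_subset_left
      (by omega)
    rw [he]
    exact hT.face' hQ hR

theorem mem_facetsAt (hT : IsFaceTiling T) {G Q R : Set E} (hQ : Q ∈ cellsAt T G)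
    (hR : R ∈ cellsAt T G) (h : HasCodim 1 (Q ∩ R)) : Q ∩ R ∈ facetsAt T G :=
  ⟨h, ⟨Q, hQ.1, hT.face Q hQ.1 R hR.1⟩, subset_inter hQ.2 hR.2⟩

theorem hasCodim_one_of_not_subset (hT : IsFaceTiling T) {G Q R : Set E} (hG : IsRidge T G)
    (hQ : Q ∈ cellsAt T G) (hR : R ∈ cellsAt T G) (hne : Q ≠ R) (hGne : G ≠ Q ∩ R) :
    HasCodim 1 (Q ∩ R) := by
  have hsub : G ⊆ Q ∩ R := subset_inter hQ.2 hR.2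
  refine ⟨hG.codim.1.mono hsub, ?_⟩
  have h1 := finrank_lt_of_exposed (hT.ridge_exposed hG hQ.1 hQ.2) hG.codim.1 hsub
    inter_subset_left hGne
  have h2 := hT.finrank_inter_lt hQ.1 hR.1 hne (hG.codim.1.mono hsub)
  have := hG.codim.2
  omega

theorem finite_cellsAt (hT : IsFaceTiling T) {G : Set E} (hG : G.Nonempty) :
    (cellsAt T G).Finite := by
  obtain ⟨g, hg⟩ := hG
  exact (hT.finite_mem g).subset fun _ hQ => ⟨hQ.1, hQ.2 hg⟩

/-- The star of a ridge is connected through facets. Near `g` a generic segment misses the affine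
span of `G`; if `f` took different values, two closed unions of cells would meet on it, and cells
meeting outside `G` share a facet. -/
theorem eq_of_forall_adjacent_around (hT : IsFaceTiling T) {G : Set E} (hG : IsRidge T G)
    {α : Type*} (f : Set E → α)
    (hf : ∀ Q ∈ cellsAt T G, ∀ R ∈ cellsAt T G, HasCodim 1 (Q ∩ R) → f Q = f R) {Q R : Set E}
    (hQ : Q ∈ cellsAt T G) (hR : R ∈ cellsAt T G) : f Q = f R := by
  obtain ⟨g, hg⟩ := hT.exists_relInt_ridge hG
  obtain ⟨r, hr, hball⟩ := hT.exists_ball g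
  have hd := hG.codim.2
  obtain ⟨x, hx, hxG⟩ := exists_mem_avoiding (I := {()}) (by simp) (fun _ => G)
    (fun _ _ => by omega) (isOpen_interior.inter Metric.isOpen_ball)
    (hT.interior_inter_ball_nonempty hQ.1 (hQ.2 hg.1) hr)
  obtain ⟨y, hy, hyG⟩ := exists_mem_avoiding (I := {()}) (by simp) (fun _ => insert x G)
    (fun _ _ => by have := finrank_vectorSpan_insert_le_add_one G x; omega)
    (isOpen_interior.inter Metric.isOpen_ball)
    (hT.interior_inter_ball_nonempty hR.1 (hR.2 hg.1) hr)
  have hseg := segment_disjoint_affineSpan (hxG () rfl) (hyG () rfl)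
  have hfin := hT.finite_cellsAt hG.codim.1
  by_contra hne
  obtain ⟨z, hz, hz1, hz2⟩ := isPreconnected_closed_iff.1 (convex_segment x y).isPreconnected
    (⋃ S ∈ {S ∈ cellsAt T G | f S = f Q}, S) (⋃ S ∈ {S ∈ cellsAt T G | f S ≠ f Q}, S)
    ((hfin.subset fun _ h => h.1).isClosed_biUnion fun S hS => (hT.compact S hS.1.1).isClosed)
    ((hfin.subset fun _ h => h.1).isClosed_biUnion fun S hS => (hT.compact S hS.1.1).isClosed)
    (fun z hz => by
      obtain ⟨S, hS, hzS⟩ := hT.cover z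
      have hSG : S ∈ cellsAt T G := ⟨hS, hT.subset_of_relInt hG hg hS
        (hball S hS ⟨z, hzS, (convex_ball g r).segment_subset hx.2 hy.2 hz⟩)⟩
      by_cases h : f S = f Q
      · exact Or.inl (mem_biUnion (x := S) ⟨hSG, h⟩ hzS)
      · exact Or.inr (mem_biUnion (x := S) ⟨hSG, h⟩ hzS))
    ⟨x, left_mem_segment ℝ x y, mem_biUnion (x := Q) ⟨hQ, rfl⟩ (interior_subset hx.1)⟩
    ⟨y, right_mem_segment ℝ x y, mem_biUnion (x := R) ⟨hR, Ne.symm hne⟩ (interior_subset hy.1)⟩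
  simp only [mem_iUnion] at hz1 hz2
  obtain ⟨S, ⟨hS, hfS⟩, hzS⟩ := hz1
  obtain ⟨S', ⟨hS', hfS'⟩, hzS'⟩ := hz2
  refine hfS' (hfS ▸ (hf S hS S' hS' ?_).symm)
  refine hT.hasCodim_one_of_not_subset hG hS hS' (fun h => hfS' (h ▸ hfS)) fun h => ?_
  refine hseg z hz (subset_affineSpan ℝ _ ?_)
  rw [h]
  exact ⟨hzS, hzS'⟩

theorem exists_src_tgt (hT : IsFaceTiling T) {F : Set E} (hF : HasCodim 1 F)
    (hQ : ∃ Q ∈ T, IsExposed ℝ Q F) {n : E} (hn : ‖n‖ = 1)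
    (ho : ∀ v ∈ vectorSpan ℝ F, ⟪n, v⟫ = 0) :
    ∃ Q ∈ T, ∃ R ∈ T, Q ∩ R = F ∧ IsFacetNormal Q F n ∧ IsFacetNormal R F (-n) := by
  obtain ⟨Q, hQ, hFQ⟩ := hQ
  obtain ⟨R, hR, -, rfl⟩ := hT.exists_neighbor hQ hF hFQ
  obtain ⟨ν, h1, h2⟩ := hT.exists_normal hQ hR hF
  rcases eq_or_eq_neg_of_orthogonal hF h1.1 hn (fun u => h1.inner_vectorSpan) ho with rfl | rfl
  · exact ⟨Q, hQ, R, hR, rfl, h1, h2⟩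
  · exact ⟨R, hR, Q, hQ, inter_comm _ _, h2, by rwa [neg_neg]⟩

theorem cell_unique (hT : IsFaceTiling T) {Q R F : Set E} {n : E} (hQ : Q ∈ T) (hR : R ∈ T)
    (hF : HasCodim 1 F) (h : IsFacetNormal Q F n) (h' : IsFacetNormal R F n) : Q = R := by
  obtain ⟨x, hx, hx'⟩ := interior_inter_nonempty_of_same_side (hT.convex Q hQ)
      (hT.interior_nonempty Q hQ) (hT.convex R hR) (hT.interior_nonempty R hR) hF h h'
  exact (hT.eq_of_mem_interior hQ hR hx (interior_subset hx')).symm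

end IsFaceTiling

/-! ### Outgoing facets of a cell at a ridge -/

theorem mem_vectorSpan_of_codim_two {G : Set E} (hG : HasCodim 2 G) {n₁ n₂ : E}
    (hli : LinearIndependent ℝ ![n₁, n₂]) (h₁ : ∀ u ∈ vectorSpan ℝ G, ⟪n₁, u⟫ = 0)
    (h₂ : ∀ u ∈ vectorSpan ℝ G, ⟪n₂, u⟫ = 0) {u : E} (hu₁ : ⟪n₁, u⟫ = 0) (hu₂ : ⟪n₂, u⟫ = 0) :
    u ∈ vectorSpan ℝ G := by
  have hle : ∀ v, v ∈ (Submodule.span ℝ {n₁, n₂})ᗮ ↔ ⟪n₁, v⟫ = 0 ∧ ⟪n₂, v⟫ = 0 := by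
    intro v
    rw [Submodule.mem_orthogonal]
    constructor
    · exact fun h => ⟨h _ (Submodule.subset_span (by simp)), h _ (Submodule.subset_span (by simp))⟩
    · rintro ⟨h1, h2⟩ w hw
      obtain ⟨a, b, rfl⟩ := Submodule.mem_span_pair.1 hw
      rw [inner_add_left, inner_smul_left, inner_smul_left, h1, h2]
      simp
  have he : vectorSpan ℝ G = (Submodule.span ℝ {n₁, n₂})ᗮ := by
    refine Submodule.eq_of_le_of_finrank_le (fun v hv => (hle v).2 ⟨h₁ v hv, h₂ v hv⟩) ?_
    have h3 := Submodule.finrank_add_finrank_orthogonal (Submodule.span ℝ {n₁, n₂})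
    have h4 := finrank_span_eq_card hli
    rw [Matrix.range_cons_cons_empty, Fintype.card_fin] at h4
    have := hG.2
    omega
  rw [he, hle]
  exact ⟨hu₁, hu₂⟩

/-- The outgoing facet of a cell at a ridge is unique. -/
theorem IsCoherent.facet_unique {G : Set E} (hG : HasCodim 2 G) {ω : E →ₗ[ℝ] E →ₗ[ℝ] ℝ}
    {n : Set E → E} (h : IsCoherent T G ω n) {Q F₁ F₂ : Set E} (hGQ : IsExposed ℝ Q G)
    (hF₁ : F₁ ∈ facetsAt T G) (hF₂ : F₂ ∈ facetsAt T G) (hE₁ : IsExposed ℝ Q F₁)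
    (hE₂ : IsExposed ℝ Q F₂) (hn₁ : IsFacetNormal Q F₁ (n F₁)) (hn₂ : IsFacetNormal Q F₂ (n F₂)) :
    F₁ = F₂ := by
  by_contra hne
  have hinter := IsFaceTiling.inter_eq_of_codim_two hG hGQ hF₁.1 hF₂.1 hE₁ hE₂ hF₁.2.2 hF₂.2.2 hne
  obtain ⟨g, hg⟩ := hG.1
  have hex : ∀ F ∈ facetsAt T G, ∃ y ∈ F, y ∉ G := by
    intro F hF
    by_contra! hc
    have := hF.2.2.antisymm hc
    have h1 := hF.1.2
    have h2 := hG.2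
    rw [← this] at h1
    omega
  obtain ⟨y₁, hy₁, hyG₁⟩ := hex F₁ hF₁
  obtain ⟨y₂, hy₂, hyG₂⟩ := hex F₂ hF₂
  have hp₁ := h.pos F₁ hF₁ g hg y₁ ⟨hy₁, hyG₁⟩
  have hp₂ := h.pos F₂ hF₂ g hg y₂ ⟨hy₂, hyG₂⟩
  have ho₁ : ⟪n F₁, y₁ - g⟫ = 0 := hn₁.inner_vectorSpan (sub_mem_vectorSpan hy₁ (hF₁.2.2 hg))
  have ho₂ : ⟪n F₂, y₂ - g⟫ = 0 := hn₂.inner_vectorSpan (sub_mem_vectorSpan hy₂ (hF₂.2.2 hg))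
  have hl₁ : ⟪n F₁, y₂ - g⟫ < 0 := by
    rw [inner_sub_right, sub_neg]
    by_contra hc
    have := hn₁.mem (hE₂.subset hy₂) (hF₁.2.2 hg) (not_lt.1 hc)
    exact hyG₂ (hinter ▸ ⟨this, hy₂⟩)
  have hl₂ : ⟪n F₂, y₁ - g⟫ < 0 := by
    rw [inner_sub_right, sub_neg]
    by_contra hc
    have := hn₂.mem (hE₁.subset hy₁) (hF₂.2.2 hg) (not_lt.1 hc)
    exact hyG₁ (hinter ▸ ⟨hy₁, this⟩)
  have hG₁ : ∀ u ∈ vectorSpan ℝ G, ⟪n F₁, u⟫ = 0 := fun u hu =>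
    hn₁.inner_vectorSpan (vectorSpan_mono ℝ hF₁.2.2 hu)
  have hG₂ : ∀ u ∈ vectorSpan ℝ G, ⟪n F₂, u⟫ = 0 := fun u hu =>
    hn₂.inner_vectorSpan (vectorSpan_mono ℝ hF₂.2.2 hu)
  generalize y₁ - g = u₁ at *
  generalize y₂ - g = u₂ at *
  have hN₁ : ⟪n F₁, n F₁⟫ = 1 := by rw [real_inner_self_eq_norm_sq, hn₁.1]; norm_num
  have hN₂ : ⟪n F₂, n F₂⟫ = 1 := by rw [real_inner_self_eq_norm_sq, hn₂.1]; norm_num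
  have hn0 := hn₁.ne_zero
  generalize n F₁ = m₁ at *
  generalize n F₂ = m₂ at *
  set t := ⟪m₁, m₂⟫ with ht
  have ht' : ⟪m₂, m₁⟫ = t := real_inner_comm _ _
  have hli : LinearIndependent ℝ ![m₁, m₂] := by
    rw [LinearIndependent.pair_iff' hn0]
    rintro a rfl
    rw [inner_smul_left, ho₁, mul_zero] at hl₂
    exact lt_irrefl _ hl₂
  have hpos : 0 < 1 - t ^ 2 := by
    have hx : m₂ - t • m₁ ≠ 0 := by
      intro h0
      rw [LinearIndependent.pair_iff' hn0] at hli
      exact hli t (sub_eq_zero.1 h0).symm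
    have h1 : 0 < ⟪m₂ - t • m₁, m₂ - t • m₁⟫ := real_inner_self_pos.2 hx
    simp only [inner_sub_left, inner_sub_right, inner_smul_left, inner_smul_right, hN₁, hN₂, ← ht,
      ht', conj_trivial] at h1
    nlinarith
  -- Modulo directions of `G`, a vector is determined by its products with `m₁` and `m₂`. Solving
  -- the Gram system with off-diagonal entry `t` expresses it in these normals.
  have key : ∀ u : E, ∀ p q : ℝ, ⟪m₁, u⟫ = p + q * t → ⟪m₂, u⟫ = p * t + q →
      ω u = ω (p • m₁ + q • m₂) := by
    intro u p q h1 h2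
    have hmem : u - (p • m₁ + q • m₂) ∈ vectorSpan ℝ G := by
      refine mem_vectorSpan_of_codim_two hG hli hG₁ hG₂ ?_ ?_
      · rw [inner_sub_right, inner_add_right, inner_smul_right, inner_smul_right, hN₁, h1, ← ht]
        ring
      · rw [inner_sub_right, inner_add_right, inner_smul_right, inner_smul_right, hN₂, h2, ht']
        ring
    have := h.ker _ hmem
    rwa [map_sub, sub_eq_zero] at this
  have hneg : ω m₂ m₁ = - ω m₁ m₂ := by rw [h.alt.neg]
  rw [key u₁ (-(⟪m₂, u₁⟫ / (1 - t ^ 2)) * t) (⟪m₂, u₁⟫ / (1 - t ^ 2))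
    (by rw [ho₁]; ring) (by field_simp; ring)] at hp₁
  rw [key u₂ (⟪m₁, u₂⟫ / (1 - t ^ 2)) (-(⟪m₁, u₂⟫ / (1 - t ^ 2)) * t)
    (by field_simp; ring) (by rw [ho₂]; ring)] at hp₂
  simp only [map_add, map_smul, LinearMap.add_apply, LinearMap.smul_apply, h.alt m₁, h.alt m₂,
    smul_eq_mul, mul_zero, zero_add, add_zero, hneg] at hp₁ hp₂
  have hq₁ : ⟪m₂, u₁⟫ / (1 - t ^ 2) < 0 := div_neg_of_neg_of_pos hl₂ hpos
  have hq₂ : ⟪m₁, u₂⟫ / (1 - t ^ 2) < 0 := div_neg_of_neg_of_pos hl₁ hpos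
  -- The two facets require opposite signs of `ω m₁ m₂`.
  have s₁ := neg_of_mul_pos_right hp₁ hq₁.le
  have s₂ := neg_of_mul_pos_right hp₂ hq₂.le
  linarith

end Parallelohedron

namespace Parallelohedron

open Set Module

set_option linter.unusedSectionVars false

variable {E : Type*} [NormedAddCommGroup E] [InnerProductSpace ℝ E] [FiniteDimensional ℝ E]
variable {Γ : Type*} [AddCommGroup Γ]

local notation "⟪" x "," y "⟫" => inner ℝ x y

/-! ### Potentials around a ridge -/

/-- Partial sums of `h` along the orbit of `x₀` are periodic because the total is zero, so they
descend to `ι`. -/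
theorem exists_cycle_potential {ι : Type*} [Fintype ι] (σ : Equiv.Perm ι)
    (hσ : ∀ x y, σ.SameCycle x y) (h : ι → Γ) (hs : ∑ i, h i = 0) :
    ∃ a : ι → Γ, ∀ x, a (σ x) - a x = h x := by
  rcases isEmpty_or_nonempty ι with hι | ⟨⟨x₀⟩⟩
  · exact ⟨0, fun x => hι.elim x⟩
  set N := (Finset.univ : Finset ι).card with hN
  have hcyc : σ.IsCycleOn ((Finset.univ : Finset ι) : Set ι) :=
    ⟨by simp, fun x _ y _ => hσ x y⟩
  set s : ℕ → Γ := fun m => ∑ j ∈ Finset.range m, h ((σ ^ j) x₀) with hsdef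
  have hsum : ∀ y, ∑ j ∈ Finset.range N, h ((σ ^ j) y) = 0 := by
    intro y
    rw [← hs]
    refine Finset.sum_bij (fun j _ => (σ ^ j) y) (fun _ _ => Finset.mem_univ _) ?_ ?_
      (fun _ _ => rfl)
    · intro i hi j hj hij
      rw [hcyc.pow_apply_eq_pow_apply (Finset.mem_univ y)] at hij
      exact hij.eq_of_lt_of_lt (Finset.mem_range.1 hi) (Finset.mem_range.1 hj)
    · intro z _
      obtain ⟨j, hj, hz⟩ := hcyc.exists_pow_eq (Finset.mem_univ y) (Finset.mem_univ z)
      exact ⟨j, Finset.mem_range.2 hj, hz⟩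
  have hper : Function.Periodic s N := by
    intro m
    simp only [hsdef]
    rw [Finset.sum_range_add]
    have := hsum ((σ ^ m) x₀)
    simp only [← Equiv.Perm.mul_apply, ← pow_add] at this
    simp only [add_comm m]
    rw [this, add_zero]
  have hex : ∀ x, ∃ m : ℕ, (σ ^ m) x₀ = x := fun x => by
    obtain ⟨m, -, hm⟩ := hcyc.exists_pow_eq (Finset.mem_univ x₀) (Finset.mem_univ x)
    exact ⟨m, hm⟩
  choose i hi using hex
  refine ⟨fun x => s (i x), fun x => ?_⟩
  have h1 : s (i (σ x)) = s (i x + 1) := by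
    have h2 : (σ ^ i (σ x)) x₀ = (σ ^ (i x + 1)) x₀ := by
      rw [hi, pow_succ', Equiv.Perm.mul_apply, hi]
    rw [hcyc.pow_apply_eq_pow_apply (Finset.mem_univ x₀)] at h2
    rw [← hper.map_mod_nat, ← hper.map_mod_nat (i x + 1)]
    exact congrArg s h2
  dsimp only
  rw [h1]
  simp only [hsdef]
  rw [Finset.sum_range_succ, add_sub_cancel_left, hi]

variable {T : Set (Set E)}

/-- The facets around `G` are matched with the cells around `G` by taking the cell on the negative,
respectively on the positive side. -/
structure IsMatching (T : Set (Set E)) (G : Set E) (n : Set E → E) (src tgt : Set E → Set E) :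
    Prop where
  bij_src : BijOn src (facetsAt T G) (cellsAt T G)
  bij_tgt : BijOn tgt (facetsAt T G) (cellsAt T G)
  inter : ∀ F ∈ facetsAt T G, src F ∩ tgt F = F
  normal_src : ∀ F ∈ facetsAt T G, IsFacetNormal (src F) F (n F)
  normal_tgt : ∀ F ∈ facetsAt T G, IsFacetNormal (tgt F) F (-(n F))

namespace IsFaceTiling

/-- The cell has two facets through the ridge. Were neither outgoing, both would be outgoing for the
reversed orientation, against `facet_unique`. -/
theorem exists_out_facet (hT : IsFaceTiling T) {G : Set E} (hG : IsRidge T G)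
    {ω : E →ₗ[ℝ] E →ₗ[ℝ] ℝ} {n : Set E → E} (h : IsCoherent T G ω n) {Q : Set E}
    (hQ : Q ∈ cellsAt T G) :
    ∃ F ∈ facetsAt T G, IsExposed ℝ Q F ∧ IsFacetNormal Q F (n F) := by
  obtain ⟨g, hg⟩ := hT.exists_relInt_ridge hG
  have hGQ := hT.ridge_exposed hG hQ.1 hQ.2
  obtain ⟨R₁, hR₁, R₂, hR₂, hne, hc₁, hc₂, hg₁, hg₂⟩ :=
    hT.exists_two_facets hQ.1 hG.codim hGQ hg.1
  by_contra! hcon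
  have hmem : ∀ R ∈ T, HasCodim 1 (Q ∩ R) → g ∈ R → Q ∩ R ∈ facetsAt T G ∧
      IsFacetNormal Q (Q ∩ R) ((-n) (Q ∩ R)) := by
    intro R hR hc hgR
    have hF := hT.mem_facetsAt hQ ⟨hR, hT.subset_of_relInt hG hg hR hgR⟩ hc
    refine ⟨hF, ?_⟩
    have hE := hT.face Q hQ.1 R hR
    obtain ⟨ν, hν, -⟩ := hT.exists_normal hQ.1 hR hc
    rcases eq_or_eq_neg_of_orthogonal hc hν.1 (h.norm _ hF) (fun u => hν.inner_vectorSpan)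
      (h.orth _ hF) with he | he
    · exact absurd (he ▸ hν) (hcon _ hF hE)
    · rw [Pi.neg_apply, he, neg_neg]
      exact hν
  obtain ⟨hF₁, hn₁⟩ := hmem R₁ hR₁ hc₁ hg₁
  obtain ⟨hF₂, hn₂⟩ := hmem R₂ hR₂ hc₂ hg₂
  have := h.neg.facet_unique hG.codim hGQ hF₁ hF₂ (hT.face Q hQ.1 R₁ hR₁) (hT.face Q hQ.1 R₂ hR₂)
    hn₁ hn₂
  exact hne (hT.neighbor_unique hQ.1 hR₁ hR₂ hc₁ this)

theorem exists_isMatching (hT : IsFaceTiling T) {G : Set E} (hG : IsRidge T G)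
    {ω : E →ₗ[ℝ] E →ₗ[ℝ] ℝ} {n : Set E → E} (h : IsCoherent T G ω n) :
    ∃ src tgt, IsMatching T G n src tgt := by
  have hex : ∀ F, ∃ Q R, F ∈ facetsAt T G → Q ∈ T ∧ R ∈ T ∧ Q ∩ R = F ∧
      IsFacetNormal Q F (n F) ∧ IsFacetNormal R F (-(n F)) := by
    intro F
    by_cases hF : F ∈ facetsAt T G
    · obtain ⟨Q, hQ, R, hR, h1, h2, h3⟩ := hT.exists_src_tgt hF.1 hF.2.1 (h.norm F hF)
        (h.orth F hF)
      exact ⟨Q, R, fun _ => ⟨hQ, hR, h1, h2, h3⟩⟩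
    · exact ⟨∅, ∅, fun h => absurd h hF⟩
  choose src tgt hst using hex
  have hsrc : ∀ F ∈ facetsAt T G, src F ∈ cellsAt T G := fun F hF =>
    ⟨(hst F hF).1, hF.2.2.trans (hst F hF).2.2.2.1.subset⟩
  have htgt : ∀ F ∈ facetsAt T G, tgt F ∈ cellsAt T G := fun F hF =>
    ⟨(hst F hF).2.1, hF.2.2.trans (hst F hF).2.2.2.2.subset⟩
  have hes : ∀ F ∈ facetsAt T G, IsExposed ℝ (src F) F := fun F hF => by
    have := hT.face _ (hst F hF).1 _ (hst F hF).2.1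
    rwa [(hst F hF).2.2.1] at this
  have het : ∀ F ∈ facetsAt T G, IsExposed ℝ (tgt F) F := fun F hF => by
    have := hT.face' (hst F hF).1 (hst F hF).2.1
    rwa [(hst F hF).2.2.1] at this
  refine ⟨src, tgt, ⟨hsrc, ?_, ?_⟩, ⟨htgt, ?_, ?_⟩, fun F hF => (hst F hF).2.2.1,
    fun F hF => (hst F hF).2.2.2.1, fun F hF => (hst F hF).2.2.2.2⟩
  · intro F₁ hF₁ F₂ hF₂ he
    refine h.facet_unique hG.codim (hT.ridge_exposed hG (hsrc F₁ hF₁).1 (hsrc F₁ hF₁).2) hF₁ hF₂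
      (hes F₁ hF₁) (he ▸ hes F₂ hF₂) (hst F₁ hF₁).2.2.2.1 (he ▸ (hst F₂ hF₂).2.2.2.1)
  · intro Q hQ
    obtain ⟨F, hF, -, hn⟩ := hT.exists_out_facet hG h hQ
    exact ⟨F, hF, hT.cell_unique (hsrc F hF).1 hQ.1 hF.1 (hst F hF).2.2.2.1 hn⟩
  · intro F₁ hF₁ F₂ hF₂ he
    refine h.neg.facet_unique hG.codim (hT.ridge_exposed hG (htgt F₁ hF₁).1 (htgt F₁ hF₁).2) hF₁
      hF₂ (het F₁ hF₁) (he ▸ het F₂ hF₂) (hst F₁ hF₁).2.2.2.2 (he ▸ (hst F₂ hF₂).2.2.2.2)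
  · intro Q hQ
    obtain ⟨F, hF, -, hn⟩ := hT.exists_out_facet hG h.neg hQ
    exact ⟨F, hF, hT.cell_unique (htgt F hF).1 hQ.1 hF.1 (hst F hF).2.2.2.2 hn⟩

theorem src_tgt_eq (hT : IsFaceTiling T) {G : Set E} {n : Set E → E} {src tgt : Set E → Set E}
    (h : IsMatching T G n src tgt) {Q R : Set E} (hQ : Q ∈ cellsAt T G) (hR : R ∈ cellsAt T G)
    (hc : HasCodim 1 (Q ∩ R)) :
    (src (Q ∩ R) = Q ∧ tgt (Q ∩ R) = R) ∨ (src (Q ∩ R) = R ∧ tgt (Q ∩ R) = Q) := by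
  have hF := hT.mem_facetsAt hQ hR hc
  obtain ⟨w, hw⟩ := exists_relInt ((hT.convex Q hQ.1).inter (hT.convex R hR.1)) hc.1
  have hs := hT.eq_or_eq_of_relInt hQ.1 hR.1 (h.bij_src.mapsTo hF).1 hc hw
    ((h.normal_src _ hF).subset hw.1)
  have ht := hT.eq_or_eq_of_relInt hQ.1 hR.1 (h.bij_tgt.mapsTo hF).1 hc hw
    ((h.normal_tgt _ hF).subset hw.1)
  have hne : src (Q ∩ R) ≠ tgt (Q ∩ R) := by
    refine hT.ne_of_hasCodim_one (h.bij_src.mapsTo hF).1 ?_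
    rw [h.inter _ hF]
    exact hc
  rcases hs with hs | hs <;> rcases ht with ht | ht
  · exact absurd (hs.trans ht.symm) hne
  · exact Or.inl ⟨hs, ht⟩
  · exact Or.inr ⟨hs, ht⟩
  · exact absurd (hs.trans ht.symm) hne

/-- Passing from a cell through its outgoing facet to the next cell permutes the cells around `G`.
Connectedness of the star makes this a single cycle, on which a function of total zero integrates.
-/
theorem exists_ridge_potential (hT : IsFaceTiling T) {G : Set E} (hG : IsRidge T G)
    {n : Set E → E} {src tgt : Set E → Set E} (h : IsMatching T G n src tgt)
    (c : Set E → Set E → Γ)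
    (hc : ∀ Q ∈ T, ∀ R ∈ T, HasCodim 1 (Q ∩ R) → c R Q = - c Q R)
    (hsum : ∑ᶠ F ∈ facetsAt T G, c (src F) (tgt F) = 0) :
    ∃ a : Set E → Γ, ∀ Q ∈ cellsAt T G, ∀ R ∈ cellsAt T G, HasCodim 1 (Q ∩ R) →
      a R - a Q = c Q R := by
  classical
  have hfin := hT.finite_cellsAt hG.codim.1
  have : Fintype (cellsAt T G) := hfin.fintype
  let e₁ : facetsAt T G ≃ cellsAt T G := h.bij_src.equiv src
  let e₂ : facetsAt T G ≃ cellsAt T G := h.bij_tgt.equiv tgt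
  have : Fintype (facetsAt T G) := Fintype.ofEquiv _ e₁.symm
  let σ : Equiv.Perm (cellsAt T G) := e₁.symm.trans e₂
  have hσ : ∀ F : facetsAt T G, σ (e₁ F) = e₂ F := fun F => by simp [σ]
  have hadj : ∀ Q R : cellsAt T G, HasCodim 1 (Q.1 ∩ R.1) → σ Q = R ∨ σ R = Q := by
    intro Q R hQR
    have hF := hT.mem_facetsAt Q.2 R.2 hQR
    rcases hT.src_tgt_eq h Q.2 R.2 hQR with ⟨h1, h2⟩ | ⟨h1, h2⟩
    · have e1 : e₁ ⟨_, hF⟩ = Q := Subtype.ext h1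
      have e2 : e₂ ⟨_, hF⟩ = R := Subtype.ext h2
      left
      rw [← e1, hσ, e2]
    · have e1 : e₁ ⟨_, hF⟩ = R := Subtype.ext h1
      have e2 : e₂ ⟨_, hF⟩ = Q := Subtype.ext h2
      right
      rw [← e1, hσ, e2]
  have hcod : ∀ Q : cellsAt T G, HasCodim 1 (Q.1 ∩ (σ Q).1) := by
    intro Q
    obtain ⟨F, rfl⟩ := e₁.surjective Q
    rw [hσ]
    have : (e₁ F).1 ∩ (e₂ F).1 = F.1 := h.inter F.1 F.2
    rw [this]
    exact F.2.1
  have hsame : ∀ Q R : cellsAt T G, σ.SameCycle Q R := by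
    intro Q R
    have key := hT.eq_of_forall_adjacent_around hG
      (fun S => ∃ hS : S ∈ cellsAt T G, σ.SameCycle Q ⟨S, hS⟩) (fun S hS S' hS' hSS' => by
        have h1 : σ.SameCycle ⟨S, hS⟩ ⟨S', hS'⟩ := by
          rcases hadj ⟨S, hS⟩ ⟨S', hS'⟩ hSS' with h2 | h2
          · rw [← h2]; exact Equiv.Perm.sameCycle_apply_right.2 (Equiv.Perm.SameCycle.refl _ _)
          · rw [← h2]; exact Equiv.Perm.sameCycle_apply_left.2 (Equiv.Perm.SameCycle.refl _ _)
        refine propext ⟨fun ⟨_, h3⟩ => ⟨hS', h3.trans h1⟩, fun ⟨_, h3⟩ => ⟨hS, h3.trans h1.symm⟩⟩)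
      Q.2 R.2
    obtain ⟨_, h3⟩ := key.mp ⟨Q.2, Equiv.Perm.SameCycle.refl _ _⟩
    exact h3
  have hs0 : ∑ Q : cellsAt T G, c Q.1 (σ Q).1 = 0 := by
    rw [← hsum, ← finsum_set_coe_eq_finsum_mem, finsum_eq_sum_of_fintype,
      ← Equiv.sum_comp e₁]
    exact Finset.sum_congr rfl fun F _ => by rw [hσ]; rfl
  obtain ⟨a, ha⟩ := exists_cycle_potential σ hsame (fun Q => c Q.1 (σ Q).1) hs0
  refine ⟨fun S => if hS : S ∈ cellsAt T G then a ⟨S, hS⟩ else 0, fun Q hQ R hR hQR => ?_⟩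
  simp only [dif_pos hQ, dif_pos hR]
  rcases hadj ⟨Q, hQ⟩ ⟨R, hR⟩ hQR with h1 | h1
  · have := ha ⟨Q, hQ⟩
    rw [h1] at this
    exact this
  · have := ha ⟨R, hR⟩
    rw [h1] at this
    have h2 := hc Q hQ.1 R hR.1 hQR
    dsimp only at this
    rw [← neg_sub, this, h2, neg_neg]

/-- Take for `ω` the area form of the orthogonal complement of the directions of `G`. For a facet
normal `ν`, `ω (y - x) ν` vanishes on `F` only when `y` lies in `G`. It keeps its sign on `F \ G`,
since a change would put a point of the extreme set `G` between two points outside it; `ν` or `-ν`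
is then chosen by this sign. -/
theorem exists_isCoherent (hT : IsFaceTiling T) {G : Set E} (hG : IsRidge T G) :
    ∃ ω : E →ₗ[ℝ] E →ₗ[ℝ] ℝ, ∃ n : Set E → E, ω ≠ 0 ∧ IsCoherent T G ω n := by
  set W := vectorSpan ℝ G with hW
  have hfr : finrank ℝ Wᗮ = 2 := by
    have h1 := Submodule.finrank_add_finrank_orthogonal W
    have h2 := hG.codim.2
    rw [← hW] at h2
    omega
  let b := (stdOrthonormalBasis ℝ Wᗮ).reindex (finCongr hfr)
  set e₁ : E := ((b 0 : Wᗮ) : E) with he₁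
  set e₂ : E := ((b 1 : Wᗮ) : E) with he₂
  have h11 : ⟪e₁, e₁⟫ = 1 := by
    have := b.orthonormal.1 0
    rw [real_inner_self_eq_norm_sq, he₁]
    rw [← Submodule.coe_norm, this]; norm_num
  have h22 : ⟪e₂, e₂⟫ = 1 := by
    have := b.orthonormal.1 1
    rw [real_inner_self_eq_norm_sq, he₂]
    rw [← Submodule.coe_norm, this]; norm_num
  have h12 : ⟪e₁, e₂⟫ = 0 := b.orthonormal.2 (by decide : (0 : Fin 2) ≠ 1)
  have h21 : ⟪e₂, e₁⟫ = 0 := by rw [real_inner_comm]; exact h12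
  have hexp : ∀ v ∈ Wᗮ, v = ⟪e₁, v⟫ • e₁ + ⟪e₂, v⟫ • e₂ := by
    intro v hv
    have := congrArg Subtype.val (b.sum_repr' ⟨v, hv⟩)
    rw [Fin.sum_univ_two] at this
    exact this.symm
  have hW1 : ∀ v ∈ W, ⟪e₁, v⟫ = 0 := fun v hv => Submodule.inner_left_of_mem_orthogonal hv (b 0).2
  have hW2 : ∀ v ∈ W, ⟪e₂, v⟫ = 0 := fun v hv => Submodule.inner_left_of_mem_orthogonal hv (b 1).2
  let ω : E →ₗ[ℝ] E →ₗ[ℝ] ℝ :=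
    (innerₛₗ ℝ e₁).smulRight (innerₛₗ ℝ e₂) - (innerₛₗ ℝ e₂).smulRight (innerₛₗ ℝ e₁)
  have hω : ∀ x y, ω x y = ⟪e₁, x⟫ * ⟪e₂, y⟫ - ⟪e₂, x⟫ * ⟪e₁, y⟫ := fun x y => by simp [ω]
  have hker : ∀ v ∈ W, ω v = 0 := by
    intro v hv
    ext y
    simp [hω, hW1 v hv, hW2 v hv]
  have hnz : ∀ F ∈ facetsAt T G, ∀ ν : E, ‖ν‖ = 1 → (∀ u ∈ vectorSpan ℝ F, ⟪ν, u⟫ = 0) →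
      ∀ x ∈ G, ∀ y ∈ F, ω (y - x) ν = 0 → y ∈ G := by
    rintro F ⟨hF, ⟨Q, hQ, hFQ⟩, hGF⟩ ν hν hνF x hx y hy h0
    have hνW : ν ∈ Wᗮ := by
      rw [Submodule.mem_orthogonal']
      exact fun u hu => hνF u (vectorSpan_mono ℝ hGF hu)
    have hou : ⟪ν, y - x⟫ = 0 := hνF _ (sub_mem_vectorSpan hy (hGF hx))
    have hGQ := hT.ridge_exposed hG hQ (hGF.trans hFQ.subset)
    refine mem_exposed_of_sub_mem hGQ (hFQ.subset hy) hx ?_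
    generalize y - x = u at *
    have hνe := hexp ν hνW
    have hν1 : ⟪e₁, ν⟫ ^ 2 + ⟪e₂, ν⟫ ^ 2 = 1 := by
      have h1 : ⟪ν, ν⟫ = 1 := by rw [real_inner_self_eq_norm_sq, hν]; norm_num
      nth_rewrite 2 [hνe] at h1
      rw [inner_add_right, inner_smul_right, inner_smul_right, real_inner_comm,
        real_inner_comm ν e₂] at h1
      rw [← h1]
      rw [real_inner_comm e₁ ν, real_inner_comm e₂ ν]; ring
    have hou' : ⟪e₁, ν⟫ * ⟪e₁, u⟫ + ⟪e₂, ν⟫ * ⟪e₂, u⟫ = 0 := by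
      rw [hνe, inner_add_left, inner_smul_left, inner_smul_left] at hou
      simpa using hou
    rw [hω] at h0
    have hu1 : ⟪e₁, u⟫ = 0 := by
      linear_combination (-⟪e₁, u⟫) * hν1 + ⟪e₁, ν⟫ * hou' + ⟪e₂, ν⟫ * h0
    have hu2 : ⟪e₂, u⟫ = 0 := by
      linear_combination (-⟪e₂, u⟫) * hν1 + ⟪e₂, ν⟫ * hou' - ⟪e₁, ν⟫ * h0
    have hWW : u ∈ Wᗮᗮ := by
      rw [Submodule.mem_orthogonal]
      intro v hv
      rw [hexp v hv, inner_add_left, inner_smul_left, inner_smul_left, hu1, hu2]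
      simp
    rwa [Submodule.orthogonal_orthogonal] at hWW
  have hex : ∀ F, ∃ n : E, F ∈ facetsAt T G → ‖n‖ = 1 ∧ (∀ u ∈ vectorSpan ℝ F, ⟪n, u⟫ = 0) ∧
      ∀ x ∈ G, ∀ y ∈ F \ G, 0 < ω (y - x) n := by
    intro F
    by_cases hF : F ∈ facetsAt T G
    swap
    · exact ⟨0, fun h => absurd h hF⟩
    obtain ⟨Q, hQ, hFQ⟩ := hF.2.1
    obtain ⟨g, hg⟩ := hG.codim.1
    have hGQ := hT.ridge_exposed hG hQ (hF.2.2.trans hFQ.subset)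
    obtain ⟨ν, hν⟩ := exists_isFacetNormal (hT.interior_nonempty Q hQ) hF.1 hFQ
    have hindep : ∀ x ∈ G, ∀ y, ω (y - x) = ω (y - g) := by
      intro x hx y
      have h1 : y - x = (y - g) + (g - x) := by abel
      rw [h1, map_add, hker _ (sub_mem_vectorSpan hg hx), add_zero]
    have hFc := hFQ.convex (hT.convex Q hQ)
    have hsign : ∀ ν : E, ‖ν‖ = 1 → (∀ u ∈ vectorSpan ℝ F, ⟪ν, u⟫ = 0) → ∀ y ∈ F \ G,
        0 < ω (y - g) ν → ∀ z ∈ F \ G, 0 < ω (z - g) ν := by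
      intro ν hν hνF y hy hpos z hz
      by_contra hcon
      have hlt : ω (z - g) ν < 0 := lt_of_le_of_ne (not_lt.1 hcon)
        fun h0 => hz.2 (hnz F hF ν hν hνF g hg z hz.1 h0)
      set p := ω (y - g) ν with hp
      set q := ω (z - g) ν with hq
      have hpq : 0 < p - q := by linarith
      have hm : (-q / (p - q)) • y + (p / (p - q)) • z ∈ F :=
        hFc hy.1 hz.1 (div_nonneg (by linarith) hpq.le) (by positivity) (by field_simp; ring)
      have hmG := hnz F hF ν hν hνF g hg _ hm (by
        have : (-q / (p - q)) • y + (p / (p - q)) • z - g =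
            (-q / (p - q)) • (y - g) + (p / (p - q)) • (z - g) := by
          match_scalars <;> field_simp <;> ring
        rw [this, map_add, map_smul, map_smul, LinearMap.add_apply, LinearMap.smul_apply,
          LinearMap.smul_apply, ← hp, ← hq, smul_eq_mul, smul_eq_mul]
        ring)
      refine hy.2 (hGQ.isExtreme.2 (hFQ.subset hy.1) (hFQ.subset hz.1) hmG ?_)
      exact ⟨_, _, div_pos (by linarith) hpq, by positivity, by field_simp; ring, rfl⟩
    by_cases hpos : ∃ y ∈ F \ G, 0 < ω (y - g) ν
    · obtain ⟨y, hy, hpos⟩ := hpos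
      refine ⟨ν, fun _ => ⟨hν.1, fun u => hν.inner_vectorSpan, fun x hx z hz => ?_⟩⟩
      rw [hindep x hx]
      exact hsign ν hν.1 (fun u => hν.inner_vectorSpan) y hy hpos z hz
    · push Not at hpos
      refine ⟨-ν, fun _ => ⟨by rw [norm_neg, hν.1], fun u hu => by
        rw [inner_neg_left, hν.inner_vectorSpan hu, neg_zero], fun x hx z hz => ?_⟩⟩
      rw [hindep x hx, map_neg, Left.neg_pos_iff]
      exact lt_of_le_of_ne (hpos z hz) fun h0 => hz.2 (hnz F hF ν hν.1
        (fun u => hν.inner_vectorSpan) g hg z hz.1 h0)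
  choose n hn using hex
  refine ⟨ω, n, fun h0 => ?_, ⟨fun x => ?_, hker, fun F hF => (hn F hF).1,
    fun F hF => (hn F hF).2.1, fun F hF => (hn F hF).2.2⟩⟩
  · have := hω e₁ e₂
    rw [h0, h11, h22, h12, h21] at this
    simp at this
  · rw [hω]; ring

/-- Jumps across facets that are locally integrable around each ridge are integrable. -/
theorem exists_potential_of_ridges (hT : IsFaceTiling T) (c : Set E → Set E → Γ)
    (hc : ∀ Q ∈ T, ∀ R ∈ T, HasCodim 1 (Q ∩ R) → c R Q = - c Q R)
    (hr : ∀ G, IsRidge T G → ∃ a : Set E → Γ, ∀ Q ∈ cellsAt T G, ∀ R ∈ cellsAt T G,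
      HasCodim 1 (Q ∩ R) → a R - a Q = c Q R) :
    ∃ a : Set E → Γ, ∀ Q ∈ T, ∀ R ∈ T, HasCodim 1 (Q ∩ R) → a R - a Q = c Q R := by
  classical
  have hex : ∀ G, ∃ a : Set E → Γ, IsRidge T G → ∀ Q ∈ cellsAt T G, ∀ R ∈ cellsAt T G,
      HasCodim 1 (Q ∩ R) → a R - a Q = c Q R := by
    intro G
    by_cases hG : IsRidge T G
    · obtain ⟨a, ha⟩ := hr G hG
      exact ⟨a, fun _ => ha⟩
    · exact ⟨0, fun h => absurd h hG⟩
  choose a ha using hex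
  -- Cells meeting in a ridge are compared by the potential at that ridge. In higher codimension the
  -- value is arbitrary and never enters the cocycle condition.
  let k : Set E → Set E → Γ := fun Q R =>
    if Q = R then 0 else if HasCodim 1 (Q ∩ R) then c Q R else a (Q ∩ R) R - a (Q ∩ R) Q
  have hk0 : ∀ Q, k Q Q = 0 := fun Q => by simp [k]
  have hk1 : ∀ Q ∈ T, ∀ R ∈ T, HasCodim 1 (Q ∩ R) → k Q R = c Q R := fun Q hQ R hR h => by
    simp [k, h, hT.ne_of_hasCodim_one hQ h]
  have hkG : ∀ G, IsRidge T G → ∀ Q ∈ cellsAt T G, ∀ R ∈ cellsAt T G,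
      k Q R = a G R - a G Q := by
    intro G hG Q hQ R hR
    by_cases hQR : Q = R
    · subst hQR
      rw [hk0, sub_self]
    by_cases h1 : HasCodim 1 (Q ∩ R)
    · rw [hk1 Q hQ.1 R hR.1 h1, ha G hG Q hQ R hR h1]
    · have hGe : G = Q ∩ R := by
        by_contra hne
        exact h1 (hT.hasCodim_one_of_not_subset hG hQ hR hQR hne)
      simp only [k, if_neg hQR, if_neg h1]
      rw [← hGe]
  obtain ⟨A, hA⟩ := hT.exists_potential k (fun Q hQ R hR S hS hne hd => by
    have hE : IsExposed ℝ Q (Q ∩ R ∩ S) := by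
      have : Q ∩ R ∩ S = (Q ∩ R) ∩ (Q ∩ S) := by
        ext x; simp only [mem_inter_iff]; tauto
      rw [this]
      exact (hT.face Q hQ R hR).inter (hT.face Q hQ S hS)
    by_cases h2 : finrank ℝ (vectorSpan ℝ (Q ∩ R ∩ S)) + 2 = finrank ℝ E
    · have hG : IsRidge T (Q ∩ R ∩ S) := ⟨⟨hne, h2⟩, Q, hQ, hE⟩
      have hQ' : Q ∈ cellsAt T (Q ∩ R ∩ S) := ⟨hQ, fun x hx => hx.1.1⟩
      have hR' : R ∈ cellsAt T (Q ∩ R ∩ S) := ⟨hR, fun x hx => hx.1.2⟩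
      have hS' : S ∈ cellsAt T (Q ∩ R ∩ S) := ⟨hS, fun x hx => hx.2⟩
      rw [hkG _ hG Q hQ' R hR', hkG _ hG R hR' S hS', hkG _ hG Q hQ' S hS']
      abel
    by_cases hQR : Q = R
    · subst hQR
      rw [hk0, zero_add]
    by_cases hRS : R = S
    · subst hRS
      rw [hk0, add_zero]
    have hle : ∀ A ∈ T, ∀ B ∈ T, A ≠ B → Q ∩ R ∩ S ⊆ A ∩ B → HasCodim 1 (A ∩ B) := by
      intro A hA B hB hAB hsub
      refine ⟨hne.mono hsub, ?_⟩
      have h3 := hT.finrank_inter_lt hA hB hAB (hne.mono hsub)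
      have h4 := Submodule.finrank_mono (vectorSpan_mono ℝ hsub)
      omega
    have hcQR := hle Q hQ R hR hQR inter_subset_left
    by_cases hQS : Q = S
    · subst hQS
      rw [hk0, hk1 Q hQ R hR hcQR, hk1 R hR Q hQ (inter_comm Q R ▸ hcQR), hc Q hQ R hR hcQR]
      abel
    -- Three distinct cells cannot share a facet: the neighbour of `Q` across it is unique.
    · exfalso
      have hcQS := hle Q hQ S hS hQS (fun x hx => ⟨hx.1.1, hx.2⟩)
      have hcK : HasCodim 1 (Q ∩ R ∩ S) := by
        refine ⟨hne, ?_⟩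
        have h4 := Submodule.finrank_mono (vectorSpan_mono ℝ
          (inter_subset_left : Q ∩ R ∩ S ⊆ Q ∩ R))
        have := hcQR.2
        omega
      have e1 := HasCodim.eq_of_exposed hE hcK hcQR inter_subset_left inter_subset_left
      have e2 := HasCodim.eq_of_exposed hE hcK hcQS (fun x hx => ⟨hx.1.1, hx.2⟩) inter_subset_left
      exact hRS (hT.neighbor_unique hQ hR hS hcQR (e1.symm.trans e2)))
  exact ⟨A, fun Q hQ R hR h => by rw [hA Q hQ R hR h, hk1 Q hQ R hR h]⟩

end IsFaceTiling

end Parallelohedron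

namespace Parallelohedron

open Set Module

set_option linter.unusedSectionVars false

variable {E : Type*} [NormedAddCommGroup E] [InnerProductSpace ℝ E] [FiniteDimensional ℝ E]

local notation "⟪" x "," y "⟫" => inner ℝ x y

/-! ### Tilings by translates -/

theorem hasCodim_vadd {k : ℕ} {F : Set E} (t : E) : HasCodim k (t +ᵥ F) ↔ HasCodim k F := by
  unfold HasCodim
  rw [vectorSpan_vadd, vadd_set_nonempty]

theorem isFacetNormal_vadd {Q F : Set E} {n : E} (t : E) :
    IsFacetNormal (t +ᵥ Q) (t +ᵥ F) n ↔ IsFacetNormal Q F n := by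
  have key : ∀ (Q F : Set E) (t : E), IsFacetNormal Q F n → IsFacetNormal (t +ᵥ Q) (t +ᵥ F) n := by
    rintro Q F t ⟨hn, m, hm, rfl⟩
    refine ⟨hn, ⟪n, t⟫ + m, ?_, ?_⟩
    · rintro _ ⟨x, hx, rfl⟩
      simp only [vadd_eq_add, inner_add_right]
      linarith [hm x hx]
    · ext x
      constructor
      · rintro ⟨y, hy, rfl⟩
        refine ⟨vadd_mem_vadd_set hy.1, ?_⟩
        simp only [vadd_eq_add, inner_add_right, hy.2]
      · rintro ⟨⟨y, hy, rfl⟩, h⟩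
        refine vadd_mem_vadd_set ⟨hy, ?_⟩
        simp only [vadd_eq_add, inner_add_right] at h
        linarith
  refine ⟨fun h => ?_, key Q F t⟩
  have := key _ _ (-t) h
  rwa [neg_vadd_vadd, neg_vadd_vadd] at this

theorem IsFacetNormal.isExposed {Q F : Set E} {n : E} (h : IsFacetNormal Q F n) :
    IsExposed ℝ Q F := by
  rintro ⟨y, hy⟩
  refine ⟨innerSL ℝ n, ?_⟩
  ext x
  simp only [innerSL_apply_apply]
  exact ⟨fun hx => ⟨h.subset hx, fun z hz => h.le hz hx⟩,
    fun hx => h.mem hx.1 hy (hx.2 y (h.subset hy))⟩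

theorem IsFacetNormal.face_unique {Q F F' : Set E} {n : E} (h : IsFacetNormal Q F n)
    (h' : IsFacetNormal Q F' n) (hF : F.Nonempty) (hF' : F'.Nonempty) : F = F' := by
  obtain ⟨y, hy⟩ := hF
  obtain ⟨y', hy'⟩ := hF'
  ext x
  exact ⟨fun hx => h'.mem (h.subset hx) hy' (h.le (h'.subset hy') hx),
    fun hx => h.mem (h'.subset hx) hy (h'.le (h.subset hy) hx)⟩

theorem vadd_inter_vadd (P : Set E) (t t' : E) :
    (t +ᵥ P) ∩ (t' +ᵥ P) = t +ᵥ (P ∩ ((t' - t) +ᵥ P)) := by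
  rw [vadd_set_inter, vadd_vadd, add_sub_cancel]

/-- `P` and `v +ᵥ P` share a facet, with normal `n` directed from `P` to `v +ᵥ P`. -/
structure IsFacetVec (P : Set E) (v n : E) : Prop where
  codim : HasCodim 1 (P ∩ (v +ᵥ P))
  normal : IsFacetNormal P (P ∩ (v +ᵥ P)) n
  normal' : IsFacetNormal (v +ᵥ P) (P ∩ (v +ᵥ P)) (-n)

theorem eq_of_vadd_eq {P : Set E} (hb : Bornology.IsBounded P) (hne : P.Nonempty) {t t' : E}
    (h : t +ᵥ P = t' +ᵥ P) : t = t' := by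
  have : t - t' = 0 := eq_zero_of_add_subset hb hne fun x hx => by
    have h1 : t +ᵥ x ∈ t' +ᵥ P := h ▸ vadd_mem_vadd_set hx
    obtain ⟨y, hy, hxy⟩ := h1
    simp only [vadd_eq_add] at hxy
    have : x + (t - t') = y := by
      rw [add_sub, add_comm x t, ← hxy]; abel
    rwa [this]
  exact sub_eq_zero.1 this

theorem IsFacetVec.of_vadd {P : Set E} {t t' n : E} (hc : HasCodim 1 ((t +ᵥ P) ∩ (t' +ᵥ P)))
    (h : IsFacetNormal (t +ᵥ P) ((t +ᵥ P) ∩ (t' +ᵥ P)) n)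
    (h' : IsFacetNormal (t' +ᵥ P) ((t +ᵥ P) ∩ (t' +ᵥ P)) (-n)) : IsFacetVec P (t' - t) n := by
  rw [vadd_inter_vadd] at hc h h'
  refine ⟨(hasCodim_vadd t).1 hc, (isFacetNormal_vadd t).1 h, ?_⟩
  rw [← isFacetNormal_vadd t, vadd_vadd, add_sub_cancel]
  exact h'

theorem IsFacetVec.of_eq_vadd {P Q R : Set E} {t t' n : E} (hQ : Q = t +ᵥ P) (hR : R = t' +ᵥ P)
    (hc : HasCodim 1 (Q ∩ R)) (h : IsFacetNormal Q (Q ∩ R) n)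
    (h' : IsFacetNormal R (Q ∩ R) (-n)) : IsFacetVec P (t' - t) n := by
  subst hQ hR
  exact IsFacetVec.of_vadd hc h h'

theorem IsFacetVec.vadd {P : Set E} {v n : E} (h : IsFacetVec P v n) (t : E) :
    HasCodim 1 ((t +ᵥ P) ∩ ((t + v) +ᵥ P)) ∧
      IsFacetNormal (t +ᵥ P) ((t +ᵥ P) ∩ ((t + v) +ᵥ P)) n ∧
      IsFacetNormal ((t + v) +ᵥ P) ((t +ᵥ P) ∩ ((t + v) +ᵥ P)) (-n) := by
  rw [vadd_inter_vadd, add_sub_cancel_left, ← vadd_vadd]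
  exact ⟨(hasCodim_vadd t).2 h.codim, (isFacetNormal_vadd t).2 h.normal,
    (isFacetNormal_vadd t).2 h.normal'⟩

theorem IsFacetVec.neg {P : Set E} {v n : E} (h : IsFacetVec P v n) : IsFacetVec P (-v) (-n) := by
  obtain ⟨h1, h2, h3⟩ := h.vadd 0
  rw [inter_comm] at h1 h2 h3
  have := IsFacetVec.of_vadd h1 h3 (by rwa [neg_neg])
  rwa [zero_add, zero_sub] at this

/-- The normal `n` determines the upper facet of `P`, and `-n` the lower one; `v` is the translation
between them. -/
theorem IsFacetVec.unique {P : Set E} (hb : Bornology.IsBounded P) {v v' n : E}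
    (h : IsFacetVec P v n) (h' : IsFacetVec P v' n) : v = v' := by
  have he := h.normal.face_unique h'.normal h.codim.1 h'.codim.1
  have h1 : IsFacetNormal P (-v +ᵥ (P ∩ (v +ᵥ P))) (-n) := by
    rw [← isFacetNormal_vadd v, vadd_neg_vadd]
    exact h.normal'
  have h2 : IsFacetNormal P (-v' +ᵥ (P ∩ (v +ᵥ P))) (-n) := by
    rw [← isFacetNormal_vadd v', vadd_neg_vadd, he]
    exact h'.normal'
  have h3 := h1.face_unique h2 (h.codim.1.vadd_set) (h.codim.1.vadd_set)
  exact neg_injective (eq_of_vadd_eq (hb.subset inter_subset_left) h.codim.1 h3)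

theorem IsFacetVec.normal_unique {P : Set E} (hi : (interior P).Nonempty) {v n n' : E}
    (h : IsFacetVec P v n) (h' : IsFacetVec P v n') : n' = n :=
  h.normal.unique hi h.codim h'.normal

theorem IsFacetVec.inner_pos {P : Set E} (hi : (interior P).Nonempty) {v n : E}
    (h : IsFacetVec P v n) : 0 < ⟪n, v⟫ := by
  obtain ⟨x, hx⟩ := hi
  obtain ⟨y, hy⟩ := h.codim.1
  have h1 := h.normal.lt_of_interior hx hy
  have h2 := h.normal'.le (x := v +ᵥ x) (vadd_mem_vadd_set (interior_subset hx)) hy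
  simp only [inner_neg_left, vadd_eq_add, inner_add_right] at h2
  linarith

/-- A face-to-face tiling by translates of `P`. -/
structure IsTranslateTiling (P : Set E) (T : Set (Set E)) : Prop extends IsFaceTiling T where
  convex_body : Convex ℝ P
  compact_body : IsCompact P
  interior_body : (interior P).Nonempty
  translate : ∀ Q ∈ T, ∃ t : E, Q = t +ᵥ P

variable {P : Set E} {T : Set (Set E)}

/-! ### Local finiteness of tilings by translates -/

theorem finite_of_separated {X : Set E} (hb : Bornology.IsBounded X) {ρ : ℝ} (hρ : 0 < ρ)
    (h : ∀ x ∈ X, ∀ y ∈ X, dist x y < ρ → x = y) : X.Finite := by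
  obtain ⟨D, hD⟩ := (Metric.isBounded_iff_subset_closedBall (0 : E)).1 hb
  obtain ⟨t, -, hfin, ht⟩ := (isCompact_closedBall (0 : E) D).finite_cover_balls (half_pos hρ)
  have hex : ∀ x ∈ X, ∃ c ∈ t, dist x c < ρ / 2 := by
    intro x hx
    have := ht (hD hx)
    simpa using this
  choose! c hc hcd using hex
  refine Set.Finite.of_injOn hc (fun x hx y hy hxy => h x hx y hy ?_) hfin
  have h1 := hcd x hx
  have h2 := hcd y hy
  rw [← hxy] at h2
  have := dist_triangle_right x y (c x)
  linarith

theorem isTranslateTiling_of (hconv : Convex ℝ P) (hcomp : IsCompact P)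
    (hint : (interior P).Nonempty) (htr : ∀ Q ∈ T, ∃ t : E, Q = t +ᵥ P)
    (hcov : ⋃₀ T = univ)
    (hdis : ∀ Q ∈ T, ∀ R ∈ T, Q ≠ R → Disjoint (interior Q) (interior R))
    (hface : ∀ Q ∈ T, ∀ R ∈ T, IsExposed ℝ Q (Q ∩ R)) : IsTranslateTiling P T where
  convex_body := hconv
  compact_body := hcomp
  interior_body := hint
  translate := htr
  convex Q hQ := by obtain ⟨t, rfl⟩ := htr Q hQ; exact hconv.vadd t
  compact Q hQ := by obtain ⟨t, rfl⟩ := htr Q hQ; exact hcomp.vadd t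
  interior_nonempty Q hQ := by
    obtain ⟨t, rfl⟩ := htr Q hQ
    rw [interior_vadd]
    exact hint.vadd_set
  cover x := by
    have : x ∈ ⋃₀ T := hcov ▸ mem_univ x
    exact this
  disjoint := hdis
  face := hface
  locallyFinite w := by
    refine ⟨1, one_pos, ?_⟩
    set X : Set E := {t | t +ᵥ P ∈ T ∧ ((t +ᵥ P) ∩ Metric.ball w 1).Nonempty} with hX
    have hfin : X.Finite := by
      obtain ⟨p, hp⟩ := hint
      obtain ⟨ρ, hρ, hball⟩ := Metric.isOpen_iff.1 isOpen_interior p hp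
      -- Interiors contain translates of one ball of radius `ρ`, so translation vectors closer than
      -- `ρ` would make interiors overlap.
      refine finite_of_separated ?_ hρ fun t ht t' ht' hd => ?_
      · obtain ⟨D, hD⟩ := hcomp.isBounded.exists_norm_le
        refine isBounded_iff_forall_norm_le.2 ⟨‖w‖ + 1 + D, ?_⟩
        rintro t ⟨-, -, ⟨x, hx, rfl⟩, hxw⟩
        have h1 := hD x hx
        rw [Metric.mem_ball, dist_eq_norm] at hxw
        simp only [vadd_eq_add] at hxw
        have h2 : t = (t + x - w) + w - x := by abel
        have h3 := norm_sub_le ((t + x - w) + w) x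
        have h4 := norm_add_le (t + x - w) w
        rw [← h2] at h3
        linarith
      · by_contra hne
        have hQ : t +ᵥ P ≠ t' +ᵥ P := fun h =>
          hne (eq_of_vadd_eq hcomp.isBounded ⟨p, interior_subset hp⟩ h)
        refine Set.disjoint_left.1 (hdis _ ht.1 _ ht'.1 hQ) (?_ : t + p ∈ _) ?_
        · rw [interior_vadd]
          exact vadd_mem_vadd_set hp
        · rw [interior_vadd]
          have hmem : p + (t - t') ∈ interior P := hball (by
            rw [Metric.mem_ball, dist_eq_norm, add_sub_cancel_left, ← dist_eq_norm]
            exact hd)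
          refine ⟨p + (t - t'), hmem, ?_⟩
          simp only [vadd_eq_add]
          abel
    refine (hfin.image (fun t => t +ᵥ P)).subset ?_
    rintro Q ⟨hQ, hne⟩
    obtain ⟨t, rfl⟩ := htr Q hQ
    exact ⟨t, ⟨hQ, hne⟩, rfl⟩

/-- Sources and targets both enumerate the cells around `G` exactly once, so the differences
telescope. -/
theorem IsMatching.finsum_sub_eq_zero {Γ : Type*} [AddCommGroup Γ] (hT : IsFaceTiling T)
    {G : Set E} (hG : G.Nonempty) {n : Set E → E} {src tgt : Set E → Set E}
    (h : IsMatching T G n src tgt) (u : Set E → Γ) :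
    ∑ᶠ F ∈ facetsAt T G, (u (tgt F) - u (src F)) = 0 := by
  have hfin : (facetsAt T G).Finite :=
    Set.Finite.of_injOn h.bij_src.mapsTo h.bij_src.injOn (hT.finite_cellsAt hG)
  rw [finsum_mem_sub_distrib _ _ hfin, finsum_mem_eq_of_bijOn tgt h.bij_tgt (fun _ _ => rfl),
    finsum_mem_eq_of_bijOn (g := u) src h.bij_src (fun _ _ => rfl), sub_self]

/-- The vectors joining `P` to its neighbours across facets. -/
def facetVecs (P : Set E) : Set E := {v | ∃ n, IsFacetVec P v n}

namespace IsTranslateTiling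

theorem isFacetVec_of_adjacent (hT : IsTranslateTiling P T) {t t' : E} (ht : t +ᵥ P ∈ T)
    (ht' : t' +ᵥ P ∈ T) (hc : HasCodim 1 ((t +ᵥ P) ∩ (t' +ᵥ P))) :
    ∃ n, IsFacetVec P (t' - t) n := by
  obtain ⟨n, hn, hn'⟩ := hT.exists_normal ht ht' hc
  exact ⟨n, IsFacetVec.of_vadd hc hn hn'⟩

/-- The neighbour across the facet is some translate of `P`; by uniqueness of the facet vector with
a given normal it is the expected one. -/
theorem add_mem (hT : IsTranslateTiling P T) {t v n : E} (ht : t +ᵥ P ∈ T)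
    (hv : IsFacetVec P v n) : (t + v) +ᵥ P ∈ T := by
  obtain ⟨h1, h2, h3⟩ := hv.vadd t
  obtain ⟨R, hR, -, he⟩ := hT.exists_neighbor ht h1 h2.isExposed
  obtain ⟨t', rfl⟩ := hT.translate R hR
  rw [← he] at h1 h2
  obtain ⟨m, hm, hm'⟩ := hT.exists_normal ht hR h1
  have hmn : m = n := h2.unique (hT.interior_nonempty _ ht) h1 hm
  subst hmn
  have := hv.unique hT.compact_body.isBounded (IsFacetVec.of_vadd h1 hm hm')
  rwa [this, add_sub_cancel]

theorem mem_iff_add_mem (hT : IsTranslateTiling P T) {v : E}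
    (hv : v ∈ AddSubgroup.closure (facetVecs P)) (t : E) : t +ᵥ P ∈ T ↔ (t + v) +ᵥ P ∈ T := by
  induction hv using AddSubgroup.closure_induction generalizing t with
  | mem v hv =>
    obtain ⟨n, hn⟩ := hv
    refine ⟨fun h => hT.add_mem h hn, fun h => ?_⟩
    have := hT.add_mem h hn.neg
    rwa [add_neg_cancel_right] at this
  | zero => rw [add_zero]
  | add v w _ _ hv hw => rw [hv t, hw (t + v), add_assoc]
  | neg v _ hv => rw [hv (t + -v), neg_add_cancel_right]

theorem exists_translation (hT : IsTranslateTiling P T) :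
    ∃ tr : Set E → E, (∀ Q ∈ T, Q = tr Q +ᵥ P) ∧ ∀ t, t +ᵥ P ∈ T → tr (t +ᵥ P) = t := by
  have hne : P.Nonempty := hT.interior_body.mono interior_subset
  have hex : ∀ Q, ∃ t : E, Q ∈ T → Q = t +ᵥ P := by
    intro Q
    by_cases hQ : Q ∈ T
    · obtain ⟨t, h⟩ := hT.translate Q hQ
      exact ⟨t, fun _ => h⟩
    · exact ⟨0, fun h => absurd h hQ⟩
  choose tr htr using hex
  exact ⟨tr, htr, fun t ht =>
    (eq_of_vadd_eq hT.compact_body.isBounded hne (htr _ ht)).symm⟩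

/-- The class of the translation vector modulo the subgroup is constant across facets, and the
tiling is facet-connected. -/
theorem sub_mem_closure (hT : IsTranslateTiling P T) {t t' : E} (ht : t +ᵥ P ∈ T)
    (ht' : t' +ᵥ P ∈ T) : t' - t ∈ AddSubgroup.closure (facetVecs P) := by
  obtain ⟨tr, htr, htr'⟩ := hT.exists_translation
  have := hT.eq_of_forall_adjacent
    (fun Q => (QuotientAddGroup.mk (tr Q) : E ⧸ AddSubgroup.closure (facetVecs P)))
    (fun Q hQ R hR hc => by
      rw [QuotientAddGroup.eq, neg_add_eq_sub]
      refine AddSubgroup.subset_closure ?_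
      have hQ' := htr Q hQ
      have hR' := htr R hR
      rw [hQ'] at hQ hc
      rw [hR'] at hR hc
      exact hT.isFacetVec_of_adjacent hQ hR hc) ht ht'
  rwa [htr' t ht, htr' t' ht', QuotientAddGroup.eq, neg_add_eq_sub] at this

theorem mem_iff_mem_closure (hT : IsTranslateTiling P T) (h0 : P ∈ T) (t : E) :
    t +ᵥ P ∈ T ↔ t ∈ AddSubgroup.closure (facetVecs P) := by
  have h0' : (0 : E) +ᵥ P ∈ T := by rwa [zero_vadd]
  constructor
  · intro h
    simpa using hT.sub_mem_closure h0' h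
  · intro h
    have := (hT.mem_iff_add_mem h 0).1 h0'
    rwa [zero_add] at this

theorem finite_facetVecs (hT : IsTranslateTiling P T) (h0 : P ∈ T) : (facetVecs P).Finite := by
  have hne : P.Nonempty := hT.interior_body.mono interior_subset
  refine Set.Finite.of_injOn (f := fun v => v +ᵥ P) (t := {R ∈ T | (P ∩ R).Nonempty}) ?_ ?_
    (hT.finite_inter hT.compact_body)
  · rintro v hv
    exact ⟨(hT.mem_iff_mem_closure h0 v).2 (AddSubgroup.subset_closure hv), hv.choose_spec.codim.1⟩
  · exact fun v _ w _ h => eq_of_vadd_eq hT.compact_body.isBounded hne h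

/-- A point outside `P` is separated from `P` by a facet. -/
theorem exists_facetVec_separating (hT : IsTranslateTiling P T) (h0 : P ∈ T) {y : E}
    (hy : y ∉ P) : ∃ v n, IsFacetVec P v n ∧ ∀ z ∈ P ∩ (v +ᵥ P), ⟪n, z⟫ < ⟪n, y⟫ := by
  obtain ⟨R, hR, hc, hsep⟩ := hT.exists_facet_separating h0 hy
  obtain ⟨n, hn, hn'⟩ := hT.exists_normal h0 hR hc
  obtain ⟨v, rfl⟩ := hT.translate R hR
  exact ⟨v, n, ⟨hc, hn, hn'⟩, hsep n hn⟩

theorem mem_interior_unique (hT : IsTranslateTiling P T) (h0 : P ∈ T) {v x : E}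
    (hv : v ∈ AddSubgroup.closure (facetVecs P)) (hx : x ∈ interior P) (hxv : x - v ∈ P) :
    v = 0 := by
  have hne : P.Nonempty := hT.interior_body.mono interior_subset
  have h1 : x ∈ v +ᵥ P := ⟨x - v, hxv, by simp⟩
  have h2 := hT.eq_of_mem_interior h0 ((hT.mem_iff_mem_closure h0 v).2 hv) hx h1
  refine eq_of_vadd_eq hT.compact_body.isBounded hne ?_
  rw [h2, zero_vadd]

theorem exists_sub_mem (hT : IsTranslateTiling P T) (h0 : P ∈ T) (x : E) :
    ∃ v ∈ AddSubgroup.closure (facetVecs P), x - v ∈ P := by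
  obtain ⟨Q, hQ, hx⟩ := hT.cover x
  obtain ⟨v, rfl⟩ := hT.translate Q hQ
  obtain ⟨y, hy, rfl⟩ := hx
  exact ⟨v, (hT.mem_iff_mem_closure h0 v).1 hQ, by simpa using hy⟩

end IsTranslateTiling

end Parallelohedron

namespace Parallelohedron

open Set Module

set_option linter.unusedSectionVars false

variable {E : Type*} [NormedAddCommGroup E] [InnerProductSpace ℝ E] [FiniteDimensional ℝ E]

local notation "⟪" x "," y "⟫" => inner ℝ x y

/-! ### Affine images of Voronoi parallelohedra have a canonical scaling -/

theorem norm_sub_le_norm_sub_iff (x p m : E) :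
    ‖x - p‖ ≤ ‖x - (p + m)‖ ↔ 2 * ⟪x - p, m⟫ ≤ ‖m‖ ^ 2 := by
  rw [← sq_le_sq₀ (norm_nonneg _) (norm_nonneg _), ← sub_sub x p m, norm_sub_sq_real (x - p) m]
  constructor <;> intro h <;> linarith

theorem finite_lattice_inter_closedBall (Λ : Submodule ℤ E) [DiscreteTopology Λ] (x : E) (r : ℝ) :
    (Metric.closedBall x r ∩ (Λ : Set E)).Finite := by
  have : DiscreteTopology Λ.toAddSubgroup := ‹DiscreteTopology Λ›
  have h1 : IsClosed (Λ.toAddSubgroup : Set E) := AddSubgroup.isClosed_of_discrete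
  exact Metric.finite_isBounded_inter_isClosed ⟨this⟩ Metric.isBounded_closedBall h1

/-- At a boundary point of a Dirichlet domain another lattice point is equally close. -/
theorem exists_tie (Λ : Submodule ℤ E) [DiscreteTopology Λ] {p x : E}
    (hx : x ∉ interior {x | ∀ q ∈ (Λ : Set E), ‖x - p‖ ≤ ‖x - q‖}) :
    ∃ q ∈ Λ, q ≠ p ∧ ‖x - q‖ ≤ ‖x - p‖ := by
  by_contra! hcon
  refine hx (mem_interior_iff_mem_nhds.2 ?_)
  have hfin := finite_lattice_inter_closedBall Λ x (‖x - p‖ + 2)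
  have hev : ∀ᶠ z in nhds x, ∀ q ∈ Metric.closedBall x (‖x - p‖ + 2) ∩ (Λ : Set E),
      q ≠ p → ‖z - p‖ < ‖z - q‖ := by
    rw [Filter.eventually_all_finite hfin]
    intro q hq
    by_cases hqp : q = p
    · exact Filter.Eventually.of_forall fun z h => absurd hqp h
    · have hc1 : Continuous fun z : E => ‖z - p‖ := by fun_prop
      have hc2 : Continuous fun z : E => ‖z - q‖ := by fun_prop
      filter_upwards [hc1.continuousAt.eventually_lt hc2.continuousAt (hcon q hq.2 hqp)]
        with z hz _ using hz
  filter_upwards [hev, Metric.ball_mem_nhds x one_pos] with z hz hzx q hq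
  by_cases hqp : q = p
  · rw [hqp]
  by_cases hqb : q ∈ Metric.closedBall x (‖x - p‖ + 2)
  · exact (hz q ⟨hqb, hq⟩ hqp).le
  · rw [Metric.mem_closedBall, not_le, dist_eq_norm] at hqb
    rw [Metric.mem_ball, dist_eq_norm] at hzx
    have h1 : ‖z - p‖ ≤ ‖z - x‖ + ‖x - p‖ := norm_sub_le_norm_sub_add_norm_sub z x p
    have h2 : ‖q - x‖ ≤ ‖q - z‖ + ‖z - x‖ := norm_sub_le_norm_sub_add_norm_sub q z x
    rw [norm_sub_rev q z] at h2
    linarith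

/-- For an affine preimage `P` of a Dirichlet domain, the facet normals of `P` are the images of
the facet vectors under the symmetric operator given by the Euclidean structure. -/
theorem exists_pos_smul_normal {P : Set E} (hb : Bornology.IsBounded P)
    (hi : (interior P).Nonempty) (hconv : Convex ℝ P) (Λ : Submodule ℤ E) [DiscreteTopology Λ]
    (L : E ≃ₗ[ℝ] E) (f : E → E) (hfc : Continuous f) (hf : ∀ x y, f x - f y = L (x - y)) {p : E}
    (hp : p ∈ Λ) (hP : P = f ⁻¹' {x | ∀ q ∈ (Λ : Set E), ‖x - p‖ ≤ ‖x - q‖}) {v n : E}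
    (h : IsFacetVec P v n) :
    ∃ κ > (0 : ℝ), (LinearMap.adjoint L.toLinearMap) (L v) = κ • n := by
  set F := P ∩ (v +ᵥ P) with hF
  obtain ⟨x₀, hx₀⟩ := exists_relInt (h.normal.convex hconv) h.codim.1
  have hmemP : ∀ x, x ∈ P ↔ ∀ q ∈ Λ, ‖f x - p‖ ≤ ‖f x - q‖ := fun x => by rw [hP]; rfl
  have hx₀i : f x₀ ∉ interior {x | ∀ q ∈ (Λ : Set E), ‖x - p‖ ≤ ‖x - q‖} := by
    intro hcon
    have : x₀ ∈ interior P := by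
      refine mem_interior.2 ⟨_, ?_, isOpen_interior.preimage hfc, hcon⟩
      rw [hP]
      exact preimage_mono interior_subset
    exact lt_irrefl _ (h.normal.lt_of_interior this hx₀.1)
  -- The competitor `q = p + m` at a relatively interior point of the facet identifies the facet
  -- hyperplane; it remains to see that `m` comes from `v`.
  obtain ⟨q, hq, hqp, hle⟩ := exists_tie Λ hx₀i
  obtain ⟨m, rfl⟩ : ∃ m, q = p + m := ⟨q - p, by abel⟩
  have hm : m ∈ Λ := by
    have := Λ.sub_mem hq hp
    rwa [add_sub_cancel_left] at this
  have hm0 : m ≠ 0 := fun h0 => hqp (by rw [h0, add_zero])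
  obtain ⟨v', hv'⟩ := L.surjective m
  set a := (LinearMap.adjoint L.toLinearMap) m with ha
  have hal : ∀ y, ⟪a, y⟫ = ⟪L y, m⟫ := fun y => by
    rw [ha, LinearMap.adjoint_inner_left, real_inner_comm]
    rfl
  have hup : ∀ y ∈ P, 2 * ⟪f y - p, m⟫ ≤ ‖m‖ ^ 2 := fun y hy =>
    (norm_sub_le_norm_sub_iff _ _ _).1 ((hmemP y).1 hy _ hq)
  have hlow : ∀ y ∈ P, -‖m‖ ^ 2 ≤ 2 * ⟪f y - p, m⟫ := fun y hy => by
    have := (norm_sub_le_norm_sub_iff (f y) p (-m)).1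
      ((hmemP y).1 hy _ (Λ.add_mem hp (Λ.neg_mem hm)))
    rw [inner_neg_right, norm_neg] at this
    linarith
  have htie₀ : 2 * ⟪f x₀ - p, m⟫ = ‖m‖ ^ 2 := by
    refine le_antisymm (hup x₀ (h.normal.subset hx₀.1)) ?_
    rw [← sq_le_sq₀ (norm_nonneg _) (norm_nonneg _), ← sub_sub (f x₀) p m,
      norm_sub_sq_real (f x₀ - p) m] at hle
    linarith
  have hdiff : ∀ x y, ⟪f x - p, m⟫ - ⟪f y - p, m⟫ = ⟪a, x⟫ - ⟪a, y⟫ := fun x y => by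
    rw [← inner_sub_left, sub_sub_sub_cancel_right, hf, ← hal, inner_sub_right]
  have hmax : ∀ y ∈ P, ⟪a, y⟫ ≤ ⟪a, x₀⟫ := fun y hy => by
    have := hdiff y x₀
    have := hup y hy
    linarith
  have hconst : ∀ y ∈ F, ⟪a, y⟫ = ⟪a, x₀⟫ :=
    hx₀.eq_of_le (innerₛₗ ℝ a) fun y hy => hmax y hy.1
  have han : a = ⟪n, a⟫ • n := exists_smul_of_orthogonal h.codim h.normal.1
    (fun u => h.normal.inner_vectorSpan) (fun u hu => inner_eq_zero_of_const hconst hu)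
  set κ := ⟪n, a⟫ with hκ
  have hκ0 : κ ≠ 0 := by
    intro h0
    rw [h0, zero_smul] at han
    have := hal v'
    rw [han, hv', inner_zero_left] at this
    exact hm0 (inner_self_eq_zero.1 this.symm)
  have hκpos : 0 < κ := by
    obtain ⟨x, hx⟩ := hi
    have h1 := hmax x (interior_subset hx)
    rw [han, inner_smul_left, inner_smul_left] at h1
    simp only [conj_trivial] at h1
    have h2 := h.normal.lt_of_interior hx hx₀.1
    refine lt_of_le_of_ne ?_ (Ne.symm hκ0)
    by_contra hneg
    nlinarith
  -- Subtracting `v'` moves the facet to the opposite side of `P`, where `n` is minimal. Lattice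
  -- invariance of the distance inequalities keeps it in `P`.
  have hsub : ∀ x ∈ F, x - v' ∈ P ∧ ∀ y ∈ P, ⟪n, x - v'⟫ ≤ ⟪n, y⟫ := by
    intro x hx
    have htie : 2 * ⟪f x - p, m⟫ = ‖m‖ ^ 2 := by
      have := hdiff x x₀
      rw [hconst x hx] at this
      linarith
    have hfx : f (x - v') = f x - m := by
      have := hf (x - v') x
      rw [sub_sub_cancel_left, map_neg, hv'] at this
      rw [sub_eq_iff_eq_add.1 this]
      abel
    constructor
    · rw [hmemP]
      intro q hq
      have h1 := (hmemP x).1 hx.1 _ (Λ.add_mem hq hm)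
      have h2 : ‖f x - (p + m)‖ ≤ ‖f x - p‖ := by
        rw [← sq_le_sq₀ (norm_nonneg _) (norm_nonneg _), ← sub_sub (f x) p m,
          norm_sub_sq_real (f x - p) m]
        linarith
      rw [hfx]
      calc ‖f x - m - p‖ = ‖f x - (p + m)‖ := by congr 1; abel
        _ ≤ ‖f x - p‖ := h2
        _ ≤ ‖f x - (q + m)‖ := h1
        _ = ‖f x - m - q‖ := by congr 1; abel
    · intro y hy
      have h1 := hdiff y (x - v')
      have h2 : ⟪f (x - v') - p, m⟫ = ⟪f x - p, m⟫ - ‖m‖ ^ 2 := by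
        rw [hfx, ← real_inner_self_eq_norm_sq m, ← inner_sub_left]
        congr 1; abel
      have h3 := hlow y hy
      have h4 : ⟪a, x - v'⟫ ≤ ⟪a, y⟫ := by linarith
      rw [han, inner_smul_left, inner_smul_left] at h4
      simp only [conj_trivial] at h4
      exact le_of_mul_le_mul_left h4 hκpos
  have hFv : IsFacetNormal P (-v +ᵥ F) (-n) := by
    rw [← isFacetNormal_vadd v, vadd_neg_vadd]
    exact h.normal'
  -- Both `-v` and `-v'` carry `F` into the face of `P` with normal `-n`, so `v - v'` translates the
  -- bounded set `F` into itself.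
  have hvv : v - v' = 0 := by
    refine eq_zero_of_add_subset (hb.subset (inter_subset_left : F ⊆ P)) h.codim.1 fun x hx => ?_
    obtain ⟨h1, h2⟩ := hsub x hx
    have h3 : -v +ᵥ x ∈ -v +ᵥ F := vadd_mem_vadd_set hx
    have h4 := hFv.mem h1 h3 (by
      rw [inner_neg_left, inner_neg_left, neg_le_neg_iff]
      exact h2 _ (hFv.subset h3))
    obtain ⟨y, hy, hxy⟩ := h4
    simp only [vadd_eq_add] at hxy
    have : x + (v - v') = y := by
      have h5 : y = (x - v') + v := by rw [← hxy]; abel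
      rw [h5]; abel
    rwa [this]
  refine ⟨κ, hκpos, ?_⟩
  rw [sub_eq_zero.1 hvv, hv', ← ha]
  exact han

/-! ### Comparison with the definitions of the statement -/

variable {d : ℕ}

theorem isTilingFace_iff {T : Set (Set (EuclideanSpace ℝ (Fin d)))} {k : ℕ}
    {F : Set (EuclideanSpace ℝ (Fin d))} :
    IsTilingFace T k F ↔ HasCodim k F ∧ ∃ Q ∈ T, IsExposed ℝ Q F := by
  unfold IsTilingFace HasCodim
  rw [finrank_euclideanSpace_fin]
  tauto

theorem facetsAround_eq (T : Set (Set (EuclideanSpace ℝ (Fin d))))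
    (G : Set (EuclideanSpace ℝ (Fin d))) : facetsAround T G = facetsAt T G := by
  ext F
  change IsTilingFace T 1 F ∧ G ⊆ F ↔ _ ∧ _ ∧ _
  rw [isTilingFace_iff, and_assoc]

theorem areCoherentNormals_iff {T : Set (Set (EuclideanSpace ℝ (Fin d)))}
    {G : Set (EuclideanSpace ℝ (Fin d))}
    {n : Set (EuclideanSpace ℝ (Fin d)) → EuclideanSpace ℝ (Fin d)} :
    AreCoherentNormals T G n ↔ ∃ ω, ω ≠ 0 ∧ IsCoherent T G ω n := by
  unfold AreCoherentNormals
  rw [facetsAround_eq]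
  refine exists_congr fun ω => and_congr_right fun _ => ⟨?_, ?_⟩
  · rintro ⟨h1, h2, h3⟩
    exact ⟨h1, h2, fun F hF => (h3 F hF).1,
      fun F hF v hv => by rw [real_inner_comm]; exact (h3 F hF).2.1 v hv,
      fun F hF => (h3 F hF).2.2⟩
  · rintro ⟨h1, h2, h3, h4, h5⟩
    exact ⟨h1, h2, fun F hF => ⟨h3 F hF, fun v hv => by rw [real_inner_comm]; exact h4 F hF v hv,
      h5 F hF⟩⟩

theorem isTranslateTiling_of_normal {P : Set (EuclideanSpace ℝ (Fin d))}
    (hP : IsFullDimPolytope P) {T : Set (Set (EuclideanSpace ℝ (Fin d)))}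
    (hT : IsNormalTranslateTiling P T) : IsTranslateTiling P T := by
  obtain ⟨⟨V, hV, hPV⟩, hi⟩ := hP
  refine isTranslateTiling_of ?_ ?_ hi hT.translate hT.cover hT.disjoint
    (fun Q hQ R hR => (hT.face_to_face Q hQ R hR).1)
  · rw [hPV]; exact convex_convexHull ℝ V
  · rw [hPV]; exact hV.isCompact_convexHull ℝ

/-- With this choice, `s F • n` is the difference of `A (tr R)` and `A (tr Q)`, so each torsion
telescopes. -/
theorem exists_isCanonicalScaling {P : Set (EuclideanSpace ℝ (Fin d))}
    {T : Set (Set (EuclideanSpace ℝ (Fin d)))} (hT : IsTranslateTiling P T)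
    (hV : VoronoiConjectureHoldsFor P) : ∃ s, IsCanonicalScaling T s := by
  classical
  obtain ⟨f, Λ, hΛ, -, p, hp, hfP⟩ := hV
  set A := (LinearMap.adjoint f.linear.toLinearMap) ∘ₗ f.linear.toLinearMap with hA
  have hfc : Continuous f := f.toAffineMap.continuous_of_finiteDimensional
  have hP : P = f ⁻¹' {x | ∀ q ∈ (Λ : Set (EuclideanSpace ℝ (Fin d))), ‖x - p‖ ≤ ‖x - q‖} := by
    have h1 : f ⁻¹' (f '' P) = P := preimage_image_eq P f.injective
    rw [hfP] at h1
    exact h1.symm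
  have hkey : ∀ v n, IsFacetVec P v n → ∃ κ > (0 : ℝ), A v = κ • n := fun v n h =>
    exists_pos_smul_normal hT.compact_body.isBounded hT.interior_body hT.convex_body Λ f.linear f
      hfc (fun x y => (f.toAffineMap.linearMap_vsub x y).symm) hp hP h
  obtain ⟨tr, htr, htr'⟩ := hT.exists_translation
  -- The pair of cells is chosen from the facet. Only the order is ambiguous, and the norm ignores
  -- it.
  have hex : ∀ F, ∃ κ : ℝ, (∃ Q ∈ T, ∃ R ∈ T, HasCodim 1 F ∧ Q ∩ R = F) →
      ∃ Q ∈ T, ∃ R ∈ T, HasCodim 1 F ∧ Q ∩ R = F ∧ κ = ‖A (tr R - tr Q)‖ := by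
    intro F
    by_cases h : ∃ Q ∈ T, ∃ R ∈ T, HasCodim 1 F ∧ Q ∩ R = F
    · obtain ⟨Q, hQ, R, hR, h1, h2⟩ := h
      exact ⟨_, fun _ => ⟨Q, hQ, R, hR, h1, h2, rfl⟩⟩
    · exact ⟨0, fun h' => absurd h' h⟩
  choose s hs using hex
  have hs' : ∀ Q ∈ T, ∀ R ∈ T, HasCodim 1 (Q ∩ R) → s (Q ∩ R) = ‖A (tr R - tr Q)‖ := by
    intro Q hQ R hR hc
    obtain ⟨Q', hQ', R', hR', -, he, hsF⟩ := hs (Q ∩ R) ⟨Q, hQ, R, hR, hc, rfl⟩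
    obtain ⟨w, hw⟩ := exists_relInt ((hT.convex Q hQ).inter (hT.convex R hR)) hc.1
    have hwQ' : w ∈ Q' ∩ R' := he ▸ hw.1
    have hne : Q' ≠ R' := hT.ne_of_hasCodim_one hQ' (he ▸ hc)
    rw [hsF]
    rcases hT.eq_or_eq_of_relInt hQ hR hQ' hc hw hwQ'.1 with h1 | h1 <;>
      rcases hT.eq_or_eq_of_relInt hQ hR hR' hc hw hwQ'.2 with h2 | h2
    · exact absurd (h1.trans h2.symm) hne
    · rw [h1, h2]
    · rw [h1, h2, ← neg_sub, map_neg, norm_neg]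
    · exact absurd (h1.trans h2.symm) hne
  have hsn : ∀ Q ∈ T, ∀ R ∈ T, ∀ n, HasCodim 1 (Q ∩ R) → IsFacetNormal Q (Q ∩ R) n →
      IsFacetNormal R (Q ∩ R) (-n) → 0 < s (Q ∩ R) ∧ s (Q ∩ R) • n = A (tr R - tr Q) := by
    intro Q hQ R hR n hc hn hn'
    have hs0 := hs' Q hQ R hR hc
    have hvec := IsFacetVec.of_eq_vadd (htr Q hQ) (htr R hR) hc hn hn'
    obtain ⟨κ, hκ, hκn⟩ := hkey _ _ hvec
    have : s (Q ∩ R) = κ := by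
      rw [hs0, hκn, norm_smul, hn.1, mul_one, Real.norm_eq_abs, abs_of_pos hκ]
    rw [this, hκn]
    exact ⟨hκ, rfl⟩
  refine ⟨s, fun F hF => ?_, fun G hG n hn => ?_⟩
  · obtain ⟨hc, Q, hQ, hE⟩ := isTilingFace_iff.1 hF
    obtain ⟨R, hR, -, rfl⟩ := hT.exists_neighbor hQ hc hE
    obtain ⟨n, h1, h2⟩ := hT.exists_normal hQ hR hc
    exact (hsn Q hQ R hR n hc h1 h2).1
  · obtain ⟨hc, hE⟩ := isTilingFace_iff.1 hG
    have hR : IsRidge T G := ⟨hc, hE⟩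
    obtain ⟨ω, -, hω⟩ := areCoherentNormals_iff.1 hn
    obtain ⟨src, tgt, hm⟩ := hT.exists_isMatching hR hω
    unfold torsion
    rw [facetsAround_eq, ← hm.finsum_sub_eq_zero hT.toIsFaceTiling hc.1 (fun Q => A (tr Q))]
    refine finsum_mem_congr rfl fun F hF => ?_
    have h1 := hm.inter F hF
    have h2 := hsn (src F) (hm.bij_src.mapsTo hF).1 (tgt F) (hm.bij_tgt.mapsTo hF).1 (n F)
    rw [h1] at h2
    rw [(h2 hF.1 (hm.normal_src F hF) (hm.normal_tgt F hF)).2, map_sub]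

end Parallelohedron

namespace Parallelohedron

open Set Module

set_option linter.unusedSectionVars false

variable {E : Type*} [NormedAddCommGroup E] [InnerProductSpace ℝ E] [FiniteDimensional ℝ E]

local notation "⟪" x "," y "⟫" => inner ℝ x y

/-! ### The gradient of the generatrix -/

theorem IsFaceTiling.exists_gradient {T : Set (Set E)} (hT : IsFaceTiling T) (s : Set E → ℝ)
    (hs : ∀ G, IsRidge T G → ∀ ω n, ω ≠ 0 → IsCoherent T G ω n →
      ∑ᶠ F ∈ facetsAt T G, s F • n F = 0) :
    ∃ a : Set E → E, ∀ Q ∈ T, ∀ R ∈ T, ∀ n, HasCodim 1 (Q ∩ R) → IsFacetNormal Q (Q ∩ R) n →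
      IsFacetNormal R (Q ∩ R) (-n) → a R - a Q = s (Q ∩ R) • n := by
  have hex : ∀ Q R, ∃ n, Q ∈ T → R ∈ T → HasCodim 1 (Q ∩ R) → IsFacetNormal Q (Q ∩ R) n ∧
      IsFacetNormal R (Q ∩ R) (-n) := by
    intro Q R
    by_cases h : Q ∈ T ∧ R ∈ T ∧ HasCodim 1 (Q ∩ R)
    · obtain ⟨n, hn⟩ := hT.exists_normal h.1 h.2.1 h.2.2
      exact ⟨n, fun _ _ _ => hn⟩
    · exact ⟨0, fun h1 h2 h3 => absurd ⟨h1, h2, h3⟩ h⟩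
  choose ν hν using hex
  have huniq : ∀ Q ∈ T, ∀ R ∈ T, ∀ n, HasCodim 1 (Q ∩ R) → IsFacetNormal Q (Q ∩ R) n →
      ν Q R = n := fun Q hQ R hR n hc hn =>
    hn.unique (hT.interior_nonempty Q hQ) hc (hν Q R hQ hR hc).1
  obtain ⟨a, ha⟩ := hT.exists_potential_of_ridges (fun Q R => s (Q ∩ R) • ν Q R)
    (fun Q hQ R hR hc => by
      have hc' : HasCodim 1 (R ∩ Q) := inter_comm Q R ▸ hc
      have h1 := (hν Q R hQ hR hc).2
      rw [inter_comm] at h1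
      rw [huniq R hR Q hQ _ hc' h1, inter_comm R Q, smul_neg])
    (fun G hG => by
      obtain ⟨ω, n, hω, hn⟩ := hT.exists_isCoherent hG
      obtain ⟨src, tgt, hm⟩ := hT.exists_isMatching hG hn
      refine hT.exists_ridge_potential hG hm _ (fun Q hQ R hR hc => ?_) ?_
      · have hc' : HasCodim 1 (R ∩ Q) := inter_comm Q R ▸ hc
        have h1 := (hν Q R hQ hR hc).2
        rw [inter_comm] at h1
        rw [huniq R hR Q hQ _ hc' h1, inter_comm R Q, smul_neg]
      · rw [← hs G hG ω n hω hn]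
        refine finsum_mem_congr rfl fun F hF => ?_
        have h1 := hm.inter F hF
        have h2 := huniq (src F) (hm.bij_src.mapsTo hF).1 (tgt F) (hm.bij_tgt.mapsTo hF).1 (n F)
        rw [h1] at h2
        rw [h1, h2 hF.1 (hm.normal_src F hF)])
  refine ⟨a, fun Q hQ R hR n hc hn _ => ?_⟩
  rw [ha Q hQ R hR hc, huniq Q hQ R hR n hc hn]

/-! ### From the gradient to a linear map -/

/-- A function on a subgroup whose increments along each generator have a fixed direction. -/
structure IsGradient (P : Set E) (α : E → E) : Prop where
  step : ∀ t ∈ AddSubgroup.closure (facetVecs P), ∀ v n, IsFacetVec P v n →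
    ∃ σ > (0 : ℝ), α (t + v) - α t = σ • n

variable {P : Set E} {α : E → E}

theorem IsFacetVec.not_parallel (hb : Bornology.IsBounded P) {v w n m : E}
    (hv : IsFacetVec P v n) (hw : IsFacetVec P w m) (h1 : w ≠ v) (h2 : w ≠ -v) (c : ℝ) :
    m ≠ c • n := by
  intro h
  have hc : |c| = 1 := by
    have := congrArg norm h
    rw [norm_smul, hv.normal.1, hw.normal.1, mul_one] at this
    exact this.symm
  rcases (abs_eq zero_le_one).1 hc with rfl | rfl
  · rw [one_smul] at h
    subst h
    exact h1 (hw.unique hb hv)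
  · rw [neg_one_smul] at h
    subst h
    exact h2 (hw.unique hb hv.neg)

/-- The two orders of adding `v` and `w` give the same total increment as combinations of the
independent normals `n` and `m`, so the coefficients agree. -/
theorem IsGradient.parallelogram (hα : IsGradient P α) (hb : Bornology.IsBounded P) {t v w n m : E}
    (ht : t ∈ AddSubgroup.closure (facetVecs P)) (hv : IsFacetVec P v n) (hw : IsFacetVec P w m)
    (h1 : w ≠ v) (h2 : w ≠ -v) : α (t + w + v) - α (t + w) = α (t + v) - α t := by
  have hvc : v ∈ AddSubgroup.closure (facetVecs P) := AddSubgroup.subset_closure ⟨n, hv⟩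
  have hwc : w ∈ AddSubgroup.closure (facetVecs P) := AddSubgroup.subset_closure ⟨m, hw⟩
  obtain ⟨σ₁, -, e1⟩ := hα.step t ht v n hv
  obtain ⟨σ₂, -, e2⟩ := hα.step (t + w) (add_mem ht hwc) v n hv
  obtain ⟨τ₁, -, e3⟩ := hα.step t ht w m hw
  obtain ⟨τ₂, -, e4⟩ := hα.step (t + v) (add_mem ht hvc) w m hw
  have h3 : t + w + v = t + v + w := by abel
  have hsum : σ₂ • n + τ₁ • m = τ₂ • m + σ₁ • n := by
    rw [← e1, ← e2, ← e3, ← e4, h3]; abel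
  by_cases hτ : τ₁ = τ₂
  · rw [e1, e2]
    rw [hτ, add_comm] at hsum
    exact add_left_cancel hsum
  · exfalso
    refine hv.not_parallel hb hw h1 h2 ((τ₁ - τ₂)⁻¹ * (σ₁ - σ₂)) ?_
    have h4 : (τ₁ - τ₂) • m = (σ₁ - σ₂) • n := by
      rw [sub_smul, sub_smul, sub_eq_sub_iff_add_eq_add, add_comm, hsum, add_comm]
    rw [mul_smul, ← h4, smul_smul, inv_mul_cancel₀ (sub_ne_zero.2 hτ), one_smul]

/-- A generic functional chooses one vector from each pair `± v`, as needed to apply `parallelogram`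
to distinct vectors. -/
theorem exists_half_system {N : Set E} (hN : N.Finite) (h0 : (0 : E) ∉ N) :
    ∃ u : E, ∀ v ∈ N, ⟪u, v⟫ ≠ 0 := by
  obtain ⟨u, -, hu⟩ := exists_mem_avoiding hN.countable (fun v => (((ℝ ∙ v)ᗮ : Submodule ℝ E) : Set E))
    (fun v hv => by
      have hv0 : v ≠ 0 := fun h => h0 (h ▸ hv)
      have h1 : vectorSpan ℝ (((ℝ ∙ v)ᗮ : Submodule ℝ E) : Set E) = (ℝ ∙ v)ᗮ := by
        rw [vectorSpan_eq_span_vsub_set_right ℝ (zero_mem (ℝ ∙ v)ᗮ)]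
        simp
      rw [h1]
      have h2 := Submodule.finrank_add_finrank_orthogonal (ℝ ∙ v)
      rw [finrank_span_singleton hv0] at h2
      omega) isOpen_univ univ_nonempty
  refine ⟨u, fun v hv h => hu v hv (subset_affineSpan ℝ _ ?_)⟩
  rw [SetLike.mem_coe, Submodule.mem_orthogonal_singleton_iff_inner_left]
  exact h

/-- Periods of an additive function can be averaged. -/
theorem exists_average (H : AddSubgroup ℤ) (g : ℤ → E) (n : E)
    (hg : ∀ m ∈ H, ∀ m', g (m + m') = g m + g m')
    (hpos : ∀ m : ℕ, ∃ σ > (0 : ℝ), g (m + 1) = σ • n) :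
    ∃ κ > (0 : ℝ), ∀ m ∈ H, g m = (m : ℝ) • κ • n := by
  have hg0 : g 0 = 0 := by
    have := hg 0 H.zero_mem 0
    rw [add_zero] at this
    simpa using this
  -- A positive period `p` fixes the mean increment `σ / p`. Without one `H` is trivial and any
  -- positive factor serves.
  by_cases hex : ∃ p ∈ H, 0 < p
  · obtain ⟨p, hp, hp0⟩ := hex
    let G : H →+ E := AddMonoidHom.mk' (fun m => g m) (fun a b => hg a a.2 b)
    obtain ⟨σ, hσ, hgp⟩ := hpos (p - 1).toNat
    have hp1 : (((p - 1).toNat : ℤ) + 1) = p := by omega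
    rw [hp1] at hgp
    have hp0' : (0 : ℝ) < p := by exact_mod_cast hp0
    refine ⟨σ / p, by positivity, fun m hm => ?_⟩
    have h1 : m • G ⟨p, hp⟩ = p • G ⟨m, hm⟩ := by
      rw [← map_zsmul, ← map_zsmul]
      congr 1
      ext
      simp [mul_comm]
    have h2 : (m : ℝ) • g p = (p : ℝ) • g m := by
      rw [Int.cast_smul_eq_zsmul, Int.cast_smul_eq_zsmul]
      exact h1
    rw [hgp] at h2
    rw [div_eq_inv_mul, mul_smul, smul_comm, h2, smul_smul, inv_mul_cancel₀ hp0'.ne', one_smul]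
  · push Not at hex
    obtain ⟨σ, hσ, -⟩ := hpos 0
    refine ⟨σ, hσ, fun m hm => ?_⟩
    have h1 := hex m hm
    have h2 := hex (-m) (H.neg_mem hm)
    obtain rfl : m = 0 := by omega
    simp [hg0]

/-- For facet vectors in a half system, the increment along `v` is invariant under the subgroup `M
v` generated by the others. In a relation `∑ k v • v = 0` each `k v • v` lies in `M v`, so the
integer multiples at stake are periods, on which the increment is exactly linear with an averaged
factor. -/
theorem IsGradient.exists_relation_map (hα : IsGradient P α) (hb : Bornology.IsBounded P)
    (hi : (interior P).Nonempty) (hfin : (facetVecs P).Finite) :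
    ∃ g : AddSubgroup.closure (facetVecs P) →+ E, ∀ v n (h : IsFacetVec P v n),
      ∃ κ > (0 : ℝ), g ⟨v, AddSubgroup.subset_closure ⟨n, h⟩⟩ = κ • n := by
  classical
  set Λ := AddSubgroup.closure (facetVecs P) with hΛ
  have hNΛ : ∀ v n, IsFacetVec P v n → v ∈ Λ := fun v n h => AddSubgroup.subset_closure ⟨n, h⟩
  obtain ⟨u, hu⟩ := exists_half_system hfin (fun ⟨n, hn⟩ => by
    have := hn.inner_pos hi
    simp at this)
  set N : Finset E := (hfin.subset (fun v (hv : v ∈ {v ∈ facetVecs P | 0 < ⟪u, v⟫}) => hv.1)).toFinset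
    with hN
  have hmemN : ∀ v, v ∈ N ↔ v ∈ facetVecs P ∧ 0 < ⟪u, v⟫ := fun v => by
    rw [hN, Set.Finite.mem_toFinset]; rfl
  have hNsub : ∀ v ∈ N, v ∈ Λ := fun v hv => AddSubgroup.subset_closure ((hmemN v).1 hv).1
  let M : E → AddSubgroup E := fun v => AddSubgroup.closure ((N : Set E) \ {v})
  have hNM : ∀ v w, w ∈ N → w ≠ v → w ∈ M v := fun v w hw hwv => by
    have : w ∈ (N : Set E) \ {v} := ⟨hw, hwv⟩
    exact AddSubgroup.subset_closure this
  have hMΛ : ∀ v, M v ≤ Λ := fun v => by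
    rw [AddSubgroup.closure_le]
    exact fun w hw => hNsub w hw.1
  -- increments along `v` do not depend on the other directions
  have hD : ∀ v ∈ N, ∀ w ∈ M v, ∀ t ∈ Λ, α (t + w + v) - α (t + w) = α (t + v) - α t := by
    intro v hv w hw
    obtain ⟨⟨n, hn⟩, huv⟩ := (hmemN v).1 hv
    induction hw using AddSubgroup.closure_induction with
    | mem w hw =>
      intro t ht
      obtain ⟨⟨m, hm⟩, huw⟩ := (hmemN w).1 hw.1
      refine hα.parallelogram hb ht hn hm hw.2 fun h => ?_
      rw [h, inner_neg_right] at huw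
      linarith
    | zero => intro t _; rw [add_zero]
    | add w w' hw hw' h h' =>
      intro t ht
      rw [← add_assoc, h' (t + w) (add_mem ht (hMΛ v hw)), h t ht]
    | neg w hw h =>
      intro t ht
      have := h (t + -w) (add_mem ht (neg_mem (hMΛ v hw)))
      rw [neg_add_cancel_right] at this
      exact this.symm
  have hDm : ∀ v ∈ N, ∀ w ∈ M v, ∀ t ∈ Λ, ∀ m : ℤ,
      α (t + w + m • v) - α (t + w) = α (t + m • v) - α t := by
    intro v hv w hw t ht m
    have hvΛ := hNsub v hv
    have hstep : ∀ m : ℤ, α (t + w + (m + 1) • v) - α (t + w + m • v) =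
        α (t + (m + 1) • v) - α (t + m • v) := by
      intro m
      have := hD v hv w hw (t + m • v) (add_mem ht (Λ.zsmul_mem hvΛ m))
      rw [add_right_comm t (m • v) w] at this
      rw [add_smul, one_smul, ← add_assoc, ← add_assoc]
      exact this
    induction m using Int.induction_on with
    | zero => simp
    | succ i ih =>
      have := congrArg₂ (· + ·) (hstep i) ih
      simpa only [sub_add_sub_cancel] using this
    | pred i ih =>
      have h1 := hstep (-i - 1)
      rw [sub_add_cancel] at h1
      have := congrArg₂ (· - ·) ih h1
      simpa only [sub_sub_sub_cancel_left, sub_sub_sub_cancel_right] using this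
  let g : E → ℤ → E := fun v m => α (m • v) - α 0
  have hg : ∀ v ∈ N, ∀ w ∈ M v, ∀ m : ℤ, α (w + m • v) - α w = g v m := by
    intro v hv w hw m
    have := hDm v hv w hw 0 Λ.zero_mem m
    simpa [g] using this
  have hnorm : ∀ v, ∃ n, v ∈ N → IsFacetVec P v n := by
    intro v
    by_cases hv : v ∈ N
    · obtain ⟨⟨n, hn⟩, -⟩ := (hmemN v).1 hv
      exact ⟨n, fun _ => hn⟩
    · exact ⟨0, fun h => absurd h hv⟩
  choose ν hν using hnorm
  have hpos : ∀ v ∈ N, ∀ m : ℕ, ∃ σ > (0 : ℝ), g v (m + 1) = σ • ν v := by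
    intro v hv m
    induction m with
    | zero =>
      obtain ⟨σ, hσ, h⟩ := hα.step 0 Λ.zero_mem v (ν v) (hν v hv)
      exact ⟨σ, hσ, by simpa [g] using h⟩
    | succ m ih =>
      obtain ⟨σ, hσ, h⟩ := ih
      obtain ⟨σ', hσ', h'⟩ := hα.step (((m : ℤ) + 1) • v) (Λ.zsmul_mem (hNsub v hv) _) v (ν v)
        (hν v hv)
      refine ⟨σ' + σ, by positivity, ?_⟩
      rw [add_smul, ← h', ← h]
      simp only [g]
      push_cast
      rw [add_smul ((m : ℤ) + 1) 1 v, one_smul]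
      abel
  -- The integers `m` with `m • v` in `M v` form the group of periods to average over.
  have hJ : ∀ v, ∃ κ > (0 : ℝ), v ∈ N → ∀ m : ℤ, m • v ∈ M v → g v m = (m : ℝ) • κ • ν v := by
    intro v
    by_cases hv : v ∈ N
    · obtain ⟨κ, hκ, h⟩ := exists_average ((M v).comap (zmultiplesHom E v)) (g v) (ν v)
        (fun m hm m' => by
          have hm' : m • v ∈ M v := by simpa using hm
          have := hg v hv (m • v) hm' m'
          rw [← this, ← add_smul]
          simp only [g]
          abel) (hpos v hv)
      exact ⟨κ, hκ, fun _ m hm => h m (by simpa using hm)⟩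
    · exact ⟨1, one_pos, fun h => absurd h hv⟩
  choose κ hκ hJ using hJ
  have hsum : ∀ (k : E → ℤ) (S : Finset E), S ⊆ N →
      α (∑ v ∈ S, k v • v) - α 0 = ∑ v ∈ S, g v (k v) := by
    intro k S
    induction S using Finset.induction_on with
    | empty => simp
    | insert v S hvS ih =>
      intro hSN
      have hS : S ⊆ N := fun w hw => hSN (Finset.mem_insert_of_mem hw)
      have hv : v ∈ N := hSN (Finset.mem_insert_self v S)
      have hw : ∑ w ∈ S, k w • w ∈ M v := AddSubgroup.sum_mem _ fun w hw =>
        AddSubgroup.zsmul_mem _ (hNM v w (hS hw) fun h => hvS (h ▸ hw)) _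
      rw [Finset.sum_insert hvS, Finset.sum_insert hvS, ← ih hS, ← hg v hv _ hw (k v),
        add_comm (k v • v)]
      abel
  -- Following the relation one generator at a time returns to 0, so the total increment vanishes;
  -- each part is linear because its multiple is a period.
  have hrel : ∀ k : E → ℤ, ∑ v ∈ N, k v • v = 0 → ∑ v ∈ N, k v • κ v • ν v = 0 := by
    intro k hk
    have h1 := hsum k N subset_rfl
    rw [hk, sub_self] at h1
    rw [h1]
    refine Finset.sum_congr rfl fun v hv => ?_
    rw [hJ v hv (k v), Int.cast_smul_eq_zsmul]
    rw [← Finset.add_sum_erase N _ hv] at hk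
    rw [eq_neg_of_add_eq_zero_left hk]
    exact AddSubgroup.neg_mem _ (AddSubgroup.sum_mem _ fun w hw => AddSubgroup.zsmul_mem _
      (hNM v w (Finset.mem_of_mem_erase hw) (Finset.ne_of_mem_erase hw)) _)
  have hrep : ∀ x : Λ, ∃ k : E → ℤ, ∑ v ∈ N, k v • v = x := by
    rintro ⟨x, hx⟩
    induction hx using AddSubgroup.closure_induction with
    | mem v hv =>
      rcases lt_or_gt_of_ne (hu v hv) with h | h
      · have hmem : -v ∈ N := (hmemN _).2 ⟨hv.imp' (fun n => -n) fun n hn => hn.neg, by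
          rw [inner_neg_right]; linarith⟩
        refine ⟨Pi.single (-v) (-1), ?_⟩
        rw [Finset.sum_eq_single (-v) (fun w _ hw => by simp [Pi.single_eq_of_ne hw])
          (fun h => absurd hmem h)]
        simp
      · have hmem : v ∈ N := (hmemN _).2 ⟨hv, h⟩
        refine ⟨Pi.single v 1, ?_⟩
        rw [Finset.sum_eq_single v (fun w _ hw => by simp [Pi.single_eq_of_ne hw])
          (fun h => absurd hmem h)]
        simp
    | zero => exact ⟨0, by simp⟩
    | add x y _ _ hx hy =>
      obtain ⟨k, hk⟩ := hx
      obtain ⟨l, hl⟩ := hy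
      exact ⟨k + l, by simp [add_smul, Finset.sum_add_distrib, hk, hl]⟩
    | neg x _ hx =>
      obtain ⟨k, hk⟩ := hx
      exact ⟨-k, by simp [neg_smul, Finset.sum_neg_distrib, hk]⟩
  choose k hk using hrep
  have hindep : ∀ l l' : E → ℤ, ∑ v ∈ N, l v • v = ∑ v ∈ N, l' v • v →
      ∑ v ∈ N, l v • κ v • ν v = ∑ v ∈ N, l' v • κ v • ν v := by
    intro l l' h
    have := hrel (l - l') (by simp [sub_smul, Finset.sum_sub_distrib, h])
    simpa [sub_smul, Finset.sum_sub_distrib, sub_eq_zero] using this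
  let G : Λ →+ E := AddMonoidHom.mk' (fun x => ∑ v ∈ N, k x v • κ v • ν v) (fun x y => by
    have := hindep (k (x + y)) (k x + k y) (by
      simp [add_smul, Finset.sum_add_distrib, hk])
    rw [this]
    simp [add_smul, Finset.sum_add_distrib])
  have hGN : ∀ v (hv : v ∈ N), G ⟨v, hNsub v hv⟩ = κ v • ν v := by
    intro v hv
    have := hindep (k ⟨v, hNsub v hv⟩) (Pi.single v 1) (by
      rw [hk, Finset.sum_eq_single v (fun w _ hw => by simp [Pi.single_eq_of_ne hw])
          (fun h => absurd hv h)]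
      simp)
    change ∑ w ∈ N, k ⟨v, hNsub v hv⟩ w • κ w • ν w = _
    rw [this, Finset.sum_eq_single v (fun w _ hw => by simp [Pi.single_eq_of_ne hw])
          (fun h => absurd hv h)]
    simp
  refine ⟨G, fun v n h => ?_⟩
  rcases lt_or_gt_of_ne (hu v ⟨n, h⟩) with h1 | h1
  · have hmem : -v ∈ N := (hmemN _).2 ⟨⟨-n, h.neg⟩, by rw [inner_neg_right]; linarith⟩
    refine ⟨κ (-v), hκ _, ?_⟩
    have h2 := hGN (-v) hmem
    rw [h.neg.normal_unique hi (hν _ hmem), smul_neg] at h2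
    have h3 : (⟨v, AddSubgroup.subset_closure ⟨n, h⟩⟩ : Λ) = -⟨-v, hNsub _ hmem⟩ := by
      ext; simp
    rw [h3, map_neg, h2, neg_neg]
  · have hmem : v ∈ N := (hmemN _).2 ⟨⟨n, h⟩, h1⟩
    refine ⟨κ v, hκ _, ?_⟩
    rw [hGN v hmem, h.normal_unique hi (hν _ hmem)]

end Parallelohedron

namespace Parallelohedron

open Set Module

set_option linter.unusedSectionVars false

variable {E : Type*} [NormedAddCommGroup E] [InnerProductSpace ℝ E] [FiniteDimensional ℝ E]

local notation "⟪" x "," y "⟫" => inner ℝ x y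

/-! ### Linear algebra -/

/-- An additive map on a lattice extends to a linear map. -/
theorem exists_linear_extension {F : Type*} [AddCommGroup F] [Module ℝ F] (Λ : Submodule ℤ E)
    [DiscreteTopology Λ] [IsZLattice ℝ Λ] (g : Λ →+ F) : ∃ A : E →ₗ[ℝ] F, ∀ v : Λ, A v = g v := by
  have := ZLattice.module_free ℝ Λ
  have := ZLattice.module_finite ℝ Λ
  let b := Module.Free.chooseBasis ℤ Λ
  refine ⟨(b.ofZLatticeBasis ℝ Λ).constr ℝ fun i => g (b i), fun v => ?_⟩
  have h : (((b.ofZLatticeBasis ℝ Λ).constr ℝ fun i => g (b i)).restrictScalars ℤ) ∘ₗ Λ.subtype =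
      g.toIntLinearMap := by
    refine b.ext fun i => ?_
    have h1 := (b.ofZLatticeBasis ℝ Λ).constr_basis ℝ (fun i => g (b i)) i
    rw [b.ofZLatticeBasis_apply ℝ Λ] at h1
    exact h1
  exact LinearMap.congr_fun h v

/-- Diagonalise `A` and scale the eigenvectors by the roots of the eigenvalues. -/
theorem exists_sqrt {A : E →ₗ[ℝ] E} (hA : A.IsPositive) :
    ∃ B : E →ₗ[ℝ] E, ∀ x y, ⟪B x, B y⟫ = ⟪A x, y⟫ := by
  classical
  let b := hA.isSymmetric.eigenvectorBasis rfl
  let l := hA.isSymmetric.eigenvalues rfl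
  have hl : ∀ i, 0 ≤ l i := hA.nonneg_eigenvalues rfl
  let B : E →ₗ[ℝ] E := b.toBasis.constr ℝ fun i => √(l i) • b i
  have hB : ∀ i, B (b i) = √(l i) • b i := fun i => by
    have := b.toBasis.constr_basis ℝ (fun i => √(l i) • b i) i
    rwa [b.coe_toBasis] at this
  have hAb : ∀ i, A (b i) = l i • b i := fun i => hA.isSymmetric.apply_eigenvectorBasis rfl i
  have h : (innerₛₗ ℝ).compl₁₂ B B = (innerₛₗ ℝ).comp A := by
    refine b.toBasis.ext fun i => b.toBasis.ext fun j => ?_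
    change ⟪B (b.toBasis i), B (b.toBasis j)⟫ = ⟪A (b.toBasis i), b.toBasis j⟫
    simp only [b.coe_toBasis, hB, hAb, real_inner_smul_left, real_inner_smul_right]
    rw [orthonormal_iff_ite.1 b.orthonormal i j]
    split_ifs with hij
    · rw [hij, mul_one, mul_one, Real.mul_self_sqrt (hl j)]
    · simp
  exact ⟨B, fun x y => LinearMap.congr_fun (LinearMap.congr_fun h x) y⟩

/-! ### The lattice of a tiling by translates -/

/-- The lattice generated by the facet vectors. -/
abbrev facetLattice (P : Set E) : Submodule ℤ E :=
  AddSubgroup.toIntSubmodule (AddSubgroup.closure (facetVecs P))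

/-- A linear map taking facet vectors to positive multiples of the facet normals. -/
def IsNormalMap (P : Set E) (A : E →ₗ[ℝ] E) : Prop :=
  ∀ v n, IsFacetVec P v n → ∃ κ > (0 : ℝ), A v = κ • n

variable {P : Set E} {T : Set (Set E)}

namespace IsTranslateTiling

/-- Lattice points closer than the radius of a ball inside `P` would give overlapping cells. -/
theorem discreteTopology (hT : IsTranslateTiling P T) (h0 : P ∈ T) :
    DiscreteTopology (facetLattice P) := by
  obtain ⟨p, hp⟩ := hT.interior_body
  obtain ⟨ρ, hρ, hball⟩ := Metric.isOpen_iff.1 isOpen_interior p hp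
  refine DiscreteTopology.of_forall_le_dist hρ fun x y hxy => ?_
  by_contra! hlt
  refine hxy (sub_eq_zero.1 (Subtype.ext ?_))
  refine hT.mem_interior_unique h0 (x - y).2 hp (interior_subset (hball ?_))
  rw [Subtype.dist_eq, dist_eq_norm] at hlt
  rw [Metric.mem_ball, dist_eq_norm, sub_sub_cancel_left, norm_neg]
  exact hlt

/-- Every point is within a bounded distance of the lattice, whereas large multiples of a nonzero
vector orthogonal to it are not. -/
theorem span_facetLattice (hT : IsTranslateTiling P T) (h0 : P ∈ T) :
    Submodule.span ℝ (facetLattice P : Set E) = ⊤ := by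
  rw [← Submodule.orthogonal_eq_bot_iff, Submodule.eq_bot_iff]
  intro x hx
  obtain ⟨D, hD⟩ := hT.compact_body.isBounded.exists_norm_le
  by_contra hx0
  have hxn : 0 < ‖x‖ := norm_pos_iff.2 hx0
  obtain ⟨k, hk⟩ := exists_nat_gt (D / ‖x‖)
  rw [div_lt_iff₀ hxn] at hk
  obtain ⟨v, hv, hvP⟩ := hT.exists_sub_mem h0 ((k : ℝ) • x)
  have h1 : ⟪v, x⟫ = 0 := hx v (Submodule.subset_span hv)
  have h2 := real_inner_le_norm ((k : ℝ) • x - v) x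
  rw [inner_sub_left, h1, sub_zero, inner_smul_left, real_inner_self_eq_norm_mul_norm,
    conj_trivial, ← mul_assoc] at h2
  have h3 := le_of_mul_le_mul_right h2 hxn
  linarith [hD _ hvP]

theorem isZLattice (hT : IsTranslateTiling P T) (h0 : P ∈ T) :
    @IsZLattice ℝ _ E _ _ (facetLattice P) (hT.discreteTopology h0) :=
  @IsZLattice.mk ℝ _ E _ _ _ (hT.discreteTopology h0) (hT.span_facetLattice h0)

/-! ### The generatrix -/

variable {A : E →ₗ[ℝ] E}

/-- The heights of the affine pieces of the generatrix with gradient `A`. -/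
theorem exists_height (hT : IsTranslateTiling P T) (h0 : P ∈ T) (hA : IsNormalMap P A) :
    ∃ b : E → ℝ, b 0 = 0 ∧ ∀ t ∈ AddSubgroup.closure (facetVecs P), ∀ v n, IsFacetVec P v n →
      ∀ z ∈ P ∩ (v +ᵥ P), b (t + v) - b t = ⟪A v, t + z⟫ := by
  obtain ⟨tr, htr, htr'⟩ := hT.exists_translation
  have hpt : ∀ F : Set E, ∃ x, F.Nonempty → x ∈ F := fun F => by
    by_cases h : F.Nonempty
    · exact ⟨h.some, fun _ => h.some_mem⟩
    · exact ⟨0, fun h' => absurd h' h⟩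
  choose pt hpt using hpt
  have hconst : ∀ Q ∈ T, ∀ R ∈ T, HasCodim 1 (Q ∩ R) → ∀ g ∈ Q ∩ R,
      ⟪A (tr R - tr Q), g⟫ = ⟪A (tr R - tr Q), pt (Q ∩ R)⟫ := by
    intro Q hQ R hR hc g hg
    obtain ⟨n, hn, hn'⟩ := hT.exists_normal hQ hR hc
    obtain ⟨κ, -, h⟩ := hA _ n (IsFacetVec.of_eq_vadd (htr Q hQ) (htr R hR) hc hn hn')
    rw [h, inner_smul_left, inner_smul_left, hn.inner_eq hg (hpt _ hc.1)]
  obtain ⟨a, ha⟩ := hT.exists_potential_of_ridges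
    (fun Q R => ⟪A (tr R - tr Q), pt (Q ∩ R)⟫)
    (fun Q hQ R hR hc => by
      rw [← neg_sub (tr R), map_neg, inner_neg_left, inter_comm])
    (fun G hG => by
      obtain ⟨g, hg⟩ := hG.codim.1
      -- A point `g` of the ridge lies on all facets around it, so the height jumps can all be
      -- evaluated there and integrate trivially.
      refine ⟨fun Q => ⟪A (tr Q), g⟫, fun Q hQ R hR hc => ?_⟩
      rw [← hconst Q hQ.1 R hR.1 hc g ⟨hQ.2 hg, hR.2 hg⟩, map_sub, inner_sub_left])
  refine ⟨fun t => a (t +ᵥ P) - a P, by simp, fun t ht v n hv z hz => ?_⟩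
  have hQ := (hT.mem_iff_mem_closure h0 t).2 ht
  have hR := hT.add_mem hQ hv
  have hc := (hv.vadd t).1
  have hmem : t + z ∈ (t +ᵥ P) ∩ ((t + v) +ᵥ P) := by
    rw [vadd_inter_vadd, add_sub_cancel_left]
    exact vadd_mem_vadd_set hz
  have h1 := ha _ hQ _ hR hc
  rw [← hconst _ hQ _ hR hc _ hmem, htr' _ hQ, htr' _ hR, add_sub_cancel_left] at h1
  rw [← h1]
  ring

/-! ### Symmetry of `A` and the bisecting hyperplanes -/

theorem inner_symm_of_lattice {Λ : Set E} (hΛ : Submodule.span ℝ Λ = ⊤)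
    (h : ∀ v ∈ Λ, ∀ w ∈ Λ, ⟪A v, w⟫ = ⟪v, A w⟫) : A.IsSymmetric := by
  have h1 : ∀ v ∈ Λ, ∀ y, ⟪A v, y⟫ = ⟪v, A y⟫ := by
    intro v hv y
    have hy : y ∈ Submodule.span ℝ Λ := hΛ ▸ Submodule.mem_top
    induction hy using Submodule.span_induction with
    | mem w hw => exact h v hv w hw
    | zero => simp
    | add x y _ _ hx hy => rw [map_add, inner_add_right, inner_add_right, hx, hy]
    | smul c x _ hx => rw [map_smul, inner_smul_right, inner_smul_right, hx]
  intro x y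
  have hx : x ∈ Submodule.span ℝ Λ := hΛ ▸ Submodule.mem_top
  induction hx using Submodule.span_induction with
  | mem w hw => exact h1 w hw y
  | zero => simp
  | add x y _ _ hx hy => rw [map_add, inner_add_left, inner_add_left, hx, hy]
  | smul c x _ hx => rw [map_smul, inner_smul_left, inner_smul_left, hx]

/-- The map `A` is symmetric, and every facet lies in the hyperplane that bisects its facet vector
in the metric given by `A`, after a translation by `c`. -/
theorem isSymmetric_and_bisect (hT : IsTranslateTiling P T) (h0 : P ∈ T) (hA : IsNormalMap P A) :
    A.IsSymmetric ∧ ∃ c : E, ∀ v n, IsFacetVec P v n → ∀ z ∈ P ∩ (v +ᵥ P),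
      ⟪A v, z⟫ = ⟪A v, v⟫ / 2 + ⟪c, v⟫ := by
  have := hT.discreteTopology h0
  have := hT.isZLattice h0
  obtain ⟨b, hb0, hb⟩ := hT.exists_height h0 hA
  have hbv : ∀ v n, IsFacetVec P v n → ∀ z ∈ P ∩ (v +ᵥ P), b v = ⟪A v, z⟫ := by
    intro v n hv z hz
    have := hb 0 (zero_mem _) v n hv z hz
    rwa [zero_add, zero_add, hb0, sub_zero] at this
  -- The heights form a quadratic function with polar form `⟪A w, t⟫`; exchanging `t` and `w` will
  -- give symmetry.
  have hquad : ∀ w ∈ AddSubgroup.closure (facetVecs P), ∀ t ∈ AddSubgroup.closure (facetVecs P),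
      b (t + w) = b t + b w + ⟪A w, t⟫ := by
    intro w hw
    induction hw using AddSubgroup.closure_induction with
    | mem v hv =>
      intro t ht
      obtain ⟨n, hv⟩ := hv
      obtain ⟨z, hz⟩ := hv.codim.1
      have h1 := hb t ht v n hv z hz
      have h2 := hbv v n hv z hz
      rw [inner_add_right] at h1
      linarith
    | zero => intro t _; simp [hb0]
    | add w w' hw hw' h h' =>
      intro t ht
      rw [← add_assoc, h' (t + w) (AddSubgroup.add_mem _ ht hw), h t ht, h' w hw, map_add, inner_add_left,
        inner_add_right]
      ring
    | neg w hw h =>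
      intro t ht
      have h1 := h (t + -w) (AddSubgroup.add_mem _ ht (neg_mem hw))
      have h2 := h (-w) (neg_mem hw)
      rw [neg_add_cancel_right, inner_add_right] at h1
      rw [neg_add_cancel, hb0] at h2
      rw [map_neg, inner_neg_left]
      linarith
  have hsymm : A.IsSymmetric := inner_symm_of_lattice (hT.span_facetLattice h0) fun v hv w hw => by
    have h1 := hquad v hv w hw
    have h2 := hquad w hw v hv
    rw [add_comm v w] at h2
    rw [real_inner_comm v (A w)] at h2
    linarith
  refine ⟨hsymm, ?_⟩
  -- Subtracting the quadratic part leaves an additive function, whose linear extension encodes the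
  -- centre.
  let e : facetLattice P →+ ℝ := AddMonoidHom.mk' (fun w => b w - ⟪A w, w⟫ / 2) fun v w => by
    have h1 := hquad w w.2 v v.2
    have h2 := hsymm (v : E) w
    rw [real_inner_comm] at h2
    rw [Submodule.coe_add, h1, map_add, inner_add_left, inner_add_right, inner_add_right]
    linarith [real_inner_comm (v : E) (A w), real_inner_comm (w : E) (A v)]
  obtain ⟨φ, hφ⟩ := exists_linear_extension (facetLattice P) e
  refine ⟨(InnerProductSpace.toDual ℝ E).symm (LinearMap.toContinuousLinearMap φ),
    fun v n hv z hz => ?_⟩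
  have h1 := hφ ⟨v, AddSubgroup.subset_closure ⟨n, hv⟩⟩
  rw [InnerProductSpace.toDual_symm_apply, ← hbv v n hv z hz, LinearMap.coe_toContinuousLinearMap',
    h1]
  change _ = _ + (b v - ⟪A v, v⟫ / 2)
  ring

/-! ### Positivity -/

/-- Along a segment from `P` to `t + P` each crossing changes `⟪A (tr S), y - x⟫` by a nonnegative
amount. Generic endpoints make `y - x` only approximately `t`, hence the limit in `ε`. -/
theorem inner_nonneg_lattice (hT : IsTranslateTiling P T) (h0 : P ∈ T) (hA : IsNormalMap P A) {t : E}
    (ht : t ∈ AddSubgroup.closure (facetVecs P)) : 0 ≤ ⟪A t, t⟫ := by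
  obtain ⟨tr, htr, htr'⟩ := hT.exists_translation
  have htT := (hT.mem_iff_mem_closure h0 t).2 ht
  obtain ⟨p, hp⟩ := hT.interior_body
  obtain ⟨ρ, hρ, hball⟩ := Metric.isOpen_iff.1 isOpen_interior p hp
  have key : ∀ ε > 0, -⟪A t, t⟫ ≤ ε * (2 * ‖A t‖) := by
    intro ε hε
    set δ := min ε ρ with hδ
    have hδ0 : 0 < δ := lt_min hε hρ
    have hsub : Metric.ball p δ ⊆ interior P :=
      (Metric.ball_subset_ball (min_le_right _ _)).trans hball
    obtain ⟨x, hx, y, hy, h⟩ := hT.exists_walk (U := Metric.ball p δ) (V := Metric.ball (t + p) δ)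
      h0 htT Metric.isOpen_ball (Metric.nonempty_ball.2 hδ0) hsub
      Metric.isOpen_ball (Metric.nonempty_ball.2 hδ0) (by
        rw [interior_vadd]
        intro y hy
        refine ⟨y - t, hsub ?_, by simp⟩
        rw [Metric.mem_ball, dist_eq_norm] at hy ⊢
        rwa [sub_sub])
    have h1 := h (fun S₁ S₂ => ⟪A (tr S₁), y - x⟫ ≤ ⟪A (tr S₂), y - x⟫) (fun _ => le_rfl)
      (fun _ _ _ => le_trans) (fun S₁ hS₁ S₂ hS₂ hc n hn hn' hpos => by
        obtain ⟨κ, hκ, hκn⟩ := hA _ n (IsFacetVec.of_eq_vadd (htr _ hS₁) (htr _ hS₂) hc hn hn')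
        rw [← sub_nonneg, ← inner_sub_left, ← map_sub, hκn, inner_smul_left]
        exact mul_nonneg hκ.le hpos)
    have htr0 : tr P = 0 := by
      have := htr' 0 (by rwa [zero_vadd])
      rwa [zero_vadd] at this
    simp only [htr' t htT, htr0, map_zero, inner_zero_left] at h1
    have h2 : y - x = t + ((y - (t + p)) - (x - p)) := by abel
    rw [h2, inner_add_right] at h1
    have h3 := real_inner_le_norm (A t) ((y - (t + p)) - (x - p))
    have h4 := norm_sub_le (y - (t + p)) (x - p)
    rw [Metric.mem_ball, dist_eq_norm] at hx hy
    have h5 : ‖(y - (t + p)) - (x - p)‖ ≤ 2 * ε := by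
      have := min_le_left ε ρ
      linarith
    have h6 := mul_le_mul_of_nonneg_left h5 (norm_nonneg (A t))
    linarith
  by_contra! hneg
  have h1 := key (-⟪A t, t⟫ / (2 * (2 * ‖A t‖ + 1))) (by
    apply div_pos <;> [linarith; positivity])
  have h2 : 0 < 2 * ‖A t‖ + 1 := by positivity
  rw [div_mul_eq_mul_div, le_div_iff₀ (by positivity)] at h1
  nlinarith [norm_nonneg (A t)]

/-- Rounding `k x` to a lattice vector changes the quadratic form by `O(k)` only, so a negative
value at `x` would show up on the lattice for large `k`. -/
theorem isPositive (hT : IsTranslateTiling P T) (h0 : P ∈ T) (hA : IsNormalMap P A) :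
    A.IsPositive := by
  have hs := (hT.isSymmetric_and_bisect h0 hA).1
  refine (LinearMap.isPositive_iff A).2 ⟨hs, fun x => ?_⟩
  by_contra! hneg
  obtain ⟨D, hD⟩ := hT.compact_body.isBounded.exists_norm_le
  have hD0 : 0 ≤ D := by
    obtain ⟨p, hp⟩ := hT.interior_body
    exact (norm_nonneg p).trans (hD p (interior_subset hp))
  set A' := LinearMap.toContinuousLinearMap A with hA'
  obtain ⟨k, hk⟩ := exists_nat_gt ((2 * (‖A x‖ * D) + ‖A'‖ * D * D) / -⟪A x, x⟫ + 1)
  have hk1 : (1 : ℝ) ≤ k := by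
    have : 0 ≤ (2 * (‖A x‖ * D) + ‖A'‖ * D * D) / -⟪A x, x⟫ := by
      apply div_nonneg
      · positivity
      · linarith
    linarith
  have hk2 : 2 * (‖A x‖ * D) + ‖A'‖ * D * D < k * -⟪A x, x⟫ := by
    rw [← div_lt_iff₀ (by linarith)]
    linarith
  obtain ⟨v, hv, hvP⟩ := hT.exists_sub_mem h0 ((k : ℝ) • x)
  obtain ⟨p, hp⟩ : ∃ p, p = (k : ℝ) • x - v := ⟨_, rfl⟩
  rw [← hp] at hvP
  have hv' : v = (k : ℝ) • x - p := by rw [hp]; abel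
  have h1 := hT.inner_nonneg_lattice h0 hA hv
  have h2 : ⟪A p, x⟫ = ⟪A x, p⟫ := by rw [hs p x, real_inner_comm]
  rw [hv', map_sub, map_smul, inner_sub_left, inner_sub_right, inner_sub_right] at h1
  simp only [inner_smul_left, inner_smul_right, conj_trivial, h2] at h1
  have hpD := hD p hvP
  have h3 : -⟪A x, p⟫ ≤ ‖A x‖ * D := by
    have := real_inner_le_norm (-A x) p
    rw [inner_neg_left, norm_neg] at this
    exact this.trans (mul_le_mul_of_nonneg_left hpD (norm_nonneg _))
  have h4 : ⟪A p, p⟫ ≤ ‖A'‖ * D * D := by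
    have h5 := A'.le_opNorm p
    calc ⟪A p, p⟫ ≤ ‖A p‖ * ‖p‖ := real_inner_le_norm _ _
      _ ≤ (‖A'‖ * ‖p‖) * ‖p‖ := mul_le_mul_of_nonneg_right h5 (norm_nonneg _)
      _ ≤ ‖A'‖ * D * D := by gcongr
  have h6 : 0 ≤ ‖A x‖ * D := by positivity
  have h7 : 0 ≤ ‖A'‖ * D * D := by positivity
  nlinarith

/-- By symmetry a kernel vector is orthogonal to all facet normals, so translating by it respects
every facet inequality and maps `P` into itself. -/
theorem eq_zero_of_map_eq_zero (hT : IsTranslateTiling P T) (h0 : P ∈ T) (hA : IsNormalMap P A)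
    {x : E} (hx : A x = 0) : x = 0 := by
  have hs := (hT.isSymmetric_and_bisect h0 hA).1
  refine eq_zero_of_add_subset hT.compact_body.isBounded
    (hT.interior_body.mono interior_subset) fun y hy => ?_
  by_contra hcon
  obtain ⟨v, n, hv, hsep⟩ := hT.exists_facetVec_separating h0 hcon
  obtain ⟨κ, hκ, hκn⟩ := hA v n hv
  obtain ⟨z, hz⟩ := hv.codim.1
  have h1 := hsep z hz
  have h2 := hv.normal.le hy hz
  have h3 : κ * ⟪n, x⟫ = 0 := by
    have := hs v x
    rw [hx, inner_zero_right, hκn, inner_smul_left] at this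
    simpa using this
  rcases mul_eq_zero.1 h3 with h | h
  · exact hκ.ne' h
  · rw [inner_add_right, h] at h1
    linarith

/-- In suitable linear coordinates, `P` is a Dirichlet domain of its lattice. -/
theorem exists_mem_iff_norm_le (hT : IsTranslateTiling P T) (h0 : P ∈ T) (hA : IsNormalMap P A) :
    ∃ (L : E ≃L[ℝ] E) (c : E), ∀ x, x ∈ P ↔
      ∀ q ∈ AddSubgroup.closure (facetVecs P), ‖L (x - c)‖ ≤ ‖L (x - c) - L q‖ := by
  have := hT.discreteTopology h0
  obtain ⟨hs, c', hc'⟩ := hT.isSymmetric_and_bisect h0 hA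
  obtain ⟨B, hB⟩ := exists_sqrt (hT.isPositive h0 hA)
  have hAinj : Function.Injective A := (injective_iff_map_eq_zero A).2 fun x hx =>
    hT.eq_zero_of_map_eq_zero h0 hA hx
  have hBinj : Function.Injective B := (injective_iff_map_eq_zero B).2 fun x hx => by
    refine hT.eq_zero_of_map_eq_zero h0 hA (inner_self_eq_zero (𝕜 := ℝ).1 ?_)
    rw [← hB, hx, inner_zero_left]
  -- Solving `A c = c'` turns the linear term of the bisector equations into a translation of the
  -- centre.
  obtain ⟨c, hc⟩ := LinearMap.surjective_of_injective hAinj c'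
  let L : E ≃L[ℝ] E := (LinearEquiv.ofInjectiveEndo B hBinj).toContinuousLinearEquiv
  have hL : ∀ x y, ⟪L x, L y⟫ = ⟪A x, y⟫ := hB
  -- A point outside `P` violates some facet inequality, which says that it is closer to that facet
  -- vector than to 0.
  have hD : ∀ x, (∀ q ∈ AddSubgroup.closure (facetVecs P), ‖L (x - c)‖ ≤ ‖L (x - c) - L q‖) →
      x ∈ P := by
    intro x hx
    by_contra hcon
    obtain ⟨v, n, hv, hsep⟩ := hT.exists_facetVec_separating h0 hcon
    obtain ⟨κ, hκ, hκn⟩ := hA v n hv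
    obtain ⟨z, hz⟩ := hv.codim.1
    have h1 := mul_lt_mul_of_pos_left (hsep z hz) hκ
    have h2 := hx v (AddSubgroup.subset_closure ⟨n, hv⟩)
    have h3 := (norm_sub_le_norm_sub_iff (L (x - c)) 0 (L v)).1 (by simpa using h2)
    rw [sub_zero, ← real_inner_self_eq_norm_sq, real_inner_comm, hL, hL, inner_sub_right] at h3
    have h4 := hc' v n hv z hz
    rw [← hc, hs c v, real_inner_comm (A v) c] at h4
    have h5 : ∀ y, ⟪A v, y⟫ = κ * ⟪n, y⟫ := fun y => by rw [hκn, inner_smul_left, conj_trivial]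
    rw [← h5, ← h5] at h1
    linarith
  refine ⟨L, c, fun x => ⟨?_, hD x⟩⟩
  have hclosed : IsClosed {x | ∀ q ∈ AddSubgroup.closure (facetVecs P),
      ‖L (x - c)‖ ≤ ‖L (x - c) - L q‖} := by
    simp only [ofPred_forall]
    exact isClosed_biInter fun q _ => isClosed_le (by fun_prop) (by fun_prop)
  have hcl : P = closure (interior P) := by
    rw [hT.convex_body.closure_interior_eq_closure_of_nonempty_interior hT.interior_body,
      hT.compact_body.isClosed.closure_eq]
  intro hx
  rw [hcl] at hx
  refine closure_minimal (t := {x | ∀ q ∈ AddSubgroup.closure (facetVecs P),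
      ‖L (x - c)‖ ≤ ‖L (x - c) - L q‖}) (fun x hx => ?_) hclosed hx
  have hΛ : IsClosed (AddSubgroup.closure (facetVecs P) : Set E) := by
    have : DiscreteTopology (AddSubgroup.closure (facetVecs P)) := this
    exact AddSubgroup.isClosed_of_discrete
  -- For interior `x`, subtracting a nearest lattice point `w` lands in the Dirichlet domain, hence
  -- in `P`. The tiling then forces `w = 0`; boundary points follow by closure.
  obtain ⟨_, ⟨w, hw, rfl⟩, hmin⟩ := (L.toHomeomorph.isClosedMap _ hΛ).exists_infDist_eq_dist
    ⟨_, mem_image_of_mem _ (zero_mem (AddSubgroup.closure (facetVecs P)))⟩ (L (x - c))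
  have hle : ∀ q ∈ AddSubgroup.closure (facetVecs P), ‖L (x - c) - L w‖ ≤ ‖L (x - c) - L q‖ := by
    intro q hq
    have h1 := Metric.infDist_le_dist_of_mem (x := L (x - c))
      (mem_image_of_mem L.toHomeomorph hq)
    rw [hmin, dist_eq_norm, dist_eq_norm] at h1
    exact h1
  have hmem : x - w ∈ P := hD _ fun q hq => by
    have h1 := hle (w + q) (AddSubgroup.add_mem _ hw hq)
    rwa [map_add, ← sub_sub, ← map_sub, sub_right_comm] at h1
  have hw0 := hT.mem_interior_unique h0 hw hx hmem
  intro q hq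
  have h1 := hle q hq
  rwa [hw0, map_zero, sub_zero] at h1

end IsTranslateTiling

/-! ### A canonical scaling makes `P` an affine Voronoi parallelohedron -/

variable {d : ℕ}

theorem exists_isNormalMap {P : Set (EuclideanSpace ℝ (Fin d))}
    {T : Set (Set (EuclideanSpace ℝ (Fin d)))} (hT : IsTranslateTiling P T) (h0 : P ∈ T)
    {s : Set (EuclideanSpace ℝ (Fin d)) → ℝ} (hs : IsCanonicalScaling T s) :
    ∃ A, IsNormalMap P A := by
  obtain ⟨a, ha⟩ := hT.exists_gradient s fun G hG ω n hω hn => by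
    have h1 := hs.2 G (isTilingFace_iff.2 ⟨hG.codim, hG.exposed⟩) n
      (areCoherentNormals_iff.2 ⟨ω, hω, hn⟩)
    unfold torsion at h1
    rwa [facetsAround_eq] at h1
  have hα : IsGradient P fun t => a (t +ᵥ P) := ⟨fun t ht v n hv => by
    have hQ := (hT.mem_iff_mem_closure h0 t).2 ht
    obtain ⟨h1, h2, h3⟩ := hv.vadd t
    exact ⟨_, hs.1 _ (isTilingFace_iff.2 ⟨h1, _, hQ, h2.isExposed⟩),
      ha _ hQ _ (hT.add_mem hQ hv) n h1 h2 h3⟩⟩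
  obtain ⟨g, hg⟩ := hα.exists_relation_map hT.compact_body.isBounded hT.interior_body
    (hT.finite_facetVecs h0)
  have := hT.discreteTopology h0
  have := hT.isZLattice h0
  obtain ⟨A, hA⟩ := exists_linear_extension (facetLattice P) g
  refine ⟨A, fun v n hv => ?_⟩
  obtain ⟨κ, hκ, h⟩ := hg v n hv
  exact ⟨κ, hκ, by rw [← h]; exact hA ⟨v, AddSubgroup.subset_closure ⟨n, hv⟩⟩⟩

theorem voronoiConjectureHoldsFor_of_mem {P : Set (EuclideanSpace ℝ (Fin d))}
    {T : Set (Set (EuclideanSpace ℝ (Fin d)))} (hT : IsTranslateTiling P T) (h0 : P ∈ T)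
    {s : Set (EuclideanSpace ℝ (Fin d)) → ℝ} (hs : IsCanonicalScaling T s) :
    VoronoiConjectureHoldsFor P := by
  obtain ⟨A, hA⟩ := exists_isNormalMap hT h0 hs
  have := hT.discreteTopology h0
  have := hT.isZLattice h0
  obtain ⟨L, c, hLc⟩ := hT.exists_mem_iff_norm_le h0 hA
  refine ⟨(AffineEquiv.constVAdd ℝ _ (-c)).trans L.toLinearEquiv.toAffineEquiv,
    -- The preimage under the inverse of `L`, that is, the image lattice; the centre `c` is moved to
    -- its point 0.
    ZLattice.comap ℝ (facetLattice P) L.symm.toLinearMap, inferInstance, inferInstance, 0,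
    zero_mem _, ?_⟩
  have hf : ∀ x, ((AffineEquiv.constVAdd ℝ _ (-c)).trans L.toLinearEquiv.toAffineEquiv) x =
      L (x - c) := fun x => by
    simp [neg_add_eq_sub]
  ext y
  constructor
  · rintro ⟨x, hx, rfl⟩ q hq
    rw [hf, sub_zero]
    have h1 := (hLc x).1 hx (L.symm q) hq
    rwa [L.apply_symm_apply] at h1
  · intro hy
    refine ⟨L.symm y + c, (hLc _).2 fun q hq => ?_, ?_⟩
    · have h1 := hy (L q) (by
        change L.symm (L q) ∈ facetLattice P
        rw [L.symm_apply_apply]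
        exact hq)
      rw [add_sub_cancel_right, L.apply_symm_apply]
      rwa [sub_zero] at h1
    · rw [hf, add_sub_cancel_right, L.apply_symm_apply]

/-! ### Reduction to a cell of the tiling -/

theorem IsTranslateTiling.vadd {P : Set E} {T : Set (Set E)} (hT : IsTranslateTiling P T) (t : E) :
    IsTranslateTiling (t +ᵥ P) T where
  toIsFaceTiling := hT.toIsFaceTiling
  convex_body := hT.convex_body.vadd t
  compact_body := hT.compact_body.vadd t
  interior_body := by
    rw [interior_vadd]
    exact hT.interior_body.vadd_set
  translate Q hQ := by
    obtain ⟨u, rfl⟩ := hT.translate Q hQ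
    exact ⟨u - t, by rw [vadd_vadd, sub_add_cancel]⟩

theorem voronoiConjectureHoldsFor_of_vadd {P : Set (EuclideanSpace ℝ (Fin d))}
    {t : EuclideanSpace ℝ (Fin d)} (h : VoronoiConjectureHoldsFor (t +ᵥ P)) :
    VoronoiConjectureHoldsFor P := by
  obtain ⟨f, hf⟩ := h
  refine ⟨(AffineEquiv.constVAdd ℝ _ t).trans f, ?_⟩
  rwa [AffineEquiv.coe_trans, image_comp]

theorem voronoiConjectureHoldsFor_of_isCanonicalScaling {P : Set (EuclideanSpace ℝ (Fin d))}
    {T : Set (Set (EuclideanSpace ℝ (Fin d)))} (hT : IsTranslateTiling P T)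
    {s : Set (EuclideanSpace ℝ (Fin d)) → ℝ} (hs : IsCanonicalScaling T s) :
    VoronoiConjectureHoldsFor P := by
  -- The body `P` itself need not be a cell; some translate is, and the conclusion is invariant
  -- under translation.
  obtain ⟨Q, hQ, -⟩ := hT.cover 0
  obtain ⟨t, rfl⟩ := hT.translate Q hQ
  exact voronoiConjectureHoldsFor_of_vadd (voronoiConjectureHoldsFor_of_mem (hT.vadd t) hQ hs)

end Parallelohedron

theorem mainTheorem1 (d : ℕ) (P : Set (EuclideanSpace ℝ (Fin d))) (hP : IsParallelohedron P)
    (T : Set (Set (EuclideanSpace ℝ (Fin d)))) (hT : IsNormalTranslateTiling P T) :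
    VoronoiConjectureHoldsFor P ↔
      ∃ s : Set (EuclideanSpace ℝ (Fin d)) → ℝ, IsCanonicalScaling T s := by
  have hT' := Parallelohedron.isTranslateTiling_of_normal hP.1 hT
  exact ⟨Parallelohedron.exists_isCanonicalScaling hT',
    fun ⟨_, hs⟩ => Parallelohedron.voronoiConjectureHoldsFor_of_isCanonicalScaling hT' hs⟩
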